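/- **Proposition (the 2-local ergotropic gap bounds mutual information).** Consider $N$ bosonic modes with Hilbert space $L^2(\mathbb R^N)$, quadratures $R=(q_1,\dots,q_N,p_1,\dots,p_N)$, $[q_k,p_l]=i\delta_{kl}$, Weyl operators $W(\xi)=e^{i\xi\cdot R}$ $(\xi\in\mathbb R^{2N})$ and Hamiltonian $H=\frac12\sum_{k=1}^N(q_k^2+p_k^2)$. Let the modes be partitioned into two non-empty sets $\mathcal A_1|\mathcal A_2$, and let $\rho=|\psi\rangle\langle\psi|$ be a pure Gaussian state with zero displacement, i.e. $\|\psi\|=1$ and, for some real symmetric matrix $\Sigma$ (the covariance matrix), $\langle\psi,W(\xi)\psi\rangle=e^{-\frac14\xi^{T}\Sigma\xi}$ for all $\xi$. A Gaussian unitary is a unitary $U$ for which there are a symplectic matrix $S$ and a vector $d$ with $U\,W(\xi)\,U^{-1}=e^{i d\cdot\xi}\,W(S\xi)$ for all $\xi$. Put $$\mathcal E_G(\rho)=\operatorname{Tr}(\rho H)-\inf_{U}\operatorname{Tr}(U\rho U^\dagger H),\qquad \mathcal E_{2\text{-loc}}^{\mathcal A_1|\mathcal A_2}(\rho)=\operatorname{Tr}(\rho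 H)-\inf_{U_1\otimes U_2}\operatorname{Tr}\big((U_1\otimes U_2)\rho(U_1\otimes U_2)^\dagger H\big),$$ where $U$ runs over the Gaussian unitaries on all modes and $U_j$ over the Gaussian unitaries on the modes in $\mathcal A_j$, and let $\delta_{2\text{-loc}}^{\mathcal A_1|\mathcal A_2}(\rho)=\mathcal E_G(\rho)-\mathcal E_{2\text{-loc}}^{\mathcal A_1|\mathcal A_2}(\rho)$ be the 2-local ergotropic gap. Let $\rho_{\mathcal A_1},\rho_{\mathcal A_2}$ be the reduced states of $\rho$, $S(\sigma)=-\operatorname{Tr}(\sigma\ln\sigma)$ the von Neumann entropy, and $\mathrm{MI}(\rho)=S(\rho_{\mathcal A_1})+S(\rho_{\mathcal A_2})-S(\rho)$ the quantum mutual information. Then $\operatorname{Tr}(\rho H)$ and the three entropies are finite, and $$\tfrac12\,\mathrm{MI}(\rho)\;<\;\delta_{2\text{-loc}}^{\mathcal A_1|\mathcal A_2}(\rho)+\min\{|\mathcal A_1|,|\mathcal A_2|\},$$ where $|\mathcal A_j|$ is the number of modes in $\mathcal A_j$. -/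

import Mathlib

open MeasureTheory Filter Topology
open scoped ENNReal InnerProductSpace

noncomputable section

namespace GaussianErgotropy

/-- The Hilbert space `L²(ℝ^ι)` of a system of bosonic modes labelled by `ι`
(Schrödinger representation). -/
abbrev Modes (ι : Type) [Fintype ι] : Type := Lp ℂ 2 (volume : Measure (ι → ℝ))

section Weyl

variable {ι : Type} [Fintype ι]

theorem memLp_weyl (ξ : ι ⊕ ι → ℝ) (φ : Modes ι) :
    MemLp (fun x : ι → ℝ =>
      Complex.exp (Complex.I * (((∑ i, ξ (.inl i) * x i)
        + (∑ i, ξ (.inl i) * ξ (.inr i)) / 2 : ℝ) : ℂ)) *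
        φ (fun i => x i + ξ (.inr i))) 2 volume := by
  have h : MemLp (fun x : ι → ℝ => φ (x + fun i => ξ (.inr i))) 2 volume :=
    (Lp.memLp φ).comp_measurePreserving
      (measurePreserving_add_right (volume : Measure (ι → ℝ)) (fun i => ξ (.inr i)))
  refine h.congr_norm ?_ ?_
  · refine AEStronglyMeasurable.mul ?_ h.1
    exact (by fun_prop : Continuous fun x : ι → ℝ =>
      Complex.exp (Complex.I * (((∑ i, ξ (.inl i) * x i)
        + (∑ i, ξ (.inl i) * ξ (.inr i)) / 2 : ℝ) : ℂ))).aestronglyMeasurable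
  · refine Eventually.of_forall fun x => ?_
    simp only [norm_mul, mul_comm Complex.I, Complex.norm_exp_ofReal_mul_I, one_mul]
    rfl

/-- The Weyl operator `W(ξ) = exp (i (∑ᵢ uᵢ qᵢ + ∑ᵢ vᵢ pᵢ))` for the phase-space vector `ξ = (u, v)`
(position part `u = ξ ∘ inl`, momentum part `v = ξ ∘ inr`), where `q` is multiplication by the
coordinate and `p = -i ∂`, so that `[q, p] = i`:
`(W(ξ) φ)(x) = exp (i (u·x + u·v / 2)) φ (x + v)`. -/
def weyl (ξ : ι ⊕ ι → ℝ) (φ : Modes ι) : Modes ι :=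
  (memLp_weyl ξ φ).toLp _

/-- `ψ` is a displacement-free pure Gaussian state with covariance matrix `Γ`: a unit vector whose
characteristic function is `⟨ψ, W(ξ) ψ⟩ = exp (-ξᵀ Γ ξ / 4)`. The normalisation is
`Γ_kl = ⟨R_k R_l + R_l R_k⟩` with `R = (q, p)`; the vacuum has `Γ = 1`. -/
def IsPureGaussianWithCov (ψ : Modes ι) (Γ : Matrix (ι ⊕ ι) (ι ⊕ ι) ℝ) : Prop :=
  ‖ψ‖ = 1 ∧ Γ.IsSymm ∧
    ∀ ξ : ι ⊕ ι → ℝ, ⟪ψ, weyl ξ ψ⟫_ℂ = ((Real.exp (-(ξ ⬝ᵥ Γ.mulVec ξ) / 4) : ℝ) : ℂ)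

/-- Displacement-free pure Gaussian states (as unit vectors). -/
def IsPureGaussian (ψ : Modes ι) : Prop :=
  ∃ Γ : Matrix (ι ⊕ ι) (ι ⊕ ι) ℝ, IsPureGaussianWithCov ψ Γ

variable [DecidableEq ι]

/-- A Gaussian unitary: a unitary that acts on the quadratures as an affine symplectic map,
written in exponentiated form `U W(ξ) U⁻¹ = exp (i d·ξ) W(S ξ)`. -/
def IsGaussianUnitary (U : Modes ι ≃ₗᵢ[ℂ] Modes ι) : Prop :=
  ∃ S ∈ Matrix.symplecticGroup ι ℝ, ∃ d : ι ⊕ ι → ℝ, ∀ (ξ : ι ⊕ ι → ℝ) (φ : Modes ι),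
    U (weyl ξ φ) = Complex.exp (Complex.I * ((d ⬝ᵥ ξ : ℝ) : ℂ)) • weyl (S.mulVec ξ) (U φ)

/-- `φ` is in the domain of the quadrature operator `R_k` and `R_k φ = η`, where
`R = (q, p)` and `R_k` is the self-adjoint (Stone) generator of the one-parameter unitary group
`t ↦ W(t e_k) = exp (i t R_k)`. -/
def IsQuadratureImage (k : ι ⊕ ι) (φ η : Modes ι) : Prop :=
  Tendsto (fun t : ℝ => (Complex.I * (t : ℂ))⁻¹ • (weyl (t • Pi.single k (1 : ℝ)) φ - φ))
    (𝓝[≠] 0) (𝓝 η)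

/-- `⟨φ, R_k² φ⟩ = ‖R_k φ‖²` in the sense of quadratic forms; it is `∞` outside the domain of
`R_k`. -/
def quadratureSq (k : ι ⊕ ι) (φ : Modes ι) : ℝ≥0∞ :=
  ⨅ (η : Modes ι) (_ : IsQuadratureImage k φ η), ENNReal.ofReal (‖η‖ ^ 2)

/-- The mean energy `Tr (|φ⟩⟨φ| H) = ⟨φ, H φ⟩` for `H = ½ ∑ᵢ (qᵢ² + pᵢ²)`. -/
def energy (φ : Modes ι) : ℝ≥0∞ :=
  2⁻¹ * ∑ k : ι ⊕ ι, quadratureSq k φ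

/-- The least energy reachable by global Gaussian unitaries. -/
def globalMinEnergy (ψ : Modes ι) : ℝ≥0∞ :=
  ⨅ (U : Modes ι ≃ₗᵢ[ℂ] Modes ι) (_ : IsGaussianUnitary U), energy (U ψ)

/-- Global Gaussian ergotropy. -/
def globalErgotropy (ψ : Modes ι) : ℝ :=
  (energy ψ).toReal - (globalMinEnergy ψ).toReal

end Weyl

section Bipartite

variable {α β : Type} [Fintype α] [Fintype β]

theorem integrable_tensor {f : (α → ℝ) → ℝ} {g : (β → ℝ) → ℝ}
    (hf : Integrable f) (hg : Integrable g) :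
    Integrable (fun z : α ⊕ β → ℝ => f (fun i => z (.inl i)) * g (fun j => z (.inr j))) ∧
    ∫ z : α ⊕ β → ℝ, f (fun i => z (.inl i)) * g (fun j => z (.inr j)) =
      (∫ x, f x) * ∫ y, g y := by
  have hmp := volume_measurePreserving_sumPiEquivProdPi (fun _ : α ⊕ β => ℝ)
  constructor
  · exact hmp.integrable_comp_of_integrable (hf.mul_prod hg)
  · rw [← integral_prod_mul f g]
    exact hmp.integral_comp (MeasurableEquiv.sumPiEquivProdPi _).measurableEmbedding
      (fun p : (α → ℝ) × (β → ℝ) => f p.1 * g p.2)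

theorem quasiMeasurePreserving_inl :
    Measure.QuasiMeasurePreserving (fun (z : α ⊕ β → ℝ) (i : α) => z (.inl i))
      volume volume :=
  Measure.quasiMeasurePreserving_fst.comp
    (volume_measurePreserving_sumPiEquivProdPi (fun _ : α ⊕ β => ℝ)).quasiMeasurePreserving

theorem quasiMeasurePreserving_inr :
    Measure.QuasiMeasurePreserving (fun (z : α ⊕ β → ℝ) (j : β) => z (.inr j))
      volume volume :=
  Measure.quasiMeasurePreserving_snd.comp
    (volume_measurePreserving_sumPiEquivProdPi (fun _ : α ⊕ β => ℝ)).quasiMeasurePreserving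

theorem memLp_tensor (φ : Modes α) (χ : Modes β) :
    MemLp (fun z : α ⊕ β → ℝ => φ (fun i => z (.inl i)) * χ (fun j => z (.inr j))) 2 volume := by
  have hm : AEStronglyMeasurable
      (fun z : α ⊕ β → ℝ => φ (fun i => z (.inl i)) * χ (fun j => z (.inr j))) volume :=
    ((Lp.aestronglyMeasurable φ).comp_quasiMeasurePreserving quasiMeasurePreserving_inl).mul
      ((Lp.aestronglyMeasurable χ).comp_quasiMeasurePreserving quasiMeasurePreserving_inr)
  rw [memLp_two_iff_integrable_sq_norm hm]
  simp only [norm_mul, mul_pow]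
  exact (integrable_tensor (f := fun x => ‖φ x‖ ^ 2) (g := fun y => ‖χ y‖ ^ 2)
    ((memLp_two_iff_integrable_sq_norm (Lp.aestronglyMeasurable φ)).1 (Lp.memLp φ))
    ((memLp_two_iff_integrable_sq_norm (Lp.aestronglyMeasurable χ)).1 (Lp.memLp χ))).1

theorem norm_sq_modes {ι : Type} [Fintype ι] (φ : Modes ι) : ‖φ‖ ^ 2 = ∫ x, ‖φ x‖ ^ 2 := by
  have h := congrArg Complex.re (inner_self_eq_norm_sq_to_K (𝕜 := ℂ) φ)
  rw [L2.inner_def] at h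
  have h2 : ∀ x, ⟪φ x, φ x⟫_ℂ = ((‖φ x‖ ^ 2 : ℝ) : ℂ) := fun x => by
    rw [inner_self_eq_norm_sq_to_K]; norm_cast
  simp only [h2, integral_complex_ofReal] at h
  rw [Complex.ofReal_re] at h
  rw [h]
  norm_cast

/-- The tensor product `(φ ⊗ χ)(x, y) = φ(x) χ(y)`, as a continuous bilinear map
`L²(ℝ^α) × L²(ℝ^β) → L²(ℝ^(α ⊕ β))`. -/
def tensor : Modes α →L[ℂ] Modes β →L[ℂ] Modes (α ⊕ β) :=
  LinearMap.mkContinuous₂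
    (LinearMap.mk₂ ℂ (fun (φ : Modes α) (χ : Modes β) => (memLp_tensor φ χ).toLp _)
      (fun φ₁ φ₂ χ => by
        rw [← MemLp.toLp_add, MemLp.toLp_eq_toLp_iff]
        filter_upwards [quasiMeasurePreserving_inl.ae (Lp.coeFn_add φ₁ φ₂)] with z hz
        simp only [Pi.add_apply] at hz ⊢
        rw [hz, add_mul])
      (fun c φ χ => by
        rw [← MemLp.toLp_const_smul, MemLp.toLp_eq_toLp_iff]
        filter_upwards [quasiMeasurePreserving_inl.ae (Lp.coeFn_smul c φ)] with z hz
        simp only [Pi.smul_apply, smul_eq_mul] at hz ⊢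
        rw [hz, mul_assoc])
      (fun φ χ₁ χ₂ => by
        rw [← MemLp.toLp_add, MemLp.toLp_eq_toLp_iff]
        filter_upwards [quasiMeasurePreserving_inr.ae (Lp.coeFn_add χ₁ χ₂)] with z hz
        simp only [Pi.add_apply] at hz ⊢
        rw [hz, mul_add])
      (fun c φ χ => by
        rw [← MemLp.toLp_const_smul, MemLp.toLp_eq_toLp_iff]
        filter_upwards [quasiMeasurePreserving_inr.ae (Lp.coeFn_smul c χ)] with z hz
        simp only [Pi.smul_apply, smul_eq_mul] at hz ⊢
        rw [hz, mul_left_comm]))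
    1
    (fun φ χ => by
      rw [one_mul]
      refine le_of_eq ((sq_eq_sq₀ (norm_nonneg _) (by positivity)).1 ?_)
      rw [LinearMap.mk₂_apply, norm_sq_modes, mul_pow, norm_sq_modes φ, norm_sq_modes χ]
      rw [← (integrable_tensor (f := fun x => ‖φ x‖ ^ 2) (g := fun y => ‖χ y‖ ^ 2)
        ((memLp_two_iff_integrable_sq_norm (Lp.aestronglyMeasurable φ)).1 (Lp.memLp φ))
        ((memLp_two_iff_integrable_sq_norm (Lp.aestronglyMeasurable χ)).1 (Lp.memLp χ))).2]
      refine integral_congr_ae ?_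
      filter_upwards [(memLp_tensor φ χ).coeFn_toLp] with z hz
      rw [hz, norm_mul, mul_pow])

section Local

variable [DecidableEq α] [DecidableEq β]

/-- A 2-local Gaussian unitary `U = U₁ ⊗ U₂` for the bipartition `α | β`. -/
def IsLocalGaussianUnitary (U : Modes (α ⊕ β) ≃ₗᵢ[ℂ] Modes (α ⊕ β)) : Prop :=
  ∃ (U₁ : Modes α ≃ₗᵢ[ℂ] Modes α) (U₂ : Modes β ≃ₗᵢ[ℂ] Modes β),
    IsGaussianUnitary U₁ ∧ IsGaussianUnitary U₂ ∧
      ∀ φ χ, U (tensor φ χ) = tensor (U₁ φ) (U₂ χ)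

/-- The least energy reachable by 2-local Gaussian unitaries. -/
def localMinEnergy (ψ : Modes (α ⊕ β)) : ℝ≥0∞ :=
  ⨅ (U : Modes (α ⊕ β) ≃ₗᵢ[ℂ] Modes (α ⊕ β)) (_ : IsLocalGaussianUnitary U), energy (U ψ)

/-- 2-local Gaussian ergotropy for the bipartition `α | β`. -/
def localErgotropy (ψ : Modes (α ⊕ β)) : ℝ :=
  (energy ψ).toReal - (localMinEnergy ψ).toReal

/-- The 2-local ergotropic gap: global minus 2-local Gaussian ergotropy. -/
def ergotropicGap (ψ : Modes (α ⊕ β)) : ℝ :=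
  globalErgotropy ψ - localErgotropy ψ

end Local

end Bipartite

section Entropy

variable (H : Type) [NormedAddCommGroup H] [InnerProductSpace ℂ H] [CompleteSpace H]

/-- Index set of a fixed Hilbert basis of `H`. -/
def basisSet : Set H := (exists_hilbertBasis ℂ H).choose

/-- A fixed Hilbert basis of `H`; the traces below do not depend on it. -/
def basis : HilbertBasis (basisSet H) ℂ H := (exists_hilbertBasis ℂ H).choose_spec.choose

variable {H}

/-- The trace of a positive operator, in `[0, ∞]`. -/
def posTrace (T : H →L[ℂ] H) : ℝ≥0∞ :=
  ∑' i, ENNReal.ofReal (⟪basis H i, T (basis H i)⟫_ℂ).re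

/-- The von Neumann entropy `-Tr (T log T)` of a density operator (natural logarithm), through the
continuous functional calculus for `x ↦ -x log x`. -/
def vonNeumannEntropy (T : H →L[ℂ] H) : ℝ≥0∞ :=
  posTrace (cfc Real.negMulLog T)

/-- The density operator `|ψ⟩⟨ψ|`. -/
def pureState (ψ : H) : H →L[ℂ] H := InnerProductSpace.rankOne ℂ ψ ψ

end Entropy

section Reduced

variable {α β : Type} [Fintype α] [Fintype β]

/-- The reduced state `Tr_β ρ = ∑ⱼ (1 ⊗ ⟨fⱼ|) ρ (1 ⊗ |fⱼ⟩)` on the modes `α`, with `f` a Hilbert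
basis of `L²(ℝ^β)`; the series converges in norm for trace-class `ρ`. -/
def reducedLeft (ρ : Modes (α ⊕ β) →L[ℂ] Modes (α ⊕ β)) : Modes α →L[ℂ] Modes α :=
  ∑' j, ContinuousLinearMap.adjoint (tensor.flip (basis (Modes β) j)) ∘L ρ ∘L
    tensor.flip (basis (Modes β) j)

/-- The reduced state `Tr_α ρ` on the modes `β`. -/
def reducedRight (ρ : Modes (α ⊕ β) →L[ℂ] Modes (α ⊕ β)) : Modes β →L[ℂ] Modes β :=
  ∑' i, ContinuousLinearMap.adjoint (tensor (basis (Modes α) i)) ∘L ρ ∘L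
    tensor (basis (Modes α) i)

/-- The quantum mutual information `S(ρ_α) + S(ρ_β) - S(ρ)`. -/
def mutualInformation (ρ : Modes (α ⊕ β) →L[ℂ] Modes (α ⊕ β)) : ℝ :=
  (vonNeumannEntropy (reducedLeft ρ)).toReal + (vonNeumannEntropy (reducedRight ρ)).toReal
    - (vonNeumannEntropy ρ).toReal

end Reduced

end GaussianErgotropy

end

/-!
Difference quotients of the Weyl operators replace the unbounded quadratures. The canonical
commutation relations hold for them in the limit, and `⟨q²⟩ + ⟨p²⟩ ≥ 1` in every mode.

*Global minimum.* Purity makes the autocorrelation of `ψ` a Gaussian of the same width as the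
characteristic function, which ties the momentum block of the covariance matrix to its other
blocks. A squeeze followed by a chirp, both read off from the position block and the
position-momentum correlations, is then a Gaussian unitary taking the state to one with covariance
`1`. Hence the global minimum is at most `(|α| + |β|) / 2`; Williamson's normal form is not needed.

*Local minimum.* Let `S` be the Shannon entropy of the Schmidt weights `rⱼ`; both reduced states
have entropy `S`, so half the mutual information is `S`. Smear the reduced state on `α` with
coherent states. Its Husimi function has energy larger by `|α| / 2`, and Gibbs' inequality against
`(2π)^(-|α|) exp (-(q² + p²) / 2)` gives `S + c ≤ E_α + |α| / 2`, where the remainder `c > 0`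
depends on the `rⱼ` only. Local unitaries preserve the Schmidt weights, so the bound survives the
infimum, strictly. The modes in `β` contribute at least `|β| / 2` to the energy by the uncertainty
relation.
-/

noncomputable section

namespace GaussianErgotropy

section Plancherel

open scoped FourierTransform SchwartzMap ContDiff

theorem Lp_fourier_toLp_ae_eq {V : Type*} [NormedAddCommGroup V] [InnerProductSpace ℝ V]
    [FiniteDimensional ℝ V] [MeasurableSpace V] [BorelSpace V] {f : V → ℂ}
    (hf₁ : Integrable f) (hf₂ : MemLp f 2) :
    ((𝓕 (hf₂.toLp f) : Lp ℂ 2 (volume : Measure V)) : V → ℂ) =ᵐ[volume] 𝓕 f := by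
  refine ae_eq_of_integral_contDiff_smul_eq ?_ ?_ fun g hg hgs => ?_
  · exact (Lp.memLp _).locallyIntegrable (by norm_num)
  · exact (VectorFourier.fourierIntegral_continuous Real.continuous_fourierChar
      (by exact continuous_inner) hf₁).locallyIntegrable
  have hgs' : HasCompactSupport (fun x => (g x : ℂ)) := hgs.comp_left (g := Complex.ofReal) rfl
  let G : 𝓢(V, ℂ) := hgs'.toSchwartzMap (Complex.ofRealCLM.contDiff.comp hg)
  have real_smul : ∀ F : V → ℂ, ∫ x, g x • F x = ∫ x, G x • F x := fun F => by
    refine integral_congr_ae (Eventually.of_forall fun x => ?_)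
    simp only [Complex.real_smul, smul_eq_mul]
    rfl
  have distribution_eq := congrArg (fun T : 𝓢'(V, ℂ) => T G)
    (Lp.fourier_toTemperedDistribution_eq (hf₂.toLp f))
  simp only [TemperedDistribution.fourier_apply, Lp.toTemperedDistribution_apply]
    at distribution_eq
  have toLp_eq : ∫ x, (𝓕 G) x • (hf₂.toLp f : V → ℂ) x = ∫ x, (𝓕 G) x • f x :=
    integral_congr_ae (by filter_upwards [hf₂.coeFn_toLp] with x hx; rw [hx])
  rw [real_smul, real_smul, ← distribution_eq, toLp_eq]
  simpa using! VectorFourier.integral_fourierIntegral_smul_eq_flip (L := innerₗ V)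
    Real.continuous_fourierChar continuous_inner G.integrable hf₁

variable {ι : Type*} [Fintype ι]

/-- The Fourier transform `k ↦ ∫ exp (-2πi k·y) G(y) dy` on `ℝ^ι`. It is kept separate from `𝓕`
because `ι → ℝ`, on which the modes live, carries the sup norm and no inner product. -/
def coordFourier (G : (ι → ℝ) → ℂ) (k : ι → ℝ) : ℂ :=
  ∫ y, Complex.exp (((-(2 * Real.pi * (k ⬝ᵥ y)) : ℝ) : ℂ) * Complex.I) * G y

theorem coordFourier_eq_fourier (G : (ι → ℝ) → ℂ) (k : ι → ℝ) :
    coordFourier G k =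
      𝓕 (fun x : EuclideanSpace ℝ ι => G (WithLp.ofLp x)) (WithLp.toLp 2 k) := by
  rw [Real.fourier_eq', coordFourier,
    ← (PiLp.volume_preserving_ofLp ι).integral_comp
      (MeasurableEquiv.toLp 2 (ι → ℝ)).symm.measurableEmbedding]
  refine integral_congr_ae (Eventually.of_forall fun x => ?_)
  simp only [smul_eq_mul, EuclideanSpace.inner_eq_star_dotProduct]
  congr 3
  simp

theorem exists_Lp_fourier_ae_eq_coordFourier {G : (ι → ℝ) → ℂ} (hG₁ : Integrable G)
    (hG₂ : MemLp G 2) : ∃ g : Lp ℂ 2 (volume : Measure (EuclideanSpace ℝ ι)),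
      (g : EuclideanSpace ℝ ι → ℂ) =ᵐ[volume] (fun x => G (WithLp.ofLp x)) ∧
      (fun k => (𝓕 g : Lp ℂ 2 (volume : Measure (EuclideanSpace ℝ ι))) (WithLp.toLp 2 k))
        =ᵐ[volume] coordFourier G := by
  have euclidean := PiLp.volume_preserving_ofLp ι
  have hG₁' := euclidean.integrable_comp_of_integrable hG₁
  have hG₂' := hG₂.comp_measurePreserving euclidean
  refine ⟨hG₂'.toLp _, hG₂'.coeFn_toLp, ?_⟩
  refine ((PiLp.volume_preserving_toLp ι).quasiMeasurePreserving.ae_eq_comp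
    (Lp_fourier_toLp_ae_eq hG₁' hG₂')).trans (Eventually.of_forall fun k => ?_)
  exact (coordFourier_eq_fourier G k).symm

theorem memLp_coordFourier {G : (ι → ℝ) → ℂ} (hG₁ : Integrable G) (hG₂ : MemLp G 2) :
    MemLp (coordFourier G) 2 := by
  obtain ⟨g, -, hg⟩ := exists_Lp_fourier_ae_eq_coordFourier hG₁ hG₂
  exact ((Lp.memLp _).comp_measurePreserving (PiLp.volume_preserving_toLp ι)).ae_eq hg

theorem integral_star_coordFourier_mul {G K : (ι → ℝ) → ℂ} (hG₁ : Integrable G)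
    (hG₂ : MemLp G 2) (hK₁ : Integrable K) (hK₂ : MemLp K 2) :
    ∫ k, star (coordFourier G k) * coordFourier K k = ∫ y, star (G y) * K y := by
  obtain ⟨g, hg, hFg⟩ := exists_Lp_fourier_ae_eq_coordFourier hG₁ hG₂
  obtain ⟨h, hh, hFh⟩ := exists_Lp_fourier_ae_eq_coordFourier hK₁ hK₂
  have parseval := Lp.inner_fourier_eq g h
  rw [L2.inner_def, L2.inner_def] at parseval
  calc ∫ k, star (coordFourier G k) * coordFourier K k
      = ∫ x, ⟪(𝓕 g : Lp ℂ 2 (volume : Measure (EuclideanSpace ℝ ι))) x,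
          (𝓕 h : Lp ℂ 2 (volume : Measure (EuclideanSpace ℝ ι))) x⟫_ℂ := by
        rw [← (PiLp.volume_preserving_toLp ι).integral_comp
          (MeasurableEquiv.toLp 2 (ι → ℝ)).measurableEmbedding]
        refine integral_congr_ae ?_
        filter_upwards [hFg, hFh] with k hgk hhk
        rw [hgk, hhk, RCLike.inner_apply, mul_comm]; rfl
    _ = ∫ x, ⟪g x, h x⟫_ℂ := parseval
    _ = ∫ y, star (G y) * K y := by
        rw [← (PiLp.volume_preserving_ofLp ι).integral_comp
          (MeasurableEquiv.toLp 2 (ι → ℝ)).symm.measurableEmbedding]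
        refine integral_congr_ae ?_
        filter_upwards [hg, hh] with x hgx hhx
        rw [hgx, hhx, RCLike.inner_apply, mul_comm]; rfl

theorem integral_norm_sq_coordFourier {G : (ι → ℝ) → ℂ} (hG₁ : Integrable G)
    (hG₂ : MemLp G 2) : ∫ k, ‖coordFourier G k‖ ^ 2 = ∫ y, ‖G y‖ ^ 2 := by
  have h := integral_star_coordFourier_mul hG₁ hG₂ hG₁ hG₂
  simp only [RCLike.star_def, RCLike.conj_mul] at h
  apply Complex.ofReal_injective
  rw [← integral_complex_ofReal, ← integral_complex_ofReal]
  exact_mod_cast h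

theorem coordFourier_translate (G : (ι → ℝ) → ℂ) (s k : ι → ℝ) :
    coordFourier (fun y => G (y + s)) k =
      Complex.exp (((2 * Real.pi * (k ⬝ᵥ s) : ℝ) : ℂ) * Complex.I) * coordFourier G k := by
  rw [coordFourier, coordFourier, ← integral_const_mul,
    ← integral_add_right_eq_self (fun y => Complex.exp (((2 * Real.pi * (k ⬝ᵥ s) : ℝ) : ℂ) *
      Complex.I) * (Complex.exp (((-(2 * Real.pi * (k ⬝ᵥ y)) : ℝ) : ℂ) * Complex.I) * G y)) s]
  refine integral_congr_ae (Eventually.of_forall fun y => ?_)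
  simp only
  rw [← mul_assoc, ← Complex.exp_add, dotProduct_add]
  congr 2
  push_cast
  ring

end Plancherel

section GaussianIntegrals

variable {ι : Type*} [Fintype ι]

theorem integrable_exp_quadratic {b : ℝ} (hb : 0 < b) (c : ι → ℝ) :
    Integrable fun x : ι → ℝ => Real.exp (-b * ∑ i, x i ^ 2 + ∑ i, c i * x i) := by
  have h := (GaussianFourier.integrable_cexp_neg_mul_sum_add (b := (b : ℂ)) (by simpa using hb)
    (fun i : ι => (c i : ℂ))).re
  refine h.congr (Eventually.of_forall fun x => ?_)
  simp only [RCLike.re_to_complex]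
  rw [← Complex.ofReal_re (Real.exp _)]
  congr 1
  push_cast
  rfl

theorem integral_cexp_quadratic {b : ℝ} (hb : 0 < b) (c : ι → ℂ) :
    ∫ x : ι → ℝ, Complex.exp (-b * ∑ i, (x i : ℂ) ^ 2 + ∑ i, c i * x i) =
      ((∫ x : ι → ℝ, Real.exp (-b * ∑ i, x i ^ 2) : ℝ) : ℂ) *
        Complex.exp ((∑ i, c i ^ 2) / (4 * b)) := by
  have with_linear := GaussianFourier.integral_cexp_neg_mul_sum_add (b := (b : ℂ))
    (by simpa using hb) c
  have without_linear := GaussianFourier.integral_cexp_neg_mul_sum_add (b := (b : ℂ))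
    (by simpa using hb) (fun _ : ι => (0 : ℂ))
  simp only [zero_mul, Finset.sum_const_zero, add_zero, ne_eq, OfNat.ofNat_ne_zero,
    not_false_eq_true, zero_pow, zero_div, Complex.exp_zero, mul_one] at without_linear
  rw [with_linear, ← without_linear, ← integral_complex_ofReal]
  congr 1
  refine integral_congr_ae (Eventually.of_forall fun x => ?_)
  push_cast
  rfl

theorem integral_exp_quadratic {b : ℝ} (hb : 0 < b) (c : ι → ℝ) :
    ∫ x : ι → ℝ, Real.exp (-b * ∑ i, x i ^ 2 + ∑ i, c i * x i) =
      (∫ x : ι → ℝ, Real.exp (-b * ∑ i, x i ^ 2)) * Real.exp ((∑ i, c i ^ 2) / (4 * b)) := by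
  have h := integral_cexp_quadratic hb (fun i => (c i : ℂ))
  apply Complex.ofReal_injective
  rw [Complex.ofReal_mul, ← integral_complex_ofReal]
  push_cast at h ⊢
  exact h

theorem integral_exp_neg_mul_sum_sq_pos {b : ℝ} (hb : 0 < b) :
    0 < ∫ x : ι → ℝ, Real.exp (-b * ∑ i, x i ^ 2) := by
  have h := integrable_exp_quadratic (ι := ι) hb 0
  simp only [Pi.zero_apply, zero_mul, Finset.sum_const_zero, add_zero] at h
  exact integral_exp_pos h

theorem integral_exp_neg_sum_sq_pos : 0 < ∫ y : ι → ℝ, Real.exp (-∑ i, y i ^ 2) := by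
  simpa only [neg_mul, one_mul] using integral_exp_neg_mul_sum_sq_pos (ι := ι) one_pos

/-- The Gaussian probability density `π^(-N/2) exp (-|x|²)`, the position density of the vacuum;
the normalisation is written as an integral because its value is never needed. -/
def gaussDensity (x : ι → ℝ) : ℝ :=
  (∫ y : ι → ℝ, Real.exp (-∑ i, y i ^ 2))⁻¹ * Real.exp (-∑ i, x i ^ 2)

theorem gaussDensity_nonneg (x : ι → ℝ) : 0 ≤ gaussDensity x :=
  mul_nonneg (inv_nonneg.2 integral_exp_neg_sum_sq_pos.le) (Real.exp_pos _).le

theorem integrable_gaussDensity : Integrable (gaussDensity (ι := ι)) := by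
  have h := integrable_exp_quadratic (ι := ι) one_pos 0
  simp only [neg_mul, one_mul, Pi.zero_apply, zero_mul, Finset.sum_const_zero, add_zero] at h
  exact h.const_mul _

theorem integral_cexp_mul_gaussDensity (u : ι → ℝ) :
    ∫ x, Complex.exp (((∑ i, u i * x i : ℝ) : ℂ) * Complex.I) * (gaussDensity x : ℂ) =
      Complex.exp (-((∑ i, u i ^ 2 : ℝ) : ℂ) / 4) := by
  have gaussian := integral_cexp_quadratic (ι := ι) one_pos (fun i => (u i : ℂ) * Complex.I)
  have hpos := integral_exp_neg_sum_sq_pos (ι := ι)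
  set Z := ∫ y : ι → ℝ, Real.exp (-∑ i, y i ^ 2) with hZ
  have integrand_eq : ∀ x : ι → ℝ, Complex.exp (((∑ i, u i * x i : ℝ) : ℂ) * Complex.I) *
      (gaussDensity x : ℂ) = (Z : ℂ)⁻¹ * Complex.exp (-((1 : ℝ) : ℂ) * ∑ i, (x i : ℂ) ^ 2 +
        ∑ i, (u i : ℂ) * Complex.I * x i) := fun x => by
    rw [gaussDensity, ← hZ]
    push_cast
    rw [mul_left_comm, ← Complex.exp_add]
    congr 2
    rw [add_comm, Finset.sum_mul, neg_one_mul]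
    congr 1
    exact Finset.sum_congr rfl fun i _ => by ring
  simp only [integrand_eq]
  rw [integral_const_mul, gaussian]
  simp only [neg_mul, one_mul]
  rw [← hZ, ← mul_assoc, inv_mul_cancel₀ (by exact_mod_cast hpos.ne'), one_mul]
  congr 1
  simp only [mul_pow, Complex.I_sq, mul_neg, mul_one, Finset.sum_neg_distrib]
  push_cast
  ring

theorem integral_gaussDensity : ∫ x : ι → ℝ, gaussDensity x = 1 := by
  have h := integral_cexp_mul_gaussDensity (ι := ι) 0
  simp only [Pi.zero_apply, zero_mul, Finset.sum_const_zero, Complex.ofReal_zero, Complex.exp_zero,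
    one_mul, ne_eq, OfNat.ofNat_ne_zero, not_false_eq_true, zero_pow, neg_zero, zero_div,
    integral_complex_ofReal] at h
  exact_mod_cast h

end GaussianIntegrals

section SpectralEntropy

theorem eq_zero_of_forall_inner_hilbertBasis_eq_zero {I K : Type*} [NormedAddCommGroup K]
    [InnerProductSpace ℂ K] (b : HilbertBasis I ℂ K) {y : K} (hy : ∀ i, ⟪b i, y⟫_ℂ = 0) :
    y = 0 := by
  have hsum := b.hasSum_repr y
  simp only [b.repr_apply_apply, hy, zero_smul] at hsum
  exact hsum.unique hasSum_zero

theorem hasSum_norm_inner_sq {I K : Type*} [NormedAddCommGroup K] [InnerProductSpace ℂ K]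
    (b : HilbertBasis I ℂ K) (x : K) : HasSum (fun i => ‖⟪b i, x⟫_ℂ‖ ^ 2) (‖x‖ ^ 2) := by
  have hterm (i : I) : (⟪x, b i⟫_ℂ * ⟪b i, x⟫_ℂ).re = ‖⟪b i, x⟫_ℂ‖ ^ 2 := by
    rw [← inner_conj_symm x (b i), mul_comm, Complex.mul_conj, Complex.normSq_eq_norm_sq,
      Complex.ofReal_re]
  have hsum := Complex.hasSum_re (b.hasSum_inner_mul_inner x x)
  simp only [hterm, inner_self_eq_norm_sq_to_K] at hsum
  exact_mod_cast hsum

theorem tsum_ofReal_norm_inner_sq {I K : Type*} [NormedAddCommGroup K] [InnerProductSpace ℂ K]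
    (b : HilbertBasis I ℂ K) (x : K) :
    ∑' i, ENNReal.ofReal (‖⟪b i, x⟫_ℂ‖ ^ 2) = ENNReal.ofReal (‖x‖ ^ 2) := by
  rw [← (hasSum_norm_inner_sq b x).tsum_eq, ENNReal.ofReal_tsum_of_nonneg
    (fun i => by positivity) (hasSum_norm_inner_sq b x).summable]

theorem hasSum_re_inner_of_eigenbasis {I K : Type*} [NormedAddCommGroup K]
    [InnerProductSpace ℂ K] [CompleteSpace K] (b : HilbertBasis I ℂ K) {A : K →L[ℂ] K}
    (hA : IsSelfAdjoint A) {ν : I → ℝ} (h : ∀ i, A (b i) = (ν i : ℂ) • b i) (x : K) :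
    HasSum (fun i => ν i * ‖⟪b i, x⟫_ℂ‖ ^ 2) (⟪x, A x⟫_ℂ).re := by
  have hcoef (i : I) : ⟪b i, A x⟫_ℂ = ν i * ⟪b i, x⟫_ℂ := by
    rw [← hA.isSymmetric.apply_clm, h, inner_smul_left, Complex.conj_ofReal]
  have hterm (i : I) :
      (⟪x, b i⟫_ℂ * ⟪b i, A x⟫_ℂ).re = ν i * ‖⟪b i, x⟫_ℂ‖ ^ 2 := by
    rw [hcoef, ← inner_conj_symm x (b i), mul_left_comm, mul_comm (starRingEnd ℂ _),
      Complex.mul_conj, Complex.normSq_eq_norm_sq, ← Complex.ofReal_mul, Complex.ofReal_re]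
  simpa only [hterm] using Complex.hasSum_re (b.hasSum_inner_mul_inner x (A x))

theorem isClosed_eigenspace {E : Type*} [NormedAddCommGroup E] [InnerProductSpace ℂ E]
    (T : E →L[ℂ] E) (μ : ℂ) :
    IsClosed (Module.End.eigenspace (T : Module.End ℂ E) μ : Set E) := by
  have heq : (Module.End.eigenspace (T : Module.End ℂ E) μ : Set E) = {x | T x = μ • x} := by
    ext x
    exact Module.End.mem_eigenspace_iff
  rw [heq]
  exact isClosed_eq T.continuous (continuous_const_smul μ)

theorem mem_orthogonal_of_forall_inner_hilbertBasis_eq_zero {I K : Type*}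
    [NormedAddCommGroup K] [InnerProductSpace ℂ K] {V : Submodule ℂ K} [CompleteSpace V]
    (b : HilbertBasis I ℂ V) {x : K} (hx : ∀ i, ⟪(b i : K), x⟫_ℂ = 0) : x ∈ Vᗮ := by
  rw [← Submodule.orthogonalProjectionOnto_eq_zero_iff]
  refine eq_zero_of_forall_inner_hilbertBasis_eq_zero b fun i => ?_
  rw [Submodule.inner_orthogonalProjectionOnto_eq_of_mem_left, hx]

theorem exists_eigenbasis.{u} {E : Type u} [NormedAddCommGroup E] [InnerProductSpace ℂ E]
    [CompleteSpace E] {T : E →L[ℂ] E} (hc : IsCompactOperator T) (hT : IsSelfAdjoint T) :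
    ∃ (J : Type u) (b : HilbertBasis J ℂ E) (μ : J → ℂ), ∀ j, T (b j) = μ j • b j := by
  have hcomplete (μ : ℂ) : CompleteSpace (Module.End.eigenspace (T : Module.End ℂ E) μ) :=
    (isClosed_eigenspace T μ).completeSpace_coe
  choose w b _ using fun μ : ℂ =>
    exists_hilbertBasis ℂ (Module.End.eigenspace (T : Module.End ℂ E) μ)
  let u : (Σ μ : ℂ, w μ) → E := fun p => (b p.1 p.2 : E)
  have hu : Orthonormal ℂ u :=
    hT.isSymmetric.orthogonalFamily_eigenspaces.orthonormal_sigma_orthonormal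
      fun μ => (b μ).orthonormal
  have htop : (Submodule.span ℂ (Set.range u))ᗮ = ⊥ := by
    rw [eq_bot_iff,
      ← ContinuousLinearMap.orthogonalComplement_iSup_eigenspaces_eq_bot hc hT.isSymmetric,
      ← Submodule.iInf_orthogonal]
    intro x hx
    rw [Submodule.mem_iInf]
    exact fun μ => mem_orthogonal_of_forall_inner_hilbertBasis_eq_zero (b μ) fun i =>
      Submodule.inner_right_of_mem_orthogonal
        (Submodule.subset_span (Set.mem_range_self (f := u) ⟨μ, i⟩)) hx
  refine ⟨_, HilbertBasis.mkOfOrthogonalEqBot hu htop, Sigma.fst, fun p => ?_⟩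
  rw [HilbertBasis.coe_mkOfOrthogonalEqBot]
  exact Module.End.mem_eigenspace_iff.1 (b p.1 p.2).2

section FunctionalCalculus

variable {E : Type*} [NormedAddCommGroup E] [InnerProductSpace ℂ E] [CompleteSpace E]
  {T : E →L[ℂ] E} {r : ℝ} {v : E}

theorem mem_spectrum_of_apply_eq_smul (hv : T v = (r : ℂ) • v) (hv0 : v ≠ 0) :
    r ∈ spectrum ℝ T := by
  rw [spectrum.mem_iff]
  intro hunit
  have hker : (algebraMap ℝ (E →L[ℂ] E) r - T) v = 0 := by
    simp [Algebra.algebraMap_eq_smul_one, hv]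
  exact hv0 ((ContinuousLinearMap.isUnit_iff_bijective.1 hunit).1 (hker.trans (map_zero _).symm))

theorem cfcHom_apply_eigenvector (hT : IsSelfAdjoint T) (hv : T v = (r : ℂ) • v)
    (hr : r ∈ spectrum ℝ T) (g : C(spectrum ℝ T, ℝ)) :
    cfcHom hT g v = (g ⟨r, hr⟩ : ℂ) • v := by
  induction g using ContinuousMap.induction_on_of_compact with
  | const s =>
    have hconst : ContinuousMap.const (spectrum ℝ T) s = algebraMap ℝ _ s := rfl
    rw [hconst, AlgHomClass.commutes, Algebra.algebraMap_eq_smul_one]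
    simp
  | id => rw [cfcHom_id hT, hv]; rfl
  | star_id => rw [map_star, cfcHom_id hT, hT.star_eq, hv]; rfl
  | add f g hf hg => rw [map_add]; simp [hf, hg, add_smul]
  | mul f g hf hg =>
    rw [map_mul, mul_apply_eq_comp, hg, map_smul, hf, smul_smul, ContinuousMap.mul_apply,
      Complex.ofReal_mul, mul_comm]
  | frequently f hf =>
    have hclosed : IsClosed {g : C(spectrum ℝ T, ℝ) | cfcHom hT g v = (g ⟨r, hr⟩ : ℂ) • v} :=
      isClosed_eq ((ContinuousLinearMap.apply ℂ E v).continuous.comp (cfcHom_continuous hT))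
        ((Complex.continuous_ofReal.comp (continuous_eval_const _)).smul continuous_const)
    exact hclosed.closure_subset (mem_closure_iff_frequently.2 hf)

theorem cfc_apply_eigenvector (hT : IsSelfAdjoint T) {f : ℝ → ℝ} (hf : Continuous f)
    (hv : T v = (r : ℂ) • v) : cfc f T v = (f r : ℂ) • v := by
  rcases eq_or_ne v 0 with rfl | hv0
  · simp
  · rw [cfc_apply f T hT hf.continuousOn,
      cfcHom_apply_eigenvector hT hv (mem_spectrum_of_apply_eq_smul hv hv0)]
    rfl

end FunctionalCalculus

variable {E : Type} [NormedAddCommGroup E] [InnerProductSpace ℂ E] [CompleteSpace E]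

theorem posTrace_eq_of_eigenbasis {I : Type*} (b : HilbertBasis I ℂ E) {A : E →L[ℂ] E}
    (hA : IsSelfAdjoint A) {ν : I → ℝ} (hν : ∀ i, 0 ≤ ν i) (h : ∀ i, A (b i) = (ν i : ℂ) • b i) :
    posTrace A = ∑' i, ENNReal.ofReal (ν i) := by
  have hterm (x : E) : ENNReal.ofReal (⟪x, A x⟫_ℂ).re =
      ∑' i, ENNReal.ofReal (ν i) * ENNReal.ofReal (‖⟪x, b i⟫_ℂ‖ ^ 2) := by
    have hsum := hasSum_re_inner_of_eigenbasis b hA h x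
    rw [← hsum.tsum_eq, ENNReal.ofReal_tsum_of_nonneg
      (fun i => mul_nonneg (hν i) (by positivity)) hsum.summable]
    exact tsum_congr fun i => by rw [ENNReal.ofReal_mul (hν i), norm_inner_symm]
  simp only [posTrace, hterm]
  rw [ENNReal.tsum_comm]
  refine tsum_congr fun i => ?_
  rw [ENNReal.tsum_mul_left, tsum_ofReal_norm_inner_sq, b.orthonormal.1 i]
  simp

theorem vonNeumannEntropy_eq_of_eigenbasis {I : Type*} (b : HilbertBasis I ℂ E)
    {T : E →L[ℂ] E} (hT : IsSelfAdjoint T) {ν : I → ℝ} (h0 : ∀ i, 0 ≤ ν i) (h1 : ∀ i, ν i ≤ 1)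
    (h : ∀ i, T (b i) = (ν i : ℂ) • b i) :
    vonNeumannEntropy T = ∑' i, ENNReal.ofReal (Real.negMulLog (ν i)) :=
  posTrace_eq_of_eigenbasis b (cfc_predicate _ _)
    (fun i => Real.negMulLog_nonneg (h0 i) (h1 i))
    fun i => cfc_apply_eigenvector hT Real.continuous_negMulLog (h i)

theorem vonNeumannEntropy_eq_tsum {J : Type*} {u : J → E} (hu : Orthonormal ℂ u) {T : E →L[ℂ] E}
    (hT : IsSelfAdjoint T) {r : J → ℝ} (h0 : ∀ j, 0 ≤ r j) (h1 : ∀ j, r j ≤ 1)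
    (h : ∀ j, T (u j) = (r j : ℂ) • u j) (hker : ∀ x, (∀ j, ⟪u j, x⟫_ℂ = 0) → T x = 0) :
    vonNeumannEntropy T = ∑' j, ENNReal.ofReal (Real.negMulLog (r j)) := by
  obtain ⟨w, b, hw, hb⟩ := hu.toSubtypeRange.exists_hilbertBasis_extension
  let g : J → w := fun j => ⟨u j, hw ⟨j, rfl⟩⟩
  have hg : Function.Injective g := fun i j hij =>
    hu.linearIndependent.injective (congrArg Subtype.val hij)
  have hbg (j : J) : b (g j) = u j := by rw [hb]
  let ν : w → ℝ := Function.extend g r fun _ => 0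
  have hνg (j : J) : ν (g j) = r j := hg.extend_apply r _ j
  have hν0 (x : w) (hx : x ∉ Set.range g) : ν x = 0 := Function.extend_apply' r _ x hx
  have hν (x : w) : 0 ≤ ν x ∧ ν x ≤ 1 := by
    by_cases hx : x ∈ Set.range g
    · obtain ⟨j, rfl⟩ := hx
      rw [hνg]
      exact ⟨h0 j, h1 j⟩
    · rw [hν0 x hx]
      exact ⟨le_rfl, zero_le_one⟩
  have hTb (x : w) : T (b x) = (ν x : ℂ) • b x := by
    by_cases hx : x ∈ Set.range g
    · obtain ⟨j, rfl⟩ := hx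
      rw [hνg, hbg, h]
    · rw [hν0 x hx, Complex.ofReal_zero, zero_smul]
      refine hker _ fun j => ?_
      rw [← hbg]
      exact b.orthonormal.2 fun hj => hx ⟨j, hj⟩
  rw [vonNeumannEntropy_eq_of_eigenbasis b hT (fun x => (hν x).1) (fun x => (hν x).2) hTb,
    ← hg.tsum_eq]
  · simp only [hνg]
  · intro x hx
    by_contra hrange
    simp [hν0 x hrange] at hx

theorem vonNeumannEntropy_pureState {ψ : E} (hψ : ‖ψ‖ = 1) :
    vonNeumannEntropy (pureState ψ) = 0 := by
  rw [vonNeumannEntropy_eq_tsum (J := Unit) (u := fun _ => ψ) (r := fun _ => 1)]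
  · simp
  · exact ⟨fun _ => hψ, fun i j hij => (hij rfl).elim⟩
  · exact (InnerProductSpace.isPositive_rankOne_self ψ).isSelfAdjoint
  · exact fun _ => zero_le_one
  · exact fun _ => le_rfl
  · intro _
    simp [pureState, inner_self_eq_norm_sq_to_K, hψ]
  · intro x hx
    simp [pureState, hx ()]

end SpectralEntropy

section HilbertTensor

open ContinuousLinearMap

variable {H₁ H₂ : Type*} {H : Type*} [NormedAddCommGroup H₁] [InnerProductSpace ℂ H₁]
  [NormedAddCommGroup H₂] [InnerProductSpace ℂ H₂] [NormedAddCommGroup H] [InnerProductSpace ℂ H]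
  {T : H₁ →L[ℂ] H₂ →L[ℂ] H} {ψ : H}

/-- A bounded bilinear map that realises `H` as the Hilbert tensor product of `H₁` and `H₂`;
`total` says that the pure tensors span a dense subspace. -/
structure IsHilbertTensor (T : H₁ →L[ℂ] H₂ →L[ℂ] H) : Prop where
  inner_apply : ∀ a b a' b', ⟪T a b, T a' b'⟫_ℂ = ⟪a, a'⟫_ℂ * ⟪b, b'⟫_ℂ
  total : ∀ x, (∀ a b, ⟪T a b, x⟫_ℂ = 0) → x = 0

theorem IsHilbertTensor.flip (hT : IsHilbertTensor T) : IsHilbertTensor T.flip where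
  inner_apply a b a' b' := by rw [flip_apply, flip_apply, hT.inner_apply, mul_comm]
  total x hx := hT.total x fun a b => hx b a

/-- A Schmidt decomposition `ψ = ∑ⱼ √rⱼ vⱼ ⊗ uⱼ` of a unit vector; the weights `rⱼ` are the
nonzero eigenvalues of both reductions of `ψ`. -/
structure IsSchmidt (T : H₁ →L[ℂ] H₂ →L[ℂ] H) (ψ : H) {J : Type*} (r : J → ℝ) (v : J → H₁)
    (u : J → H₂) : Prop where
  left : Orthonormal ℂ v
  right : Orthonormal ℂ u
  pos : ∀ j, 0 < r j
  hasSum_one : HasSum r 1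
  hasSum_vec : HasSum (fun j => (Real.sqrt (r j) : ℂ) • T (v j) (u j)) ψ

theorem IsSchmidt.flip {J : Type*} {r : J → ℝ} {v : J → H₁} {u : J → H₂}
    (h : IsSchmidt T ψ r v u) : IsSchmidt T.flip ψ r u v :=
  ⟨h.right, h.left, h.pos, h.hasSum_one, h.hasSum_vec⟩

theorem IsSchmidt.hasSum_inner (hT : IsHilbertTensor T) {J : Type*} {r : J → ℝ} {v : J → H₁}
    {u : J → H₂} (h : IsSchmidt T ψ r v u) (a : H₁) (y : H₂) :
    HasSum (fun j => (Real.sqrt (r j) : ℂ) * (⟪a, v j⟫_ℂ * ⟪y, u j⟫_ℂ)) ⟪T a y, ψ⟫_ℂ := by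
  simpa only [innerSL_apply_apply, inner_smul_right, hT.inner_apply] using
    h.hasSum_vec.mapL (innerSL ℂ (T a y))

theorem IsSchmidt.inner_left (hT : IsHilbertTensor T) {J : Type*} {r : J → ℝ} {v : J → H₁}
    {u : J → H₂} (h : IsSchmidt T ψ r v u) (k : J) (y : H₂) :
    ⟪T (v k) y, ψ⟫_ℂ = (Real.sqrt (r k) : ℂ) * ⟪y, u k⟫_ℂ := by
  refine (h.hasSum_inner hT (v k) y).unique ?_
  convert hasSum_single k fun j hj => ?_ using 1
  · rw [inner_self_eq_norm_sq_to_K, h.left.1 k]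
    simp
  · rw [h.left.2 hj.symm]
    simp

section PartialInner

variable [CompleteSpace H₁] [CompleteSpace H]

/-- The partial inner product `⟨x|ψ⟩ ∈ H₁` of `ψ ∈ H₁ ⊗ H₂` with `x ∈ H₂`; it is antilinear
in `x`. -/
def partialInner (T : H₁ →L[ℂ] H₂ →L[ℂ] H) (ψ : H) (x : H₂) : H₁ :=
  adjoint (T.flip x) ψ

theorem inner_partialInner (T : H₁ →L[ℂ] H₂ →L[ℂ] H) (ψ : H) (x : H₂) (a : H₁) :
    ⟪a, partialInner T ψ x⟫_ℂ = ⟪T a x, ψ⟫_ℂ := by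
  rw [partialInner, adjoint_inner_right, flip_apply]

end PartialInner

theorem IsHilbertTensor.orthonormal_tensor (hT : IsHilbertTensor T) {I J : Type*} {e : I → H₁}
    {u : J → H₂} (he : Orthonormal ℂ e) (hu : Orthonormal ℂ u) :
    Orthonormal ℂ (fun p : J × I => T (e p.2) (u p.1)) := by
  classical
  rw [orthonormal_iff_ite]
  rintro ⟨j, i⟩ ⟨j', i'⟩
  rw [hT.inner_apply, orthonormal_iff_ite.1 he, orthonormal_iff_ite.1 hu]
  by_cases hi : i = i' <;> by_cases hj : j = j' <;> simp [hi, hj]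

variable [CompleteSpace H₁] [CompleteSpace H]

theorem IsHilbertTensor.span_tensor_orthogonal_eq_bot [CompleteSpace H₂]
    (hT : IsHilbertTensor T) {I J : Type*} (e : HilbertBasis I ℂ H₁) (u : HilbertBasis J ℂ H₂) :
    (Submodule.span ℂ (Set.range fun p : J × I => T (e p.2) (u p.1)))ᗮ = ⊥ := by
  rw [eq_bot_iff]
  intro x hx
  have hpartial (j : J) : partialInner T x (u j) = 0 :=
    eq_zero_of_forall_inner_hilbertBasis_eq_zero e fun i => by
      rw [inner_partialInner]
      exact Submodule.inner_right_of_mem_orthogonal (Submodule.subset_span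
        (Set.mem_range_self (f := fun p : J × I => T (e p.2) (u p.1)) (j, i))) hx
  refine hT.total x fun a b => ?_
  have hadjoint : adjoint (T a) x = 0 :=
    eq_zero_of_forall_inner_hilbertBasis_eq_zero u fun j => by
      rw [adjoint_inner_right, ← inner_partialInner, hpartial, inner_zero_right]
  rw [← adjoint_inner_right, hadjoint, inner_zero_right]

variable [CompleteSpace H₂]

theorem IsHilbertTensor.hasSum_partialInner (hT : IsHilbertTensor T) (ψ : H) {J : Type*}
    (u : HilbertBasis J ℂ H₂) : HasSum (fun j => T (partialInner T ψ (u j)) (u j)) ψ := by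
  obtain ⟨w, e, -⟩ := exists_hilbertBasis ℂ H₁
  have hsum := (HilbertBasis.mkOfOrthogonalEqBot (hT.orthonormal_tensor e.orthonormal u.orthonormal)
    (hT.span_tensor_orthogonal_eq_bot e u)).hasSum_repr ψ
  simp only [HilbertBasis.repr_apply_apply, HilbertBasis.coe_mkOfOrthogonalEqBot] at hsum
  refine hsum.prod_fiberwise fun j => ?_
  have hfiber := (e.hasSum_repr (partialInner T ψ (u j))).mapL (T.flip (u j))
  simpa [HilbertBasis.repr_apply_apply, inner_partialInner] using hfiber

theorem IsHilbertTensor.hasSum_norm_sq_partialInner (hT : IsHilbertTensor T) (ψ : H)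
    {J : Type*} (u : HilbertBasis J ℂ H₂) :
    HasSum (fun j => ‖partialInner T ψ (u j)‖ ^ 2) (‖ψ‖ ^ 2) := by
  have hterm (j : J) : (innerSL ℂ ψ (T (partialInner T ψ (u j)) (u j))).re =
      ‖partialInner T ψ (u j)‖ ^ 2 := by
    rw [innerSL_apply_apply, ← inner_conj_symm, ← inner_partialInner, Complex.conj_re,
      ← @inner_self_eq_norm_sq ℂ]
    rfl
  have hlimit : (innerSL ℂ ψ ψ).re = ‖ψ‖ ^ 2 := by
    rw [innerSL_apply_apply, ← @inner_self_eq_norm_sq ℂ]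
    rfl
  simpa only [hterm, hlimit] using
    Complex.hasSum_re ((hT.hasSum_partialInner ψ u).mapL (innerSL ℂ ψ))

end HilbertTensor

section ReducedOp

open ContinuousLinearMap

universe u

variable {H₁ : Type*} {H₂ : Type u} {H : Type} [NormedAddCommGroup H₁] [InnerProductSpace ℂ H₁]
  [NormedAddCommGroup H₂] [InnerProductSpace ℂ H₂] [CompleteSpace H₂]
  [NormedAddCommGroup H] [InnerProductSpace ℂ H] [CompleteSpace H]
  {T : H₁ →L[ℂ] H₂ →L[ℂ] H} {ψ : H} {I : Type*}

/-- The reduction of the pure state `ψ ∈ H₁ ⊗ H₂` to `H₂`; it does not depend on the Hilbert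
basis `e` of `H₁`. -/
def reducedOp (T : H₁ →L[ℂ] H₂ →L[ℂ] H) (e : HilbertBasis I ℂ H₁) (ψ : H) :
    H₂ →L[ℂ] H₂ :=
  ∑' i, adjoint (T (e i)) ∘L pureState ψ ∘L T (e i)

theorem adjoint_comp_pureState_comp (T : H₁ →L[ℂ] H₂ →L[ℂ] H) (ψ : H) (a : H₁) :
    adjoint (T a) ∘L pureState ψ ∘L T a =
      InnerProductSpace.rankOne ℂ (partialInner T.flip ψ a) (partialInner T.flip ψ a) := by
  ext x
  simp [pureState, partialInner, adjoint_inner_left]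

variable [CompleteSpace H₁] (e : HilbertBasis I ℂ H₁)

theorem IsHilbertTensor.hasSum_reducedOp (hT : IsHilbertTensor T) (ψ : H) :
    HasSum (fun i => InnerProductSpace.rankOne ℂ (partialInner T.flip ψ (e i))
      (partialInner T.flip ψ (e i))) (reducedOp T e ψ) := by
  simp only [reducedOp, adjoint_comp_pureState_comp]
  refine Summable.hasSum (Summable.of_norm ?_)
  simp only [InnerProductSpace.norm_rankOne, ← sq]
  exact (hT.flip.hasSum_norm_sq_partialInner ψ e).summable

theorem IsHilbertTensor.inner_reducedOp (hT : IsHilbertTensor T) (ψ : H) (x y : H₂) :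
    ⟪x, reducedOp T e ψ y⟫_ℂ = ⟪partialInner T ψ y, partialInner T ψ x⟫_ℂ := by
  have hsum := ((hT.hasSum_reducedOp e ψ).mapL
    (ContinuousLinearMap.apply ℂ H₂ y)).mapL (innerSL ℂ x)
  have hterm (i : I) : innerSL ℂ x (ContinuousLinearMap.apply ℂ H₂ y (InnerProductSpace.rankOne ℂ
      (partialInner T.flip ψ (e i)) (partialInner T.flip ψ (e i)))) =
      ⟪partialInner T ψ y, e i⟫_ℂ * ⟪e i, partialInner T ψ x⟫_ℂ := by
    rw [innerSL_apply_apply, apply_apply, InnerProductSpace.rankOne_apply, inner_smul_right,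
      inner_partialInner, inner_partialInner, ← inner_conj_symm, inner_partialInner,
      ← inner_conj_symm (partialInner T ψ y), inner_partialInner, flip_apply, flip_apply]
  simp only [hterm] at hsum
  exact hsum.unique (e.hasSum_inner_mul_inner (partialInner T ψ y) (partialInner T ψ x))

theorem IsHilbertTensor.isSelfAdjoint_reducedOp (hT : IsHilbertTensor T) (ψ : H) :
    IsSelfAdjoint (reducedOp T e ψ) := by
  rw [ContinuousLinearMap.isSelfAdjoint_iff_isSymmetric]
  intro x y
  change ⟪reducedOp T e ψ x, y⟫_ℂ = ⟪x, reducedOp T e ψ y⟫_ℂ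
  rw [← inner_conj_symm, hT.inner_reducedOp, hT.inner_reducedOp, inner_conj_symm]

theorem IsHilbertTensor.isCompactOperator_reducedOp (hT : IsHilbertTensor T) (ψ : H) :
    IsCompactOperator (reducedOp T e ψ) := by
  refine isCompactOperator_of_tendsto (hT.hasSum_reducedOp e ψ) (Eventually.of_forall fun s => ?_)
  refine Submodule.sum_mem (compactOperator (RingHom.id ℂ) H₂ H₂) fun i _ => ?_
  exact (isCompactOperator_of_locallyCompactSpace_dom (innerSL ℂ _)).clm_comp
    (toSpanSingleton ℂ _)

theorem IsHilbertTensor.inner_partialInner_eigenvector (hT : IsHilbertTensor T) {x y : H₂} {μ : ℂ}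
    (hy : reducedOp T e ψ y = μ • y) :
    ⟪partialInner T ψ y, partialInner T ψ x⟫_ℂ = μ * ⟪x, y⟫_ℂ := by
  rw [← hT.inner_reducedOp e, hy, inner_smul_right]

theorem IsHilbertTensor.exists_schmidt (hT : IsHilbertTensor T) (hψ : ‖ψ‖ = 1) :
    ∃ (J : Type u) (r : J → ℝ) (v : J → H₁) (u : J → H₂), IsSchmidt T ψ r v u := by
  obtain ⟨w, e, -⟩ := exists_hilbertBasis ℂ H₁
  obtain ⟨J, b, μ, hb⟩ := exists_eigenbasis (hT.isCompactOperator_reducedOp e ψ)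
    (hT.isSelfAdjoint_reducedOp e ψ)
  let a : J → H₁ := fun j => partialInner T ψ (b j)
  have hinj : Function.Injective (Subtype.val : {j // a j ≠ 0} → J) := Subtype.val_injective
  have hzero : ∀ j ∉ Set.range (Subtype.val : {j // a j ≠ 0} → J), a j = 0 := fun j hj => by
    by_contra h
    exact hj ⟨⟨j, h⟩, rfl⟩
  refine ⟨{j // a j ≠ 0}, fun j => ‖a j‖ ^ 2, fun j => ((‖a j‖ : ℂ)⁻¹) • a j, fun j => b j,
    ⟨fun j => ?_, fun j k hjk => ?_⟩, b.orthonormal.comp _ hinj,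
    fun j => by have := j.2; positivity, ?_, ?_⟩
  · rw [norm_smul, norm_inv, Complex.norm_real, norm_norm,
      inv_mul_cancel₀ (norm_ne_zero_iff.2 j.2)]
  · simp only [a]
    rw [inner_smul_left, inner_smul_right, hT.inner_partialInner_eigenvector e (hb j),
      b.orthonormal.2 fun h => hjk (Subtype.ext h.symm)]
    simp
  · have hnorm := hT.hasSum_norm_sq_partialInner ψ b
    rw [hψ, one_pow] at hnorm
    exact (hinj.hasSum_iff fun j hj => by
      change ‖a j‖ ^ 2 = 0
      simp [hzero j hj]).2 hnorm
  · have hterm (j : {j // a j ≠ 0}) :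
        (Real.sqrt (‖a j‖ ^ 2) : ℂ) • T ((‖a j‖ : ℂ)⁻¹ • a j) (b j) = T (a j) (b j) := by
      have hj : (‖a j‖ : ℂ) ≠ 0 := by exact_mod_cast norm_ne_zero_iff.2 j.2
      rw [Real.sqrt_sq (norm_nonneg _), map_smul, smul_apply, smul_smul, mul_inv_cancel₀ hj,
        one_smul]
    simp only [hterm]
    have hsum := (hinj.hasSum_iff fun j hj => by
      change T (a j) (b j) = 0
      simp [hzero j hj]).2 (hT.hasSum_partialInner ψ b)
    exact hsum

end ReducedOp

section SchmidtEntropy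

variable {H₁ : Type*} {H₂ H : Type} [NormedAddCommGroup H₁] [InnerProductSpace ℂ H₁]
  [NormedAddCommGroup H₂] [InnerProductSpace ℂ H₂] [CompleteSpace H₂]
  [NormedAddCommGroup H] [InnerProductSpace ℂ H] [CompleteSpace H]
  [CompleteSpace H₁] {T : H₁ →L[ℂ] H₂ →L[ℂ] H} {ψ : H} {J : Type*} {r : J → ℝ} {v : J → H₁}
  {u : J → H₂} {I : Type*} (e : HilbertBasis I ℂ H₁)

theorem IsSchmidt.reducedOp_apply_right (hT : IsHilbertTensor T) (h : IsSchmidt T ψ r v u)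
    (k : J) : reducedOp T e ψ (u k) = (r k : ℂ) • u k := by
  have hpartial : partialInner T ψ (u k) = (Real.sqrt (r k) : ℂ) • v k :=
    ext_inner_left ℂ fun a => by
      rw [inner_partialInner, inner_smul_right]
      exact h.flip.inner_left hT.flip k a
  refine ext_inner_left ℂ fun x => ?_
  rw [hT.inner_reducedOp, hpartial, inner_smul_left, inner_partialInner, h.inner_left hT,
    inner_smul_right, ← mul_assoc, Complex.conj_ofReal, ← Complex.ofReal_mul,
    Real.mul_self_sqrt (h.pos k).le]

theorem IsSchmidt.reducedOp_eq_zero_of_orthogonal (hT : IsHilbertTensor T)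
    (h : IsSchmidt T ψ r v u) {y : H₂} (hy : ∀ j, ⟪u j, y⟫_ℂ = 0) : reducedOp T e ψ y = 0 := by
  have hpartial : partialInner T ψ y = 0 := ext_inner_left ℂ fun a => by
    rw [inner_partialInner, inner_zero_right]
    refine (h.hasSum_inner hT a y).unique ?_
    convert hasSum_zero using 2 with j
    rw [inner_eq_zero_symm.1 (hy j)]
    simp
  refine ext_inner_left ℂ fun x => ?_
  rw [hT.inner_reducedOp, hpartial, inner_zero_left, inner_zero_right]

theorem IsSchmidt.vonNeumannEntropy_reducedOp (hT : IsHilbertTensor T)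
    (h : IsSchmidt T ψ r v u) :
    vonNeumannEntropy (reducedOp T e ψ) = ∑' j, ENNReal.ofReal (Real.negMulLog (r j)) :=
  vonNeumannEntropy_eq_tsum h.right (hT.isSelfAdjoint_reducedOp e ψ) (fun j => (h.pos j).le)
    (fun j => le_hasSum h.hasSum_one j fun i _ => (h.pos i).le)
    (h.reducedOp_apply_right e hT) fun _ => h.reducedOp_eq_zero_of_orthogonal e hT

end SchmidtEntropy

section WeylRelations

variable {ι : Type} [Fintype ι]

/-- The multiplier `exp (i (u·x + u·v / 2))` in the Schrödinger form of `W(ξ)`, `ξ = (u, v)`. -/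
def weylPhase (ξ : ι ⊕ ι → ℝ) (x : ι → ℝ) : ℂ :=
  Complex.exp (Complex.I * (((∑ i, ξ (.inl i) * x i)
    + (∑ i, ξ (.inl i) * ξ (.inr i)) / 2 : ℝ) : ℂ))

theorem norm_weylPhase (ξ : ι ⊕ ι → ℝ) (x : ι → ℝ) : ‖weylPhase ξ x‖ = 1 := by
  rw [weylPhase, mul_comm, Complex.norm_exp_ofReal_mul_I]

theorem weyl_coeFn (ξ : ι ⊕ ι → ℝ) (φ : Modes ι) :
    weyl ξ φ =ᵐ[volume] fun x => weylPhase ξ x * φ (fun i => x i + ξ (.inr i)) :=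
  (memLp_weyl ξ φ).coeFn_toLp

theorem measurePreserving_translate (v : ι → ℝ) :
    MeasurePreserving (fun (x : ι → ℝ) (i : ι) => x i + v i) volume volume :=
  measurePreserving_add_right (volume : Measure (ι → ℝ)) v

theorem ae_translate {p : (ι → ℝ) → Prop} (hp : ∀ᵐ x, p x) (v : ι → ℝ) :
    ∀ᵐ x : ι → ℝ, p (fun i => x i + v i) :=
  (measurePreserving_translate v).quasiMeasurePreserving.ae hp

theorem integrable_norm_sq_modes (φ : Modes ι) : Integrable fun x => ‖φ x‖ ^ 2 :=
  (memLp_two_iff_integrable_sq_norm (Lp.aestronglyMeasurable φ)).1 (Lp.memLp φ)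

theorem inner_weyl_eq_integral (ξ : ι ⊕ ι → ℝ) (φ χ : Modes ι) :
    ⟪φ, weyl ξ χ⟫_ℂ =
      ∫ x, star (φ x) * (weylPhase ξ x * χ (fun i => x i + ξ (.inr i))) := by
  rw [L2.inner_def]
  refine integral_congr_ae ?_
  filter_upwards [weyl_coeFn ξ χ] with x hx
  rw [hx, RCLike.inner_apply, mul_comm]
  rfl

theorem weyl_add_right (ξ : ι ⊕ ι → ℝ) (φ χ : Modes ι) :
    weyl ξ (φ + χ) = weyl ξ φ + weyl ξ χ := by
  refine Lp.ext ?_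
  filter_upwards [weyl_coeFn ξ (φ + χ), weyl_coeFn ξ φ, weyl_coeFn ξ χ,
    Lp.coeFn_add (weyl ξ φ) (weyl ξ χ),
    ae_translate (Lp.coeFn_add φ χ) fun i => ξ (.inr i)] with x hsum hφ hχ hadd htranslate
  rw [hsum, hadd, Pi.add_apply, hφ, hχ, htranslate, Pi.add_apply, mul_add]

theorem weyl_smul_right (ξ : ι ⊕ ι → ℝ) (c : ℂ) (φ : Modes ι) :
    weyl ξ (c • φ) = c • weyl ξ φ := by
  refine Lp.ext ?_
  filter_upwards [weyl_coeFn ξ (c • φ), weyl_coeFn ξ φ, Lp.coeFn_smul c (weyl ξ φ),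
    ae_translate (Lp.coeFn_smul c φ) fun i => ξ (.inr i)] with x hcφ hφ hsmul htranslate
  rw [hcφ, hsmul, Pi.smul_apply, hφ, htranslate, Pi.smul_apply, smul_eq_mul, smul_eq_mul,
    mul_left_comm]

theorem norm_weyl (ξ : ι ⊕ ι → ℝ) (φ : Modes ι) : ‖weyl ξ φ‖ = ‖φ‖ := by
  refine (sq_eq_sq₀ (norm_nonneg _) (norm_nonneg _)).1 ?_
  rw [norm_sq_modes, norm_sq_modes,
    ← integral_add_right_eq_self (fun x => ‖φ x‖ ^ 2) fun i => ξ (.inr i)]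
  refine integral_congr_ae ?_
  filter_upwards [weyl_coeFn ξ φ] with x hx
  rw [hx, norm_mul, norm_weylPhase, one_mul]
  rfl

/-- The Weyl operator `W(ξ)` as a linear isometry. -/
def weylIso (ξ : ι ⊕ ι → ℝ) : Modes ι →ₗᵢ[ℂ] Modes ι where
  toFun := weyl ξ
  map_add' := weyl_add_right ξ
  map_smul' := weyl_smul_right ξ
  norm_map' := norm_weyl ξ

theorem weylIso_apply (ξ : ι ⊕ ι → ℝ) (φ : Modes ι) : weylIso ξ φ = weyl ξ φ := rfl

theorem inner_weyl_weyl (ξ : ι ⊕ ι → ℝ) (φ χ : Modes ι) : ⟪weyl ξ φ, weyl ξ χ⟫_ℂ = ⟪φ, χ⟫_ℂ :=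
  (weylIso ξ).inner_map_map φ χ

theorem weyl_zero (φ : Modes ι) : weyl 0 φ = φ := by
  refine Lp.ext ?_
  filter_upwards [weyl_coeFn 0 φ] with x hx
  simp [hx, weylPhase]

/-- The symplectic form `σ((u, v), (u', v')) = u'·v - u·v'` on phase space, which governs the
Weyl relations `weyl_weyl`. -/
def symplForm (ξ ζ : ι ⊕ ι → ℝ) : ℝ :=
  ∑ i, (ζ (.inl i) * ξ (.inr i) - ξ (.inl i) * ζ (.inr i))

theorem symplForm_swap (ξ ζ : ι ⊕ ι → ℝ) : symplForm ζ ξ = -symplForm ξ ζ := by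
  rw [symplForm, symplForm, ← Finset.sum_neg_distrib]
  exact Finset.sum_congr rfl fun i _ => by ring

theorem symplForm_self (ξ : ι ⊕ ι → ℝ) : symplForm ξ ξ = 0 := by
  simp [symplForm]

theorem symplForm_smul_right (c : ℝ) (ξ ζ : ι ⊕ ι → ℝ) :
    symplForm ξ (c • ζ) = c * symplForm ξ ζ := by
  rw [symplForm, symplForm, Finset.mul_sum]
  exact Finset.sum_congr rfl fun i _ => by simp only [Pi.smul_apply, smul_eq_mul]; ring

theorem symplForm_smul_left (c : ℝ) (ξ ζ : ι ⊕ ι → ℝ) :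
    symplForm (c • ξ) ζ = c * symplForm ξ ζ := by
  rw [symplForm_swap, symplForm_smul_right, symplForm_swap ξ, mul_neg, neg_neg]

theorem weyl_weyl (ξ ζ : ι ⊕ ι → ℝ) (φ : Modes ι) :
    weyl ξ (weyl ζ φ) =
      Complex.exp (Complex.I * ((symplForm ξ ζ / 2 : ℝ) : ℂ)) • weyl (ξ + ζ) φ := by
  refine Lp.ext ?_
  filter_upwards [weyl_coeFn ξ (weyl ζ φ), weyl_coeFn (ξ + ζ) φ,
    Lp.coeFn_smul (Complex.exp (Complex.I * ((symplForm ξ ζ / 2 : ℝ) : ℂ))) (weyl (ξ + ζ) φ),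
    ae_translate (weyl_coeFn ζ φ) fun i => ξ (.inr i)] with x hcomp hadd hsmul htranslate
  have hshift : (fun i => x i + ξ (.inr i) + ζ (.inr i)) = fun i => x i + (ξ + ζ) (.inr i) := by
    funext i
    rw [Pi.add_apply, add_assoc]
  rw [hcomp, hsmul, Pi.smul_apply, hadd, htranslate, smul_eq_mul, ← mul_assoc, ← mul_assoc, hshift]
  congr 1
  simp only [weylPhase, ← Complex.exp_add, ← mul_add, ← Complex.ofReal_add]
  congr 3
  simp only [symplForm, Finset.sum_div, ← Finset.sum_add_distrib]
  refine Finset.sum_congr rfl fun i _ => ?_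
  simp only [Pi.add_apply]
  ring

theorem inner_weyl_left (ξ : ι ⊕ ι → ℝ) (φ χ : Modes ι) :
    ⟪weyl ξ φ, χ⟫_ℂ = ⟪φ, weyl (-ξ) χ⟫_ℂ := by
  have hinv : weyl ξ (weyl (-ξ) χ) = χ := by
    have hform : symplForm ξ (-ξ) = 0 := by
      rw [← neg_one_smul ℝ ξ, symplForm_smul_right, symplForm_self, mul_zero]
    simp [weyl_weyl, weyl_zero, hform]
  conv_lhs => rw [← hinv]
  exact inner_weyl_weyl ξ _ _

end WeylRelations

section Tensor

variable {α β : Type} [Fintype α] [Fintype β]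

theorem tensor_coeFn (φ : Modes α) (χ : Modes β) :
    tensor φ χ =ᵐ[volume]
      fun z : α ⊕ β → ℝ => φ (fun i => z (.inl i)) * χ (fun j => z (.inr j)) :=
  (memLp_tensor φ χ).coeFn_toLp

theorem inner_tensor_tensor (φ φ' : Modes α) (χ χ' : Modes β) :
    ⟪tensor φ χ, tensor φ' χ'⟫_ℂ = ⟪φ, φ'⟫_ℂ * ⟪χ, χ'⟫_ℂ := by
  rw [L2.inner_def, L2.inner_def, L2.inner_def,
    ← integral_prod_mul (fun x => ⟪φ x, φ' x⟫_ℂ) (fun y => ⟪χ y, χ' y⟫_ℂ)]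
  have hmp := volume_measurePreserving_sumPiEquivProdPi (fun _ : α ⊕ β => ℝ)
  refine Eq.trans ?_ (hmp.integral_comp (MeasurableEquiv.sumPiEquivProdPi _).measurableEmbedding
      (fun p : (α → ℝ) × (β → ℝ) => ⟪φ p.1, φ' p.1⟫_ℂ * ⟪χ p.2, χ' p.2⟫_ℂ))
  refine integral_congr_ae ?_
  filter_upwards [tensor_coeFn φ χ, tensor_coeFn φ' χ'] with z hφχ hφχ'
  rw [hφχ, hφχ']
  simp only [RCLike.inner_apply, map_mul, MeasurableEquiv.coe_sumPiEquivProdPi,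
    Equiv.sumPiEquivProdPi]
  exact mul_mul_mul_comm _ _ _ _

/-- The part of a phase-space vector that belongs to the modes in `α`. -/
def leftPart (ξ : (α ⊕ β) ⊕ (α ⊕ β) → ℝ) : α ⊕ α → ℝ :=
  Sum.elim (fun a => ξ (.inl (.inl a))) (fun a => ξ (.inr (.inl a)))

/-- The part of a phase-space vector that belongs to the modes in `β`. -/
def rightPart (ξ : (α ⊕ β) ⊕ (α ⊕ β) → ℝ) : β ⊕ β → ℝ :=
  Sum.elim (fun b => ξ (.inl (.inr b))) (fun b => ξ (.inr (.inr b)))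

theorem weylPhase_sum (ξ : (α ⊕ β) ⊕ (α ⊕ β) → ℝ) (z : α ⊕ β → ℝ) :
    weylPhase ξ z = weylPhase (leftPart ξ) (fun i => z (.inl i)) *
      weylPhase (rightPart ξ) (fun j => z (.inr j)) := by
  simp only [weylPhase, ← Complex.exp_add, ← mul_add, ← Complex.ofReal_add,
    Fintype.sum_sum_type, leftPart, rightPart, Sum.elim_inl, Sum.elim_inr]
  congr 3
  ring

theorem weyl_tensor (ξ : (α ⊕ β) ⊕ (α ⊕ β) → ℝ) (φ : Modes α) (χ : Modes β) :
    weyl ξ (tensor φ χ) = tensor (weyl (leftPart ξ) φ) (weyl (rightPart ξ) χ) := by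
  refine Lp.ext ?_
  filter_upwards [weyl_coeFn ξ (tensor φ χ),
    tensor_coeFn (weyl (leftPart ξ) φ) (weyl (rightPart ξ) χ),
    quasiMeasurePreserving_inl.ae (weyl_coeFn (leftPart ξ) φ),
    quasiMeasurePreserving_inr.ae (weyl_coeFn (rightPart ξ) χ),
    ae_translate (tensor_coeFn φ χ) fun i => ξ (.inr i)]
    with z hweyl htensor hleft hright htranslate
  rw [hweyl, htensor, hleft, hright, htranslate, weylPhase_sum]
  exact mul_mul_mul_comm _ _ _ _

end Tensor

section PuncturedLimits

theorem tendsto_neg_punctured : Tendsto (fun t : ℝ => -t) (𝓝[≠] 0) (𝓝[≠] 0) := by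
  refine tendsto_nhdsWithin_iff.2 ⟨?_, ?_⟩
  · simpa using (continuous_neg.tendsto (0 : ℝ)).mono_left nhdsWithin_le_nhds
  · filter_upwards [self_mem_nhdsWithin] with t ht
    simpa using ht

theorem eventually_fst_ne_and_snd_ne_zero :
    ∀ᶠ p : ℝ × ℝ in 𝓝[≠] 0 ×ˢ 𝓝[≠] 0, p.1 ≠ 0 ∧ p.2 ≠ 0 :=
  (tendsto_fst.eventually self_mem_nhdsWithin).and (tendsto_snd.eventually self_mem_nhdsWithin)

theorem tendsto_mul_punctured :
    Tendsto (fun p : ℝ × ℝ => p.1 * p.2) (𝓝[≠] 0 ×ˢ 𝓝[≠] 0) (𝓝[≠] 0) := by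
  refine tendsto_nhdsWithin_iff.2 ⟨?_, ?_⟩
  · simpa using ((tendsto_fst (f := 𝓝[≠] (0 : ℝ)) (g := 𝓝[≠] (0 : ℝ))).mono_right
      nhdsWithin_le_nhds).mul (tendsto_snd.mono_right nhdsWithin_le_nhds)
  · filter_upwards [eventually_fst_ne_and_snd_ne_zero] with p hp
    exact mul_ne_zero hp.1 hp.2

theorem tendsto_mul_self_punctured : Tendsto (fun t : ℝ => t * t) (𝓝[≠] 0) (𝓝[≠] 0) :=
  tendsto_mul_punctured.comp (tendsto_id.prodMk tendsto_id)

theorem tendsto_exp_sub_one_div (c : ℂ) :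
    Tendsto (fun s : ℝ => (Complex.exp (c * s) - 1) / s) (𝓝[≠] 0) (𝓝 c) := by
  have hderiv : HasDerivAt (fun s : ℝ => Complex.exp (c * s)) c 0 := by
    have hcomplex : HasDerivAt (fun s : ℂ => Complex.exp (c * s)) c ((0 : ℝ) : ℂ) := by
      simpa using ((hasDerivAt_id ((0 : ℝ) : ℂ)).const_mul c).cexp
    exact hcomplex.comp_ofReal
  refine (hasDerivAt_iff_tendsto_slope.1 hderiv).congr fun s => ?_
  simp [slope_def_module, div_eq_inv_mul]

theorem tendsto_exp_mul_self_sub_one_div (c : ℂ) :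
    Tendsto (fun t : ℝ => (Complex.exp (c * (t * t : ℝ)) - 1) / t) (𝓝[≠] 0) (𝓝 0) := by
  have hid : Tendsto (fun t : ℝ => (t : ℂ)) (𝓝[≠] 0) (𝓝 0) := by
    simpa using (Complex.continuous_ofReal.tendsto 0).mono_left nhdsWithin_le_nhds
  have hprod := ((tendsto_exp_sub_one_div c).comp tendsto_mul_self_punctured).mul hid
  rw [mul_zero] at hprod
  refine hprod.congr' ?_
  filter_upwards [self_mem_nhdsWithin] with t ht
  have ht' : (t : ℂ) ≠ 0 := by exact_mod_cast ht
  simp only [Function.comp]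
  push_cast
  field_simp

end PuncturedLimits

section Quadratures

variable {ι : Type} [Fintype ι]

/-- The difference quotient `(W(tξ) φ - φ) / (i t)`. -/
def weylQuot (ξ : ι ⊕ ι → ℝ) (φ : Modes ι) (t : ℝ) : Modes ι :=
  (Complex.I * (t : ℂ))⁻¹ • (weyl (t • ξ) φ - φ)

/-- `φ` is in the domain of the field operator `ξ · R`, and `(ξ · R) φ = η`. For a basis vector
`ξ` this is `IsQuadratureImage`. -/
def HasField (ξ : ι ⊕ ι → ℝ) (φ η : Modes ι) : Prop :=
  Tendsto (weylQuot ξ φ) (𝓝[≠] 0) (𝓝 η)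

variable {ξ ζ : ι ⊕ ι → ℝ} {φ η θ : Modes ι}

theorem HasField.tendsto_weyl (h : HasField ξ φ η) :
    Tendsto (fun t : ℝ => weyl (t • ξ) φ) (𝓝[≠] 0) (𝓝 φ) := by
  have hfactor : Tendsto (fun t : ℝ => Complex.I * (t : ℂ)) (𝓝[≠] 0) (𝓝 0) := by
    have hcont : Continuous fun t : ℝ => Complex.I * (t : ℂ) := by fun_prop
    simpa using (hcont.tendsto 0).mono_left nhdsWithin_le_nhds
  have hlim := (hfactor.smul h).add_const φ
  rw [zero_smul, zero_add] at hlim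
  refine hlim.congr' ?_
  filter_upwards [self_mem_nhdsWithin] with t ht
  have hne : Complex.I * (t : ℂ) ≠ 0 := mul_ne_zero Complex.I_ne_zero (by exact_mod_cast ht)
  rw [weylQuot, smul_smul, mul_inv_cancel₀ hne, one_smul, sub_add_cancel]

theorem HasField.tendsto_weyl_weyl (hξ : HasField ξ φ η) (hζ : HasField ζ φ θ) :
    Tendsto (fun t : ℝ => weyl (t • ξ) (weyl (t • ζ) φ)) (𝓝[≠] 0) (𝓝 φ) := by
  have hξ' := tendsto_iff_norm_sub_tendsto_zero.1 hξ.tendsto_weyl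
  have hζ' := tendsto_iff_norm_sub_tendsto_zero.1 hζ.tendsto_weyl
  rw [tendsto_iff_norm_sub_tendsto_zero]
  refine squeeze_zero (fun _ => norm_nonneg _) (fun t => ?_) (by simpa using hζ'.add hξ')
  calc ‖weyl (t • ξ) (weyl (t • ζ) φ) - φ‖
      = ‖weylIso (t • ξ) (weyl (t • ζ) φ - φ) + (weyl (t • ξ) φ - φ)‖ := by
        rw [map_sub, weylIso_apply, weylIso_apply, sub_add_sub_cancel]
    _ ≤ ‖weyl (t • ζ) φ - φ‖ + ‖weyl (t • ξ) φ - φ‖ :=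
        (norm_add_le _ _).trans (by rw [LinearIsometry.norm_map])

theorem weyl_weyl_comm (ξ ζ : ι ⊕ ι → ℝ) (φ : Modes ι) :
    weyl ζ (weyl ξ φ) =
      Complex.exp (-(Complex.I * (symplForm ξ ζ : ℝ))) • weyl ξ (weyl ζ φ) := by
  rw [weyl_weyl, weyl_weyl, smul_smul, add_comm ζ, ← Complex.exp_add, symplForm_swap ξ ζ]
  congr 2
  push_cast
  ring

theorem inner_weylQuot_weylQuot (ξ ζ : ι ⊕ ι → ℝ) (φ : Modes ι) (s t : ℝ) :
    ⟪weylQuot ξ φ s, weylQuot ζ φ t⟫_ℂ =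
      ((s * t : ℝ) : ℂ)⁻¹ * (⟪φ, weyl (-(s • ξ)) (weyl (t • ζ) φ)⟫_ℂ
        - ⟪φ, weyl (-(s • ξ)) φ⟫_ℂ - ⟪φ, weyl (t • ζ) φ⟫_ℂ + ⟪φ, φ⟫_ℂ) := by
  have hcoef : (starRingEnd ℂ) (Complex.I * (s : ℂ))⁻¹ * (Complex.I * (t : ℂ))⁻¹ =
      ((s * t : ℝ) : ℂ)⁻¹ := by
    rw [map_inv₀, map_mul, Complex.conj_I, Complex.conj_ofReal, ← mul_inv, Complex.ofReal_mul]
    congr 1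
    linear_combination (-(s : ℂ) * t) * Complex.I_mul_I
  simp only [weylQuot, inner_smul_left, inner_smul_right, inner_sub_left, inner_sub_right,
    inner_weyl_left, ← hcoef]
  ring

/-- The canonical commutation relation in weak form, by differentiating the Weyl relations. -/
theorem HasField.inner_sub_inner (hξ : HasField ξ φ η) (hζ : HasField ζ φ θ) :
    ⟪η, θ⟫_ℂ - ⟪θ, η⟫_ℂ = -(Complex.I * (symplForm ξ ζ : ℝ)) * ⟪φ, φ⟫_ℂ := by
  have hξneg : Tendsto (fun t => weylQuot ξ φ (-t)) (𝓝[≠] 0) (𝓝 η) := hξ.comp tendsto_neg_punctured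
  have hζneg : Tendsto (fun t => weylQuot ζ φ (-t)) (𝓝[≠] 0) (𝓝 θ) := hζ.comp tendsto_neg_punctured
  refine tendsto_nhds_unique ((hξneg.inner hζ (𝕜 := ℂ)).sub (hζneg.inner hξ (𝕜 := ℂ))) ?_
  have hphase := (tendsto_exp_sub_one_div (-(Complex.I * (symplForm ξ ζ : ℝ)))).comp
    tendsto_mul_self_punctured
  have hinner : Tendsto (fun t : ℝ => ⟪φ, weyl (t • ξ) (weyl (t • ζ) φ)⟫_ℂ) (𝓝[≠] 0)
      (𝓝 ⟪φ, φ⟫_ℂ) := tendsto_const_nhds.inner (hξ.tendsto_weyl_weyl hζ)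
  refine (hphase.mul hinner).congr' ?_
  filter_upwards [self_mem_nhdsWithin] with t ht
  have ht' : (t : ℂ) ≠ 0 := by exact_mod_cast ht
  simp only [Function.comp, inner_weylQuot_weylQuot, neg_smul, neg_neg]
  rw [weyl_weyl_comm (t • ξ) (t • ζ), inner_smul_right, symplForm_smul_left, symplForm_smul_right,
    ← mul_assoc t t]
  push_cast
  field_simp
  ring_nf

theorem HasField.uncertainty (hξ : HasField ξ φ η) (hζ : HasField ζ φ θ) (hφ : ‖φ‖ = 1) :
    |symplForm ξ ζ| ≤ ‖η‖ ^ 2 + ‖θ‖ ^ 2 := by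
  have hcomm : ‖⟪η, θ⟫_ℂ - ⟪θ, η⟫_ℂ‖ = |symplForm ξ ζ| := by
    rw [hξ.inner_sub_inner hζ, inner_self_eq_norm_sq_to_K, hφ]
    simp
  have hcauchy : ‖⟪η, θ⟫_ℂ - ⟪θ, η⟫_ℂ‖ ≤ ‖η‖ * ‖θ‖ + ‖θ‖ * ‖η‖ :=
    (norm_sub_le _ _).trans (add_le_add (norm_inner_le_norm _ _) (norm_inner_le_norm _ _))
  nlinarith [sq_nonneg (‖η‖ - ‖θ‖)]

section PureGaussian

theorem dotProduct_mulVec_comm {n : Type*} [Fintype n] {Γ : Matrix n n ℝ} (hΓ : Γ.IsSymm)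
    (ξ ζ : n → ℝ) : ζ ⬝ᵥ Γ.mulVec ξ = ξ ⬝ᵥ Γ.mulVec ζ := by
  rw [Matrix.dotProduct_mulVec, ← Matrix.mulVec_transpose, hΓ.eq, dotProduct_comm]

variable {ψ : Modes ι} {Γ : Matrix (ι ⊕ ι) (ι ⊕ ι) ℝ}

theorem IsPureGaussianWithCov.inner_weyl_smul (hψ : IsPureGaussianWithCov ψ Γ)
    (ξ : ι ⊕ ι → ℝ) (t : ℝ) :
    ⟪ψ, weyl (t • ξ) ψ⟫_ℂ =
      Complex.exp (-(((ξ ⬝ᵥ Γ.mulVec ξ : ℝ) : ℂ) / 4) * (t * t : ℝ)) := by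
  rw [hψ.2.2, Complex.ofReal_exp, Matrix.mulVec_smul, smul_dotProduct, dotProduct_smul]
  congr 1
  push_cast [smul_eq_mul]
  ring

theorem IsPureGaussianWithCov.inner_weyl_neg_weyl (hψ : IsPureGaussianWithCov ψ Γ)
    (ξ ζ : ι ⊕ ι → ℝ) (s t : ℝ) :
    ⟪ψ, weyl (-(s • ξ)) (weyl (t • ζ) ψ)⟫_ℂ =
      ⟪ψ, weyl (s • ξ) ψ⟫_ℂ * ⟪ψ, weyl (t • ζ) ψ⟫_ℂ *
        Complex.exp ((((ξ ⬝ᵥ Γ.mulVec ζ : ℝ) : ℂ) - Complex.I * (symplForm ξ ζ : ℝ)) / 2 *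
          ((s * t : ℝ) : ℂ)) := by
  rw [hψ.inner_weyl_smul, hψ.inner_weyl_smul, weyl_weyl, inner_smul_right, hψ.2.2,
    Complex.ofReal_exp]
  simp only [← Complex.exp_add]
  congr 1
  rw [← neg_smul, symplForm_smul_left, symplForm_smul_right]
  simp only [Matrix.mulVec_add, Matrix.mulVec_smul, add_dotProduct, dotProduct_add,
    smul_dotProduct, dotProduct_smul, smul_eq_mul, dotProduct_mulVec_comm hψ.2.1 ξ ζ]
  push_cast
  ring

theorem IsPureGaussianWithCov.tendsto_inner_weylQuot (hψ : IsPureGaussianWithCov ψ Γ)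
    (ξ ζ : ι ⊕ ι → ℝ) :
    Tendsto (fun p : ℝ × ℝ => ⟪weylQuot ξ ψ p.1, weylQuot ζ ψ p.2⟫_ℂ) (𝓝[≠] 0 ×ˢ 𝓝[≠] 0)
      (𝓝 ((((ξ ⬝ᵥ Γ.mulVec ζ : ℝ) : ℂ) - Complex.I * (symplForm ξ ζ : ℝ)) / 2)) := by
  set c : ℂ := (((ξ ⬝ᵥ Γ.mulVec ζ : ℝ) : ℂ) - Complex.I * (symplForm ξ ζ : ℝ)) / 2 with hc
  have hone (ξ : ι ⊕ ι → ℝ) : Tendsto (fun t : ℝ => ⟪ψ, weyl (t • ξ) ψ⟫_ℂ) (𝓝[≠] 0) (𝓝 1) := by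
    simp only [hψ.inner_weyl_smul]
    have hcont : Continuous fun t : ℝ =>
        Complex.exp (-(((ξ ⬝ᵥ Γ.mulVec ξ : ℝ) : ℂ) / 4) * (t * t : ℝ)) := by fun_prop
    simpa using (hcont.tendsto 0).mono_left nhdsWithin_le_nhds
  have hquot (ξ : ι ⊕ ι → ℝ) :
      Tendsto (fun t : ℝ => (⟪ψ, weyl (t • ξ) ψ⟫_ℂ - 1) / t) (𝓝[≠] 0) (𝓝 0) := by
    simp only [hψ.inner_weyl_smul]
    exact tendsto_exp_mul_self_sub_one_div _
  have hlim := (((hquot ξ).comp tendsto_fst).mul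
    ((hquot ζ).comp (tendsto_snd (f := 𝓝[≠] (0 : ℝ))))).add
    ((((hone ξ).comp tendsto_fst).mul ((hone ζ).comp (tendsto_snd (f := 𝓝[≠] (0 : ℝ))))).mul
      ((tendsto_exp_sub_one_div c).comp tendsto_mul_punctured))
  rw [mul_zero, zero_add, one_mul, one_mul] at hlim
  refine hlim.congr' ?_
  filter_upwards [eventually_fst_ne_and_snd_ne_zero] with p hp
  have hp₁ : (p.1 : ℂ) ≠ 0 := by exact_mod_cast hp.1
  have hp₂ : (p.2 : ℂ) ≠ 0 := by exact_mod_cast hp.2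
  have hself : ⟪ψ, ψ⟫_ℂ = 1 := by
    rw [inner_self_eq_norm_sq_to_K, hψ.1]
    simp
  have hneg : ⟪ψ, weyl (-(p.1 • ξ)) ψ⟫_ℂ = ⟪ψ, weyl (p.1 • ξ) ψ⟫_ℂ := by
    rw [← neg_smul, hψ.inner_weyl_smul, hψ.inner_weyl_smul, neg_mul_neg]
  rw [inner_weylQuot_weylQuot, hψ.inner_weyl_neg_weyl, hneg, hself, ← hc]
  simp only [Function.comp]
  push_cast
  field_simp
  ring

theorem exists_tendsto_of_tendsto_inner {E T : Type*} [NormedAddCommGroup E]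
    [InnerProductSpace ℂ E] [CompleteSpace E] {l : Filter T} [l.NeBot] {a : T → E} {L : ℝ}
    (h : Tendsto (fun p : T × T => ⟪a p.1, a p.2⟫_ℂ) (l ×ˢ l) (𝓝 (L : ℂ))) :
    ∃ η, Tendsto a l (𝓝 η) := by
  refine cauchy_map_iff_exists_tendsto.1 (cauchy_map_iff'.2 ?_)
  rw [Metric.uniformity_eq_comap_nhds_zero, tendsto_comap_iff]
  have hre : Tendsto (fun p : T × T => (⟪a p.1, a p.2⟫_ℂ).re) (l ×ˢ l) (𝓝 L) :=
    (Complex.continuous_re.tendsto _).comp h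
  have hdiag : Tendsto (fun t : T => (⟪a t, a t⟫_ℂ).re) l (𝓝 L) :=
    hre.comp (tendsto_id.prodMk tendsto_id)
  have hdist := (((hdiag.comp (tendsto_fst (g := l))).add
    (hdiag.comp (tendsto_snd (f := l)))).sub (hre.const_mul 2)).sqrt
  rw [← two_mul, sub_self, Real.sqrt_zero] at hdist
  refine hdist.congr fun p => ?_
  simp only [Function.comp, dist_eq_norm]
  rw [← Real.sqrt_sq (norm_nonneg (a p.1 - a p.2)), @norm_sub_sq ℂ,
    ← @inner_self_eq_norm_sq ℂ, ← @inner_self_eq_norm_sq ℂ]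
  simp only [RCLike.re_to_complex]
  ring_nf

theorem IsPureGaussianWithCov.exists_hasField (hψ : IsPureGaussianWithCov ψ Γ)
    (ξ : ι ⊕ ι → ℝ) : ∃ η, HasField ξ ψ η := by
  refine exists_tendsto_of_tendsto_inner (L := (ξ ⬝ᵥ Γ.mulVec ξ) / 2) ?_
  simpa [symplForm_self] using hψ.tendsto_inner_weylQuot ξ ξ

theorem IsPureGaussianWithCov.inner_field (hψ : IsPureGaussianWithCov ψ Γ)
    (hξ : HasField ξ ψ η) (hζ : HasField ζ ψ θ) :
    ⟪η, θ⟫_ℂ = (((ξ ⬝ᵥ Γ.mulVec ζ : ℝ) : ℂ) - Complex.I * (symplForm ξ ζ : ℝ)) / 2 :=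
  tendsto_nhds_unique ((hξ.comp tendsto_fst).inner (hζ.comp tendsto_snd))
    (hψ.tendsto_inner_weylQuot ξ ζ)

theorem IsPureGaussianWithCov.norm_sq_field (hψ : IsPureGaussianWithCov ψ Γ)
    (h : HasField ξ ψ η) : ‖η‖ ^ 2 = (ξ ⬝ᵥ Γ.mulVec ξ) / 2 := by
  rw [← @inner_self_eq_norm_sq ℂ, hψ.inner_field h h, symplForm_self]
  simp

end PureGaussian

variable [DecidableEq ι] {k : ι ⊕ ι}

theorem IsQuadratureImage.hasField (h : IsQuadratureImage k φ η) :
    HasField (Pi.single k 1) φ η := h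

theorem quadratureSq_eq (h : IsQuadratureImage k φ η) :
    quadratureSq k φ = ENNReal.ofReal (‖η‖ ^ 2) := by
  refine le_antisymm (iInf₂_le η h) (le_iInf₂ fun θ hθ => ?_)
  rw [tendsto_nhds_unique hθ h]

theorem exists_image_of_quadratureSq_ne_top (h : quadratureSq k φ ≠ ⊤) :
    ∃ η, IsQuadratureImage k φ η := by
  by_contra! hne
  exact h (by simp [quadratureSq, hne])

theorem one_le_quadratureSq_add (hφ : ‖φ‖ = 1) (i : ι) :
    1 ≤ quadratureSq (.inl i) φ + quadratureSq (.inr i) φ := by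
  by_cases hq : quadratureSq (.inl i) φ = ⊤
  · simp [hq]
  by_cases hp : quadratureSq (.inr i) φ = ⊤
  · simp [hp]
  obtain ⟨η, hη⟩ := exists_image_of_quadratureSq_ne_top hq
  obtain ⟨θ, hθ⟩ := exists_image_of_quadratureSq_ne_top hp
  have hform : symplForm (Pi.single (.inl i) 1 : ι ⊕ ι → ℝ) (Pi.single (.inr i) 1) = -1 := by
    simp [symplForm, Pi.single_apply]
  have huncertainty := hη.hasField.uncertainty hθ.hasField hφ
  rw [hform, abs_neg, abs_one] at huncertainty
  rw [quadratureSq_eq hη, quadratureSq_eq hθ, ← ENNReal.ofReal_add (by positivity) (by positivity)]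
  exact ENNReal.one_le_ofReal.2 huncertainty

theorem IsPureGaussianWithCov.exists_isQuadratureImage {ψ : Modes ι}
    {Γ : Matrix (ι ⊕ ι) (ι ⊕ ι) ℝ} (hψ : IsPureGaussianWithCov ψ Γ) (k : ι ⊕ ι) :
    ∃ η, IsQuadratureImage k ψ η ∧ ‖η‖ ^ 2 = Γ k k / 2 := by
  obtain ⟨η, hη⟩ := hψ.exists_hasField (Pi.single k 1)
  have hnorm := hψ.norm_sq_field hη
  rw [Matrix.mulVec_single_one, single_one_dotProduct] at hnorm
  exact ⟨η, hη, hnorm⟩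

theorem IsPureGaussianWithCov.energy_eq {ψ : Modes ι} {Γ : Matrix (ι ⊕ ι) (ι ⊕ ι) ℝ}
    (hψ : IsPureGaussianWithCov ψ Γ) : energy ψ = ENNReal.ofReal (Γ.trace / 4) := by
  choose η hη hnorm using hψ.exists_isQuadratureImage
  simp only [energy, fun k => quadratureSq_eq (hη k)]
  have hhalf : (2⁻¹ : ℝ≥0∞) = ENNReal.ofReal 2⁻¹ := by
    rw [ENNReal.ofReal_inv_of_pos two_pos, ENNReal.ofReal_ofNat]
  rw [← ENNReal.ofReal_sum_of_nonneg fun k _ => by positivity, hhalf,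
    ← ENNReal.ofReal_mul (by norm_num)]
  simp only [hnorm, ← Finset.sum_div, Matrix.trace, Matrix.diag_apply]
  congr 1
  ring

end Quadratures

section SqueezeChirp

open Matrix

variable {ι : Type} [Fintype ι] [DecidableEq ι] {L Y : Matrix ι ι ℝ}

theorem measurePreserving_mulVec (hL : L.det ≠ 0) :
    MeasurePreserving (fun x : ι → ℝ => L *ᵥ x) volume (ENNReal.ofReal |L.det⁻¹| • volume) :=
  ⟨(LinearMap.continuous_of_finiteDimensional (Matrix.toLin' L)).measurable,
    Real.map_matrix_volume_pi_eq_smul_volume_pi hL⟩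

theorem ae_mulVec (hL : L.det ≠ 0) {p : (ι → ℝ) → Prop} (hp : ∀ᵐ x, p x) :
    ∀ᵐ x : ι → ℝ, p (L *ᵥ x) := by
  have hquasi : Measure.QuasiMeasurePreserving (fun x : ι → ℝ => L *ᵥ x) volume volume :=
    ⟨(measurePreserving_mulVec hL).measurable, by
      rw [(measurePreserving_mulVec hL).map_eq]
      exact Measure.smul_absolutelyContinuous⟩
  exact hquasi.ae hp

theorem abs_det_mul_integral_comp_mulVec (hL : L.det ≠ 0) (f : (ι → ℝ) → ℝ) :
    |L.det| * ∫ x, f (L *ᵥ x) = ∫ x, f x := by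
  have hembedding : MeasurableEmbedding fun x : ι → ℝ => L *ᵥ x :=
    (LinearMap.continuous_of_finiteDimensional (Matrix.toLin' L)).measurableEmbedding
      (Matrix.mulVec_injective_of_isUnit (L.isUnit_iff_isUnit_det.2 hL.isUnit))
  rw [(measurePreserving_mulVec hL).integral_comp hembedding, integral_smul_measure,
    ENNReal.toReal_ofReal (abs_nonneg _), abs_inv, smul_eq_mul,
    mul_inv_cancel_left₀ (abs_pos.2 hL).ne']

/-- The multiplier `|det L|^½ exp (i x·Yx / 2)`, the unimodular factor of a metaplectic operator
normalised so that composition with `L` becomes isometric. -/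
def chirp (L Y : Matrix ι ι ℝ) (x : ι → ℝ) : ℂ :=
  (Real.sqrt |L.det| : ℂ) * Complex.exp (Complex.I * ((x ⬝ᵥ Y *ᵥ x / 2 : ℝ) : ℂ))

theorem norm_chirp (L Y : Matrix ι ι ℝ) (x : ι → ℝ) : ‖chirp L Y x‖ = Real.sqrt |L.det| := by
  rw [chirp, norm_mul, mul_comm Complex.I, Complex.norm_exp_ofReal_mul_I, mul_one,
    Complex.norm_real, Real.norm_of_nonneg (Real.sqrt_nonneg _)]

theorem continuous_chirp (L Y : Matrix ι ι ℝ) : Continuous (chirp L Y) := by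
  unfold chirp
  fun_prop

theorem chirp_mul_chirp_inv (hL : L.det ≠ 0) (Y : Matrix ι ι ℝ) (x : ι → ℝ) :
    chirp L Y x * chirp L⁻¹ (-(L⁻¹ᵀ * Y * L⁻¹)) (L *ᵥ x) = 1 := by
  have hform : (L *ᵥ x) ⬝ᵥ (-(L⁻¹ᵀ * Y * L⁻¹)) *ᵥ (L *ᵥ x) = -(x ⬝ᵥ Y *ᵥ x) := by
    rw [neg_mulVec, dotProduct_neg, mulVec_mulVec, Matrix.mul_assoc, nonsing_inv_mul _ hL.isUnit,
      Matrix.mul_one, ← mulVec_mulVec, dotProduct_mulVec, vecMul_transpose, mulVec_mulVec,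
      nonsing_inv_mul _ hL.isUnit, one_mulVec]
  have hsqrt : Real.sqrt |L.det| * (Real.sqrt |L.det|)⁻¹ = 1 :=
    mul_inv_cancel₀ (Real.sqrt_ne_zero'.2 (abs_pos.2 hL))
  rw [chirp, chirp, hform, mul_mul_mul_comm, ← Complex.exp_add, det_nonsing_inv,
    Ring.inverse_eq_inv, abs_inv, Real.sqrt_inv, ← Complex.ofReal_mul, hsqrt, Complex.ofReal_one,
    one_mul, neg_div, Complex.ofReal_neg, mul_neg, add_neg_cancel, Complex.exp_zero]

theorem memLp_squeezeChirp (hL : L.det ≠ 0) (Y : Matrix ι ι ℝ) (φ : Modes ι) :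
    MemLp (fun x => chirp L Y x * φ (L *ᵥ x)) 2 volume := by
  have hcomp : MemLp (fun x => φ (L *ᵥ x)) 2 volume :=
    ((Lp.memLp φ).smul_measure ENNReal.ofReal_ne_top).comp_measurePreserving
      (measurePreserving_mulVec hL)
  refine (hcomp.const_mul (Real.sqrt |L.det| : ℂ)).congr_norm
    ((continuous_chirp L Y).aestronglyMeasurable.mul hcomp.1) (Eventually.of_forall fun x => ?_)
  rw [norm_mul, norm_mul, norm_chirp, Complex.norm_real,
    Real.norm_of_nonneg (Real.sqrt_nonneg _)]

/-- The operator `(U φ)(x) = |det L|^½ exp (i x·Yx / 2) φ(L x)`: the linear change of coordinates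
`L` followed by the quadratic phase `Y`. These are all the metaplectic operators needed to bring a
pure Gaussian state to standard form. -/
def squeezeChirp (hL : L.det ≠ 0) (Y : Matrix ι ι ℝ) (φ : Modes ι) : Modes ι :=
  (memLp_squeezeChirp hL Y φ).toLp _

theorem squeezeChirp_coeFn (hL : L.det ≠ 0) (Y : Matrix ι ι ℝ) (φ : Modes ι) :
    squeezeChirp hL Y φ =ᵐ[volume] fun x => chirp L Y x * φ (L *ᵥ x) :=
  (memLp_squeezeChirp hL Y φ).coeFn_toLp

theorem squeezeChirp_add (hL : L.det ≠ 0) (Y : Matrix ι ι ℝ) (φ χ : Modes ι) :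
    squeezeChirp hL Y (φ + χ) = squeezeChirp hL Y φ + squeezeChirp hL Y χ := by
  refine Lp.ext ?_
  filter_upwards [squeezeChirp_coeFn hL Y (φ + χ), squeezeChirp_coeFn hL Y φ,
    squeezeChirp_coeFn hL Y χ, Lp.coeFn_add (squeezeChirp hL Y φ) (squeezeChirp hL Y χ),
    ae_mulVec hL (Lp.coeFn_add φ χ)] with x hφχ hφ hχ hadd hcomp
  rw [hφχ, hadd, Pi.add_apply, hφ, hχ, hcomp, Pi.add_apply, mul_add]

theorem squeezeChirp_smul (hL : L.det ≠ 0) (Y : Matrix ι ι ℝ) (c : ℂ) (φ : Modes ι) :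
    squeezeChirp hL Y (c • φ) = c • squeezeChirp hL Y φ := by
  refine Lp.ext ?_
  filter_upwards [squeezeChirp_coeFn hL Y (c • φ), squeezeChirp_coeFn hL Y φ,
    Lp.coeFn_smul c (squeezeChirp hL Y φ), ae_mulVec hL (Lp.coeFn_smul c φ)]
    with x hcφ hφ hsmul hcomp
  rw [hcφ, hsmul, Pi.smul_apply, hφ, hcomp, Pi.smul_apply, smul_eq_mul, smul_eq_mul,
    mul_left_comm]

theorem norm_squeezeChirp (hL : L.det ≠ 0) (Y : Matrix ι ι ℝ) (φ : Modes ι) :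
    ‖squeezeChirp hL Y φ‖ = ‖φ‖ := by
  refine (sq_eq_sq₀ (norm_nonneg _) (norm_nonneg _)).1 ?_
  rw [norm_sq_modes, norm_sq_modes, ← abs_det_mul_integral_comp_mulVec hL fun x => ‖φ x‖ ^ 2,
    ← integral_const_mul]
  refine integral_congr_ae ?_
  filter_upwards [squeezeChirp_coeFn hL Y φ] with x hx
  rw [hx, norm_mul, mul_pow, norm_chirp, Real.sq_sqrt (abs_nonneg _)]

theorem squeezeChirp_surjective (hL : L.det ≠ 0) (Y : Matrix ι ι ℝ) :
    Function.Surjective (squeezeChirp hL Y) := by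
  intro φ
  have hL' : L⁻¹.det ≠ 0 := by
    rw [det_nonsing_inv, Ring.inverse_eq_inv]
    exact inv_ne_zero hL
  refine ⟨squeezeChirp hL' (-(L⁻¹ᵀ * Y * L⁻¹)) φ, Lp.ext ?_⟩
  filter_upwards [squeezeChirp_coeFn hL Y (squeezeChirp hL' (-(L⁻¹ᵀ * Y * L⁻¹)) φ),
    ae_mulVec hL (squeezeChirp_coeFn hL' (-(L⁻¹ᵀ * Y * L⁻¹)) φ)] with x houter hinner
  rw [houter, hinner, mulVec_mulVec, nonsing_inv_mul _ hL.isUnit, one_mulVec, ← mul_assoc,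
    chirp_mul_chirp_inv hL, one_mul]

/-- `squeezeChirp` as a unitary. -/
def squeezeChirpEquiv (hL : L.det ≠ 0) (Y : Matrix ι ι ℝ) : Modes ι ≃ₗᵢ[ℂ] Modes ι :=
  LinearIsometryEquiv.ofSurjective
    { toFun := squeezeChirp hL Y
      map_add' := squeezeChirp_add hL Y
      map_smul' := squeezeChirp_smul hL Y
      norm_map' := norm_squeezeChirp hL Y }
    (squeezeChirp_surjective hL Y)

theorem squeezeChirpEquiv_apply (hL : L.det ≠ 0) (Y : Matrix ι ι ℝ) (φ : Modes ι) :
    squeezeChirpEquiv hL Y φ = squeezeChirp hL Y φ := rfl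

/-- The symplectic matrix by which `squeezeChirp` acts on phase space. -/
def squeezeChirpMatrix (L Y : Matrix ι ι ℝ) : Matrix (ι ⊕ ι) (ι ⊕ ι) ℝ :=
  fromBlocks Lᵀ (-(Y * L⁻¹)) 0 L⁻¹

/-- The inverse of `squeezeChirpMatrix`; covariance matrices transform by congruence with it. -/
def squeezeChirpMatrixInv (L Y : Matrix ι ι ℝ) : Matrix (ι ⊕ ι) (ι ⊕ ι) ℝ :=
  fromBlocks L⁻¹ᵀ (L⁻¹ᵀ * Y) 0 L

theorem transpose_mul_inv_transpose (hL : L.det ≠ 0) : Lᵀ * L⁻¹ᵀ = 1 := by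
  rw [← transpose_mul, nonsing_inv_mul _ hL.isUnit, transpose_one]

theorem squeezeChirpMatrix_mem_symplecticGroup (hL : L.det ≠ 0) (hY : Y.IsSymm) :
    squeezeChirpMatrix L Y ∈ symplecticGroup ι ℝ := by
  rw [SymplecticGroup.mem_iff, squeezeChirpMatrix, J, fromBlocks_transpose, fromBlocks_multiply,
    fromBlocks_multiply]
  simp [transpose_mul_inv_transpose hL, hY.eq, Matrix.mul_assoc, nonsing_inv_mul _ hL.isUnit,
    ← Matrix.mul_assoc Lᵀ]

theorem squeezeChirpMatrix_mul_inv (hL : L.det ≠ 0) (Y : Matrix ι ι ℝ) :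
    squeezeChirpMatrix L Y * squeezeChirpMatrixInv L Y = 1 := by
  have hinv : Lᵀ * L⁻¹ᵀ = 1 := transpose_mul_inv_transpose hL
  rw [squeezeChirpMatrix, squeezeChirpMatrixInv, fromBlocks_multiply, ← fromBlocks_one,
    ← Matrix.mul_assoc, hinv]
  simp [Matrix.mul_assoc, nonsing_inv_mul _ hL.isUnit]

theorem squeezeChirpMatrix_mulVec (L Y : Matrix ι ι ℝ) (u v : ι → ℝ) :
    squeezeChirpMatrix L Y *ᵥ Sum.elim u v =
      Sum.elim (Lᵀ *ᵥ u - Y *ᵥ (L⁻¹ *ᵥ v)) (L⁻¹ *ᵥ v) := by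
  rw [squeezeChirpMatrix, fromBlocks_mulVec]
  simp [neg_mulVec, sub_eq_add_neg]

theorem chirp_mul_weylPhase (L : Matrix ι ι ℝ) (hY : Y.IsSymm) (u w x : ι → ℝ) :
    chirp L Y x * weylPhase (Sum.elim u (L *ᵥ w)) (L *ᵥ x) =
      weylPhase (Sum.elim (Lᵀ *ᵥ u - Y *ᵥ w) w) x * chirp L Y (x + w) := by
  have hexponent : x ⬝ᵥ Y *ᵥ x / 2 + (u ⬝ᵥ L *ᵥ x + u ⬝ᵥ L *ᵥ w / 2) =
      (Lᵀ *ᵥ u - Y *ᵥ w) ⬝ᵥ x + (Lᵀ *ᵥ u - Y *ᵥ w) ⬝ᵥ w / 2 + (x + w) ⬝ᵥ Y *ᵥ (x + w) / 2 := by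
    have htranspose : ∀ y, (Lᵀ *ᵥ u) ⬝ᵥ y = u ⬝ᵥ L *ᵥ y := fun y => by
      rw [dotProduct_mulVec, mulVec_transpose]
    rw [sub_dotProduct, sub_dotProduct, htranspose, htranspose, mulVec_add, add_dotProduct,
      dotProduct_add, dotProduct_add, dotProduct_comm (Y *ᵥ w) x, dotProduct_comm (Y *ᵥ w) w,
      dotProduct_mulVec_comm hY x w]
    ring
  rw [chirp, chirp, mul_assoc, mul_left_comm _ ((Real.sqrt |L.det| : ℝ) : ℂ), weylPhase,
    weylPhase, ← Complex.exp_add, ← Complex.exp_add, ← mul_add, ← mul_add, ← Complex.ofReal_add,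
    ← Complex.ofReal_add]
  exact congrArg (fun t : ℝ => (Real.sqrt |L.det| : ℂ) * Complex.exp (Complex.I * (t : ℂ)))
    hexponent

theorem squeezeChirp_weyl (hL : L.det ≠ 0) (hY : Y.IsSymm) (ξ : ι ⊕ ι → ℝ) (φ : Modes ι) :
    squeezeChirp hL Y (weyl ξ φ) = weyl (squeezeChirpMatrix L Y *ᵥ ξ) (squeezeChirp hL Y φ) := by
  obtain ⟨u, w, rfl⟩ : ∃ u w, ξ = Sum.elim u (L *ᵥ w) :=
    ⟨ξ ∘ .inl, L⁻¹ *ᵥ (ξ ∘ .inr), by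
      rw [mulVec_mulVec, mul_nonsing_inv _ hL.isUnit, one_mulVec, Sum.elim_comp_inl_inr]⟩
  rw [squeezeChirpMatrix_mulVec, mulVec_mulVec w L⁻¹ L, nonsing_inv_mul _ hL.isUnit, one_mulVec]
  refine Lp.ext ?_
  filter_upwards [squeezeChirp_coeFn hL Y (weyl (Sum.elim u (L *ᵥ w)) φ),
    weyl_coeFn (Sum.elim (Lᵀ *ᵥ u - Y *ᵥ w) w) (squeezeChirp hL Y φ),
    ae_mulVec hL (weyl_coeFn (Sum.elim u (L *ᵥ w)) φ),
    ae_translate (squeezeChirp_coeFn hL Y φ) w] with x hleft hright hweyl hchirp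
  have hshift : (fun i => (L *ᵥ x) i + (L *ᵥ w) i) = L *ᵥ (x + w) := (mulVec_add L x w).symm
  simp only [Sum.elim_inr] at hright hweyl
  rw [hleft, hright, hweyl, hchirp, hshift, ← mul_assoc, ← mul_assoc,
    chirp_mul_weylPhase L hY]
  rfl

theorem isGaussianUnitary_squeezeChirpEquiv (hL : L.det ≠ 0) (hY : Y.IsSymm) :
    IsGaussianUnitary (squeezeChirpEquiv hL Y) := by
  refine ⟨squeezeChirpMatrix L Y, squeezeChirpMatrix_mem_symplecticGroup hL hY, 0, fun ξ φ => ?_⟩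
  rw [zero_dotProduct, Complex.ofReal_zero, mul_zero, Complex.exp_zero, one_smul,
    squeezeChirpEquiv_apply, squeezeChirpEquiv_apply, squeezeChirp_weyl hL hY]

theorem IsPureGaussianWithCov.squeezeChirp {ψ : Modes ι} {Γ : Matrix (ι ⊕ ι) (ι ⊕ ι) ℝ}
    (hψ : IsPureGaussianWithCov ψ Γ) (hL : L.det ≠ 0) (hY : Y.IsSymm) :
    IsPureGaussianWithCov (squeezeChirpEquiv hL Y ψ)
      ((squeezeChirpMatrixInv L Y)ᵀ * Γ * squeezeChirpMatrixInv L Y) := by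
  obtain ⟨hnorm, hsymm, hchar⟩ := hψ
  refine ⟨by rw [LinearIsometryEquiv.norm_map, hnorm], ?_, fun ξ => ?_⟩
  · rw [Matrix.IsSymm, transpose_mul, transpose_mul, transpose_transpose, hsymm.eq,
      Matrix.mul_assoc]
  · have hξ : squeezeChirpMatrix L Y *ᵥ (squeezeChirpMatrixInv L Y *ᵥ ξ) = ξ := by
      rw [mulVec_mulVec, squeezeChirpMatrix_mul_inv hL, one_mulVec]
    have hcovariant : weyl ξ (squeezeChirpEquiv hL Y ψ) =
        squeezeChirpEquiv hL Y (weyl (squeezeChirpMatrixInv L Y *ᵥ ξ) ψ) := by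
      rw [squeezeChirpEquiv_apply, squeezeChirpEquiv_apply, squeezeChirp_weyl hL hY, hξ]
    rw [hcovariant, LinearIsometryEquiv.inner_map_map, hchar, ← mulVec_mulVec, ← mulVec_mulVec,
      dotProduct_mulVec ξ, vecMul_transpose]

end SqueezeChirp

section PositionDensity

theorem charFunDual_withDensity_ofReal {E : Type*} [NormedAddCommGroup E] [NormedSpace ℝ E]
    [MeasurableSpace E] {μ : Measure E} {f : E → ℝ} (hf : Integrable f μ) (hf₀ : ∀ x, 0 ≤ f x)
    (Λ : StrongDual ℝ E) :
    charFunDual (μ.withDensity fun x => ENNReal.ofReal (f x)) Λ =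
      ∫ x, Complex.exp ((Λ x : ℂ) * Complex.I) * (f x : ℂ) ∂μ := by
  rw [charFunDual_apply, integral_withDensity_eq_integral_toReal_smul₀
    hf.1.aemeasurable.ennreal_ofReal (by simp)]
  refine integral_congr_ae (Eventually.of_forall fun x => ?_)
  simp only [ENNReal.toReal_ofReal (hf₀ x), Complex.real_smul]
  rw [mul_comm]

theorem ae_eq_of_integral_cexp_eq {ι : Type*} [Fintype ι] {f g : (ι → ℝ) → ℝ}
    (hf : Integrable f) (hg : Integrable g) (hf₀ : ∀ x, 0 ≤ f x) (hg₀ : ∀ x, 0 ≤ g x)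
    (h : ∀ u : ι → ℝ, ∫ x, Complex.exp (((∑ i, u i * x i : ℝ) : ℂ) * Complex.I) * (f x : ℂ) =
      ∫ x, Complex.exp (((∑ i, u i * x i : ℝ) : ℂ) * Complex.I) * (g x : ℂ)) :
    f =ᵐ[volume] g := by
  have hfin_f : IsFiniteMeasure (volume.withDensity fun x => ENNReal.ofReal (f x)) :=
    isFiniteMeasure_withDensity_ofReal hf.2
  have hfin_g : IsFiniteMeasure (volume.withDensity fun x => ENNReal.ofReal (g x)) :=
    isFiniteMeasure_withDensity_ofReal hg.2
  have hmeasure : (volume.withDensity fun x => ENNReal.ofReal (f x)) =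
      volume.withDensity fun x => ENNReal.ofReal (g x) := by
    refine Measure.ext_of_charFunDual (funext fun Λ => ?_)
    classical
    obtain ⟨u, hu⟩ : ∃ u : ι → ℝ, ∀ x, Λ x = ∑ i, u i * x i := by
      refine ⟨fun i => Λ (Pi.single i 1), fun x => ?_⟩
      conv_lhs => rw [pi_eq_sum_univ' x, map_sum]
      exact Finset.sum_congr rfl fun i _ => by rw [map_smul, smul_eq_mul, mul_comm]
    simp only [charFunDual_withDensity_ofReal hf hf₀, charFunDual_withDensity_ofReal hg hg₀, hu]
    exact h u
  have hdensity := (withDensity_eq_iff_of_sigmaFinite hf.1.aemeasurable.ennreal_ofReal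
    hg.1.aemeasurable.ennreal_ofReal).1 hmeasure
  filter_upwards [hdensity] with x hx
  exact (ENNReal.ofReal_eq_ofReal_iff (hf₀ x) (hg₀ x)).1 hx

variable {ι : Type} [Fintype ι]

theorem inner_weyl_position_eq_integral (ψ : Modes ι) (u : ι → ℝ) :
    ⟪ψ, weyl (Sum.elim u 0) ψ⟫_ℂ =
      ∫ x, Complex.exp (((∑ i, u i * x i : ℝ) : ℂ) * Complex.I) * ((‖ψ x‖ ^ 2 : ℝ) : ℂ) := by
  rw [inner_weyl_eq_integral]
  refine integral_congr_ae (Eventually.of_forall fun x => ?_)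
  simp only [Sum.elim_inr, Pi.zero_apply, add_zero, weylPhase, Sum.elim_inl, mul_zero,
    Finset.sum_const_zero, zero_div]
  rw [mul_left_comm, RCLike.star_def, RCLike.conj_mul, mul_comm Complex.I]
  norm_cast

theorem norm_sq_ae_eq_gaussDensity {ψ : Modes ι}
    (h : ∀ u : ι → ℝ,
      ⟪ψ, weyl (Sum.elim u 0) ψ⟫_ℂ = Complex.exp (-((∑ i, u i ^ 2 : ℝ) : ℂ) / 4)) :
    (fun x => ‖ψ x‖ ^ 2) =ᵐ[volume] gaussDensity :=
  ae_eq_of_integral_cexp_eq (integrable_norm_sq_modes ψ) integrable_gaussDensity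
    (fun _ => by positivity) gaussDensity_nonneg fun u => by
      rw [← inner_weyl_position_eq_integral, h, integral_cexp_mul_gaussDensity]

end PositionDensity

section Autocorrelation

variable {ι : Type} [Fintype ι]

/-- The autocorrelation `x ↦ ψ̄(x) ψ(x + w)` of a wave function, whose Fourier transform is the
characteristic function of `ψ` at momentum displacement `w`. -/
def autocorrelation (ψ : Modes ι) (w x : ι → ℝ) : ℂ :=
  star (ψ x) * ψ fun i => x i + w i

theorem integrable_autocorrelation (ψ : Modes ι) (w : ι → ℝ) :
    Integrable (autocorrelation ψ w) :=
  (Lp.memLp ψ).star.integrable_mul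
    ((Lp.memLp ψ).comp_measurePreserving (measurePreserving_translate w))

theorem inner_weyl_eq_integral_autocorrelation (ψ : Modes ι) (u w : ι → ℝ) :
    ⟪ψ, weyl (Sum.elim u w) ψ⟫_ℂ =
      Complex.exp ((u ⬝ᵥ w / 2 : ℝ) * Complex.I) *
        ∫ x, Complex.exp ((u ⬝ᵥ x : ℝ) * Complex.I) * autocorrelation ψ w x := by
  rw [inner_weyl_eq_integral, ← integral_const_mul]
  refine integral_congr_ae (Eventually.of_forall fun x => ?_)
  simp only [autocorrelation, weylPhase, Sum.elim_inr, Sum.elim_inl, dotProduct]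
  rw [mul_left_comm, ← mul_assoc (Complex.exp _) (Complex.exp _), ← Complex.exp_add]
  congr 2
  push_cast
  ring

theorem inner_weyl_eq_coordFourier_autocorrelation (ψ : Modes ι) (w k : ι → ℝ) :
    ⟪ψ, weyl (Sum.elim (-(2 * Real.pi) • k) w) ψ⟫_ℂ =
      Complex.exp (((-(2 * Real.pi) • k) ⬝ᵥ w / 2 : ℝ) * Complex.I) *
        coordFourier (autocorrelation ψ w) k := by
  simp only [inner_weyl_eq_integral_autocorrelation, coordFourier, smul_dotProduct, smul_eq_mul,
    neg_mul]

theorem norm_coordFourier_autocorrelation (ψ : Modes ι) (w k : ι → ℝ) :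
    ‖coordFourier (autocorrelation ψ w) k‖ =
      ‖⟪ψ, weyl (Sum.elim (-(2 * Real.pi) • k) w) ψ⟫_ℂ‖ := by
  rw [inner_weyl_eq_coordFourier_autocorrelation, norm_mul, Complex.norm_exp_ofReal_mul_I, one_mul]

variable {ψ : Modes ι}

theorem norm_sq_autocorrelation_ae_eq (hψ : (fun x => ‖ψ x‖ ^ 2) =ᵐ[volume] gaussDensity)
    (w : ι → ℝ) :
    (fun x => ‖autocorrelation ψ w x‖ ^ 2) =ᵐ[volume] fun x =>
      (∫ y : ι → ℝ, Real.exp (-∑ i, y i ^ 2))⁻¹ ^ 2 * Real.exp (-(w ⬝ᵥ w)) *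
        Real.exp (-2 * ∑ i, x i ^ 2 + ∑ i, (-2 * w i) * x i) := by
  filter_upwards [hψ, ae_translate hψ w] with x hx hxw
  rw [autocorrelation, norm_mul, norm_star, mul_pow, hx, hxw, gaussDensity, gaussDensity,
    mul_mul_mul_comm, ← Real.exp_add, ← sq, mul_assoc (_ ^ 2), ← Real.exp_add]
  congr 2
  simp only [dotProduct, Finset.mul_sum, ← Finset.sum_neg_distrib, ← Finset.sum_add_distrib]
  exact Finset.sum_congr rfl fun i _ => by ring

theorem memLp_autocorrelation (hψ : (fun x => ‖ψ x‖ ^ 2) =ᵐ[volume] gaussDensity)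
    (w : ι → ℝ) : MemLp (autocorrelation ψ w) 2 := by
  rw [memLp_two_iff_integrable_sq_norm (integrable_autocorrelation ψ w).1]
  exact ((integrable_exp_quadratic two_pos fun i => -2 * w i).const_mul _).congr
    (norm_sq_autocorrelation_ae_eq hψ w).symm

theorem integral_norm_sq_autocorrelation (hψ : (fun x => ‖ψ x‖ ^ 2) =ᵐ[volume] gaussDensity)
    (w : ι → ℝ) :
    ∫ x, ‖autocorrelation ψ w x‖ ^ 2 =
      (∫ y : ι → ℝ, Real.exp (-∑ i, y i ^ 2))⁻¹ ^ 2 *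
        (∫ x : ι → ℝ, Real.exp (-2 * ∑ i, x i ^ 2)) * Real.exp (-(w ⬝ᵥ w) / 2) := by
  have hsq : (∑ i, (-2 * w i) ^ 2) / (4 * 2) = w ⬝ᵥ w / 2 := by
    simp only [mul_pow, ← Finset.mul_sum, dotProduct, ← sq]
    ring
  have hexp : Real.exp (-(w ⬝ᵥ w) / 2) = Real.exp (-(w ⬝ᵥ w)) * Real.exp (w ⬝ᵥ w / 2) := by
    rw [← Real.exp_add]
    congr 1
    ring
  rw [integral_congr_ae (norm_sq_autocorrelation_ae_eq hψ w), integral_const_mul,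
    integral_exp_quadratic two_pos, hsq, hexp]
  ring

end Autocorrelation

section StandardForm

open Matrix
open scoped MatrixOrder

variable {ι : Type} [Fintype ι]

theorem dotProduct_fromBlocks_mulVec (A B C D : Matrix ι ι ℝ) (u v u' v' : ι → ℝ) :
    Sum.elim u v ⬝ᵥ (fromBlocks A B C D) *ᵥ Sum.elim u' v' =
      u ⬝ᵥ A *ᵥ u' + u ⬝ᵥ B *ᵥ v' + v ⬝ᵥ C *ᵥ u' + v ⬝ᵥ D *ᵥ v' := by
  rw [fromBlocks_mulVec, sumElim_dotProduct_sumElim, dotProduct_add, dotProduct_add]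
  simp only [Function.comp_def, Sum.elim_inl, Sum.elim_inr]
  ring

theorem symplForm_elim (u v u' v' : ι → ℝ) :
    symplForm (Sum.elim u v) (Sum.elim u' v') = u' ⬝ᵥ v - u ⬝ᵥ v' := by
  simp [symplForm, dotProduct, Finset.sum_sub_distrib]

theorem IsPureGaussianWithCov.posDef_position {ψ : Modes ι} {Γ : Matrix (ι ⊕ ι) (ι ⊕ ι) ℝ}
    (hψ : IsPureGaussianWithCov ψ Γ) : Γ.toBlocks₁₁.PosDef := by
  have hsymm : Γ.toBlocks₁₁.IsHermitian := by
    ext i j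
    exact congrFun (congrFun hψ.2.1 (.inl i)) (.inl j)
  refine Matrix.PosDef.of_dotProduct_mulVec_pos hsymm fun u hu => ?_
  obtain ⟨η, hη⟩ := hψ.exists_hasField (Sum.elim u 0)
  obtain ⟨θ, hθ⟩ := hψ.exists_hasField (Sum.elim 0 u)
  have hnorm := hψ.norm_sq_field hη
  rw [← fromBlocks_toBlocks Γ, dotProduct_fromBlocks_mulVec] at hnorm
  simp only [mulVec_zero, dotProduct_zero, add_zero, zero_dotProduct] at hnorm
  have hη_ne : η ≠ 0 := by
    rintro rfl
    exact hu (by simpa [symplForm_elim, hψ.1] using hη.inner_sub_inner hθ)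
  have hη_pos : 0 < ‖η‖ ^ 2 := by positivity
  rw [star_trivial]
  linarith

section PositionBlockOne

variable [DecidableEq ι] {ψ : Modes ι} {C D : Matrix ι ι ℝ}
  (hψ : IsPureGaussianWithCov ψ (fromBlocks 1 C Cᵀ D))
include hψ

theorem IsPureGaussianWithCov.inner_weyl_elim (u w : ι → ℝ) :
    ⟪ψ, weyl (Sum.elim u w) ψ⟫_ℂ =
      (Real.exp (-(u ⬝ᵥ u + 2 * (u ⬝ᵥ C *ᵥ w) + w ⬝ᵥ D *ᵥ w) / 4) : ℝ) := by
  rw [hψ.2.2, dotProduct_fromBlocks_mulVec, one_mulVec, dotProduct_mulVec w Cᵀ u,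
    vecMul_transpose, dotProduct_comm (C *ᵥ w) u]
  congr 4
  ring

theorem IsPureGaussianWithCov.norm_sq_ae_eq :
    (fun x => ‖ψ x‖ ^ 2) =ᵐ[volume] gaussDensity :=
  norm_sq_ae_eq_gaussDensity fun u => by
    rw [hψ.inner_weyl_elim, mulVec_zero, mulVec_zero, dotProduct_zero, zero_dotProduct, mul_zero,
      add_zero, add_zero, dotProduct]
    push_cast
    simp only [sq]

theorem IsPureGaussianWithCov.norm_sq_coordFourier_autocorrelation (w k : ι → ℝ) :
    ‖coordFourier (autocorrelation ψ w) k‖ ^ 2 = Real.exp (-(w ⬝ᵥ D *ᵥ w) / 2) *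
      Real.exp (-(2 * Real.pi ^ 2) * ∑ i, k i ^ 2 +
        ∑ i, (2 * Real.pi * (C *ᵥ w) i) * k i) := by
  have hquadratic : ∑ i, k i ^ 2 = k ⬝ᵥ k := by simp only [dotProduct, sq]
  have hlinear : ∑ i, (2 * Real.pi * (C *ᵥ w) i) * k i = 2 * Real.pi * (k ⬝ᵥ C *ᵥ w) := by
    rw [dotProduct, Finset.mul_sum]
    exact Finset.sum_congr rfl fun i _ => by ring
  rw [norm_coordFourier_autocorrelation, hψ.inner_weyl_elim, Complex.norm_real, Real.norm_eq_abs,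
    abs_of_pos (Real.exp_pos _), ← Real.exp_nat_mul, ← Real.exp_add, hquadratic, hlinear]
  simp only [smul_dotProduct, dotProduct_smul, smul_eq_mul]
  congr 1
  push_cast
  ring

theorem IsPureGaussianWithCov.integral_norm_sq_coordFourier_autocorrelation (w : ι → ℝ) :
    ∫ k, ‖coordFourier (autocorrelation ψ w) k‖ ^ 2 =
      (∫ x : ι → ℝ, Real.exp (-(2 * Real.pi ^ 2) * ∑ i, x i ^ 2)) *
        Real.exp (((C *ᵥ w) ⬝ᵥ (C *ᵥ w) - w ⬝ᵥ D *ᵥ w) / 2) := by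
  have hsq : (∑ i, (2 * Real.pi * (C *ᵥ w) i) ^ 2) / (4 * (2 * Real.pi ^ 2)) =
      (C *ᵥ w) ⬝ᵥ (C *ᵥ w) / 2 := by
    simp only [mul_pow, ← Finset.mul_sum, dotProduct, ← sq]
    field_simp
    ring
  rw [integral_congr_ae (Eventually.of_forall (hψ.norm_sq_coordFourier_autocorrelation w)),
    integral_const_mul, integral_exp_quadratic (by positivity), hsq, mul_left_comm,
    ← Real.exp_add]
  congr 2
  ring

/-- Plancherel for the autocorrelation, divided by its instance at `v = 0`, compares two
exponentials. It expresses purity: a mixed Gaussian state has only `≥`. -/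
theorem IsPureGaussianWithCov.momentum_block (v : ι → ℝ) :
    v ⬝ᵥ D *ᵥ v = v ⬝ᵥ v + (C *ᵥ v) ⬝ᵥ (C *ᵥ v) := by
  have hplancherel := fun w => integral_norm_sq_coordFourier (integrable_autocorrelation ψ w)
    (memLp_autocorrelation hψ.norm_sq_ae_eq w)
  simp only [hψ.integral_norm_sq_coordFourier_autocorrelation,
    integral_norm_sq_autocorrelation hψ.norm_sq_ae_eq] at hplancherel
  have hzero := hplancherel 0
  simp only [mulVec_zero, dotProduct_zero, sub_zero, neg_zero, zero_div, Real.exp_zero,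
    mul_one] at hzero
  have hpos : 0 < ∫ x : ι → ℝ, Real.exp (-(2 * Real.pi ^ 2) * ∑ i, x i ^ 2) :=
    integral_exp_neg_mul_sum_sq_pos (by positivity)
  have hexp := hplancherel v
  rw [← hzero] at hexp
  have hexponent := Real.exp_injective (mul_left_cancel₀ hpos.ne' hexp)
  linarith

/-- The field vectors satisfy `p(w)ψ = q(Cw)ψ + i q(w)ψ`, as both sides have the same inner
products; the canonical commutator `[p(v), p(w)] = 0` then forces `C` to be symmetric. -/
theorem IsPureGaussianWithCov.cross_block_symm (v w : ι → ℝ) :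
    (C *ᵥ v) ⬝ᵥ w = v ⬝ᵥ C *ᵥ w := by
  choose P hP using fun w : ι → ℝ => hψ.exists_hasField (Sum.elim 0 w)
  choose Q hQ using fun u : ι → ℝ => hψ.exists_hasField (Sum.elim u 0)
  have hPP : ∀ w, ⟪P w, P w⟫_ℂ = ((w ⬝ᵥ w + (C *ᵥ w) ⬝ᵥ (C *ᵥ w) : ℝ) : ℂ) / 2 := fun w => by
    rw [hψ.inner_field (hP w) (hP w), symplForm_self, dotProduct_fromBlocks_mulVec,
      hψ.momentum_block]
    simp
  have hQQ : ∀ a b, ⟪Q a, Q b⟫_ℂ = ((a ⬝ᵥ b : ℝ) : ℂ) / 2 := fun a b => by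
    rw [hψ.inner_field (hQ a) (hQ b), symplForm_elim, dotProduct_fromBlocks_mulVec]
    simp
  have hPQ : ∀ w a, ⟪P w, Q a⟫_ℂ =
      (((C *ᵥ w) ⬝ᵥ a : ℝ) - Complex.I * ((a ⬝ᵥ w : ℝ) : ℂ)) / 2 := fun w a => by
    rw [hψ.inner_field (hP w) (hQ a), symplForm_elim, dotProduct_fromBlocks_mulVec,
      dotProduct_mulVec w Cᵀ a, vecMul_transpose]
    simp
  have hQP : ∀ w a, ⟪Q a, P w⟫_ℂ =
      (((C *ᵥ w) ⬝ᵥ a : ℝ) + Complex.I * ((a ⬝ᵥ w : ℝ) : ℂ)) / 2 := fun w a => by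
    rw [← inner_conj_symm, hPQ]
    simp [Complex.conj_ofNat]
  have hPw : ∀ w, P w = Q (C *ᵥ w) + Complex.I • Q w := fun w => by
    rw [← sub_eq_zero, ← inner_self_eq_zero (𝕜 := ℂ)]
    simp only [inner_sub_left, inner_sub_right, inner_add_left, inner_add_right, inner_smul_left,
      inner_smul_right, hPP, hQQ, hPQ, hQP, Complex.conj_I, dotProduct_comm w (C *ᵥ w)]
    push_cast
    linear_combination (((w ⬝ᵥ w : ℝ) : ℂ) / 2) * Complex.I_mul_I
  have hcomm := (hP v).inner_sub_inner (hP w)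
  rw [symplForm_elim, zero_dotProduct, zero_dotProduct, hPw v, hPw w] at hcomm
  simp only [inner_add_left, inner_add_right, inner_smul_left, inner_smul_right, hQQ,
    Complex.conj_I] at hcomm
  have him := congrArg Complex.im hcomm
  simp only [neg_mul, Complex.sub_im, Complex.add_im, Complex.div_ofNat_im, Complex.ofReal_im,
    zero_div, Complex.neg_im, Complex.mul_im, Complex.I_re, mul_zero, Complex.I_im,
    Complex.div_ofNat_re, Complex.ofReal_re, one_mul, zero_add, mul_neg, zero_mul, neg_zero,
    Complex.add_re, Complex.neg_re, Complex.mul_re, sub_self, add_zero, Complex.ofReal_zero,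
    inner_self_eq_norm_sq_to_K, Complex.coe_algebraMap, Complex.zero_im] at him
  rw [dotProduct_comm w (C *ᵥ v), dotProduct_comm (C *ᵥ w) v] at him
  linarith

theorem IsPureGaussianWithCov.cross_block_eq_zero (hC : Cᵀ = -C) : C = 0 := by
  ext i j
  have hsymm := hψ.cross_block_symm (Pi.single i 1) (Pi.single j 1)
  rw [mulVec_single_one, mulVec_single_one, dotProduct_single_one, single_one_dotProduct] at hsymm
  simp only [col_apply] at hsymm
  have hanti := congrFun (congrFun hC i) j
  simp only [transpose_apply, Matrix.neg_apply] at hanti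
  rw [Matrix.zero_apply]
  linarith

theorem IsPureGaussianWithCov.trace_eq_two_mul_card (hC : Cᵀ = -C) :
    (fromBlocks 1 C Cᵀ D).trace = 2 * Fintype.card ι := by
  have hD : ∀ i, D i i = 1 := fun i => by
    have hmomentum := hψ.momentum_block (Pi.single i 1)
    rw [hψ.cross_block_eq_zero hC, zero_mulVec, dotProduct_zero, add_zero, mulVec_single_one,
      single_one_dotProduct] at hmomentum
    simpa using hmomentum
  simp [Matrix.trace, hD, two_mul]

end PositionBlockOne

theorem exists_mul_transpose_of_posDef {n : Type*} [Fintype n] [DecidableEq n]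
    {A : Matrix n n ℝ} (hA : A.PosDef) : ∃ L : Matrix n n ℝ, L.det ≠ 0 ∧ A = L * Lᵀ := by
  obtain ⟨B, hB⟩ := CStarAlgebra.nonneg_iff_eq_star_mul_self.mp hA.posSemidef.nonneg
  rw [star_eq_conjTranspose, conjTranspose_eq_transpose_of_trivial] at hB
  refine ⟨Bᵀ, fun hdet => hA.det_pos.ne' ?_, by rw [hB, transpose_transpose]⟩
  rw [hB, det_mul, hdet, zero_mul]

variable [DecidableEq ι]

theorem transpose_mul_mul_squeezeChirpMatrixInv {L : Matrix ι ι ℝ} (hL : L.det ≠ 0)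
    (Y B D : Matrix ι ι ℝ) :
    ∃ D', (squeezeChirpMatrixInv L Y)ᵀ * fromBlocks (L * Lᵀ) B Bᵀ D * squeezeChirpMatrixInv L Y =
      fromBlocks 1 (Y + L⁻¹ * B * L) (Y + L⁻¹ * B * L)ᵀ D' := by
  have hright : Lᵀ * L⁻¹ᵀ = 1 := transpose_mul_inv_transpose hL
  have hleft : L⁻¹ * (L * Lᵀ) = Lᵀ := by
    rw [← Matrix.mul_assoc, nonsing_inv_mul _ hL.isUnit, Matrix.one_mul]
  rw [squeezeChirpMatrixInv, fromBlocks_transpose, fromBlocks_multiply, fromBlocks_multiply]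
  refine ⟨_, fromBlocks_inj.2 ⟨?_, ?_, ?_, rfl⟩⟩
  · simp [hleft, hright]
  · simp [hleft, ← Matrix.mul_assoc Lᵀ, hright]
  · simp [Matrix.add_mul, Matrix.mul_assoc, hleft, hright]

theorem IsPureGaussianWithCov.exists_standard_form {ψ : Modes ι} {Γ : Matrix (ι ⊕ ι) (ι ⊕ ι) ℝ}
    (hψ : IsPureGaussianWithCov ψ Γ) :
    ∃ (U : Modes ι ≃ₗᵢ[ℂ] Modes ι) (C D : Matrix ι ι ℝ), IsGaussianUnitary U ∧ Cᵀ = -C ∧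
      IsPureGaussianWithCov (U ψ) (fromBlocks 1 C Cᵀ D) := by
  obtain ⟨L, hL, hΓ₁₁⟩ := exists_mul_transpose_of_posDef hψ.posDef_position
  set M := L⁻¹ * Γ.toBlocks₁₂ * L with hM
  have hY : (-((1 / 2 : ℝ) • (M + Mᵀ))).IsSymm := by
    rw [Matrix.IsSymm, transpose_neg, transpose_smul, transpose_add, transpose_transpose, add_comm]
  have hΓ : Γ = fromBlocks (L * Lᵀ) Γ.toBlocks₁₂ Γ.toBlocks₁₂ᵀ Γ.toBlocks₂₂ := by
    have hsymm := isSymm_fromBlocks_iff.1 ((fromBlocks_toBlocks Γ).symm ▸ hψ.2.1)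
    rw [← hΓ₁₁, hsymm.2.1, fromBlocks_toBlocks]
  obtain ⟨D, hD⟩ := transpose_mul_mul_squeezeChirpMatrixInv hL
    (-((1 / 2 : ℝ) • (M + Mᵀ))) Γ.toBlocks₁₂ Γ.toBlocks₂₂
  have hU := hψ.squeezeChirp hL hY
  rw [hΓ, hD, ← hM] at hU
  refine ⟨_, _, D, isGaussianUnitary_squeezeChirpEquiv hL hY, ?_, hU⟩
  ext i j
  simp
  ring

theorem IsPureGaussianWithCov.globalMinEnergy_le {ψ : Modes ι} {Γ : Matrix (ι ⊕ ι) (ι ⊕ ι) ℝ}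
    (hψ : IsPureGaussianWithCov ψ Γ) :
    globalMinEnergy ψ ≤ ENNReal.ofReal (Fintype.card ι / 2) := by
  obtain ⟨U, C, D, hU, hC, hUψ⟩ := hψ.exists_standard_form
  calc globalMinEnergy ψ ≤ energy (U ψ) := iInf₂_le U hU
    _ = ENNReal.ofReal (2 * Fintype.card ι / 4) := by
      rw [hUψ.energy_eq, hUψ.trace_eq_two_mul_card hC]
    _ = ENNReal.ofReal (Fintype.card ι / 2) := by
      congr 1
      ring

end StandardForm

section CoherentStates

section GaussRoot

variable {ι : Type*} [Fintype ι]

/-- The vacuum wave function `π^(-N/4) exp (-|x|² / 2)`, the square root of `gaussDensity`. -/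
def gaussRoot (x : ι → ℝ) : ℝ :=
  √(∫ y : ι → ℝ, Real.exp (-∑ i, y i ^ 2))⁻¹ * Real.exp (-(∑ i, x i ^ 2) / 2)

theorem gaussRoot_sq (x : ι → ℝ) : gaussRoot x ^ 2 = gaussDensity x := by
  rw [gaussRoot, gaussDensity, mul_pow, Real.sq_sqrt (inv_nonneg.2 integral_exp_neg_sum_sq_pos.le),
    ← Real.exp_nat_mul]
  congr 2
  push_cast
  ring

theorem gaussRoot_pos (x : ι → ℝ) : 0 < gaussRoot x :=
  mul_pos (Real.sqrt_pos.2 (inv_pos.2 integral_exp_neg_sum_sq_pos)) (Real.exp_pos _)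

theorem gaussRoot_le_gaussRoot_zero (x : ι → ℝ) : gaussRoot x ≤ gaussRoot (0 : ι → ℝ) := by
  refine mul_le_mul_of_nonneg_left (Real.exp_le_exp.2 ?_) (Real.sqrt_nonneg _)
  have hsum : 0 ≤ ∑ i, x i ^ 2 := Finset.sum_nonneg fun i _ => sq_nonneg _
  simp only [Pi.zero_apply, ne_eq, OfNat.ofNat_ne_zero, not_false_eq_true, zero_pow,
    Finset.sum_const_zero]
  linarith

theorem continuous_gaussRoot : Continuous (gaussRoot (ι := ι)) := by
  unfold gaussRoot
  fun_prop

theorem gaussRoot_sum {α β : Type} [Fintype α] [Fintype β] (z : α ⊕ β → ℝ) :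
    gaussRoot z = gaussRoot (fun i => z (.inl i)) * gaussRoot fun j => z (.inr j) := by
  have hα : Integrable fun x : α → ℝ => Real.exp (-∑ i, x i ^ 2) := by
    simpa using integrable_exp_quadratic (ι := α) one_pos 0
  have hβ : Integrable fun y : β → ℝ => Real.exp (-∑ j, y j ^ 2) := by
    simpa using integrable_exp_quadratic (ι := β) one_pos 0
  have hnormalisation := (integrable_tensor hα hβ).2
  simp only [← Real.exp_add, ← neg_add] at hnormalisation
  simp only [gaussRoot, Fintype.sum_sum_type, hnormalisation]
  rw [mul_inv, Real.sqrt_mul (inv_nonneg.2 integral_exp_neg_sum_sq_pos.le), mul_mul_mul_comm,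
    ← Real.exp_add, neg_add, add_div]

end GaussRoot

section CoherentState

variable {ι : Type} [Fintype ι]

/-- The wave function `y ↦ exp (2πi k·y) g(y - x)` of the vacuum `g` displaced to position `x` and
momentum `2π k`, where `p = (x, k)`. -/
def coherentWave (p : (ι → ℝ) × (ι → ℝ)) (y : ι → ℝ) : ℂ :=
  Complex.exp ((2 * Real.pi * (p.2 ⬝ᵥ y) : ℝ) * Complex.I) * gaussRoot (y - p.1)

theorem norm_sq_coherentWave (p : (ι → ℝ) × (ι → ℝ)) (y : ι → ℝ) :
    ‖coherentWave p y‖ ^ 2 = gaussDensity (y - p.1) := by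
  rw [coherentWave, norm_mul, Complex.norm_exp_ofReal_mul_I, one_mul, Complex.norm_real,
    Real.norm_eq_abs, sq_abs, gaussRoot_sq]

theorem memLp_coherentWave (p : (ι → ℝ) × (ι → ℝ)) : MemLp (coherentWave p) 2 := by
  have hcont : Continuous (coherentWave p) := by
    have := continuous_gaussRoot (ι := ι)
    unfold coherentWave
    fun_prop
  rw [memLp_two_iff_integrable_sq_norm hcont.aestronglyMeasurable]
  simp only [norm_sq_coherentWave]
  exact integrable_gaussDensity.comp_sub_right p.1

/-- The coherent state at the phase-space point `p`, with the coordinates of `coherentWave`. -/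
def coherentState (p : (ι → ℝ) × (ι → ℝ)) : Modes ι :=
  (memLp_coherentWave p).toLp _

theorem coherentState_coeFn (p : (ι → ℝ) × (ι → ℝ)) :
    coherentState p =ᵐ[volume] coherentWave p :=
  (memLp_coherentWave p).coeFn_toLp

theorem norm_coherentState (p : (ι → ℝ) × (ι → ℝ)) : ‖coherentState p‖ = 1 := by
  refine (sq_eq_sq₀ (norm_nonneg _) one_pos.le).1 ?_
  rw [norm_sq_modes, one_pow, ← integral_gaussDensity (ι := ι),
    ← integral_sub_right_eq_self gaussDensity p.1]
  refine integral_congr_ae ?_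
  filter_upwards [coherentState_coeFn p] with y hy
  rw [hy, norm_sq_coherentWave]

/-- The wave function `v` localised by the vacuum centred at `x`. -/
def windowed (v : Modes ι) (x y : ι → ℝ) : ℂ :=
  gaussRoot (y - x) * v y

theorem integrable_windowed (v : Modes ι) (x : ι → ℝ) : Integrable (windowed v x) := by
  have hwindow : MemLp (fun y : ι → ℝ => (gaussRoot (y - x) : ℂ)) 2 :=
    (memLp_coherentWave (x, 0)).ae_eq (Eventually.of_forall fun y => by simp [coherentWave])
  exact hwindow.integrable_mul (Lp.memLp v)

theorem memLp_windowed (v : Modes ι) (x : ι → ℝ) : MemLp (windowed v x) 2 := by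
  refine (Lp.memLp v).of_le_mul (c := gaussRoot (0 : ι → ℝ)) (integrable_windowed v x).1
    (Eventually.of_forall fun y => ?_)
  rw [windowed, norm_mul, Complex.norm_real, Real.norm_of_nonneg (gaussRoot_pos _).le]
  exact mul_le_mul_of_nonneg_right (gaussRoot_le_gaussRoot_zero _) (norm_nonneg _)

theorem inner_coherentState (p : (ι → ℝ) × (ι → ℝ)) (v : Modes ι) :
    ⟪coherentState p, v⟫_ℂ = coordFourier (windowed v p.1) p.2 := by
  rw [L2.inner_def, coordFourier]
  refine integral_congr_ae ?_
  filter_upwards [coherentState_coeFn p] with y hy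
  rw [RCLike.inner_apply, hy, coherentWave, windowed, map_mul, Complex.conj_ofReal,
    ← Complex.exp_conj, map_mul, Complex.conj_ofReal, Complex.conj_I, mul_neg, ← neg_mul,
    ← Complex.ofReal_neg]
  ring

theorem eq_zero_of_forall_inner_coherentState_eq_zero {v : Modes ι}
    (hv : ∀ p, ⟪coherentState p, v⟫_ℂ = 0) : v = 0 := by
  have hplancherel :=
    integral_norm_sq_coordFourier (integrable_windowed v 0) (memLp_windowed v 0)
  have hzero : ∀ k, coordFourier (windowed v 0) k = 0 := fun k =>
    (inner_coherentState (0, k) v).symm.trans (hv _)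
  simp only [hzero, norm_zero, ne_eq, OfNat.ofNat_ne_zero, not_false_eq_true, zero_pow,
    integral_zero] at hplancherel
  have hwindowed := (integral_eq_zero_iff_of_nonneg (fun y => sq_nonneg _)
    ((memLp_two_iff_integrable_sq_norm (integrable_windowed v 0).1).1
      (memLp_windowed v 0))).1 hplancherel.symm
  refine Lp.ext ?_
  filter_upwards [hwindowed, Lp.coeFn_zero ℂ 2 (volume : Measure (ι → ℝ))] with y hy hy₀
  rw [hy₀]
  simpa [windowed, (gaussRoot_pos _).ne'] using hy

end CoherentState

section TensorTotal

variable {α β : Type} [Fintype α] [Fintype β]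

theorem tensor_coherentState (p : (α → ℝ) × (α → ℝ)) (q : (β → ℝ) × (β → ℝ)) :
    tensor (coherentState p) (coherentState q) =
      coherentState (Sum.elim p.1 q.1, Sum.elim p.2 q.2) := by
  refine Lp.ext ?_
  filter_upwards [tensor_coeFn (coherentState p) (coherentState q),
    quasiMeasurePreserving_inl.ae (coherentState_coeFn p),
    quasiMeasurePreserving_inr.ae (coherentState_coeFn q),
    coherentState_coeFn (Sum.elim p.1 q.1, Sum.elim p.2 q.2)] with z htensor hp hq hpq
  rw [htensor, hp, hq, hpq, coherentWave, coherentWave, coherentWave, gaussRoot_sum,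
    mul_mul_mul_comm, ← Complex.exp_add, ← add_mul, ← Complex.ofReal_add, ← mul_add,
    Complex.ofReal_mul (gaussRoot _)]
  simp only [dotProduct, Fintype.sum_sum_type, Sum.elim_inl, Sum.elim_inr]
  rfl

theorem isHilbertTensor_tensor : IsHilbertTensor (tensor (α := α) (β := β)) := by
  refine ⟨fun φ χ φ' χ' => inner_tensor_tensor φ φ' χ χ', fun f hf => ?_⟩
  refine eq_zero_of_forall_inner_coherentState_eq_zero fun p => ?_
  have hp := hf (coherentState (p.1 ∘ Sum.inl, p.2 ∘ Sum.inl))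
    (coherentState (p.1 ∘ Sum.inr, p.2 ∘ Sum.inr))
  simpa only [tensor_coherentState, Sum.elim_comp_inl_inr] using hp

end TensorTotal

end CoherentStates

section Husimi

section WindowOverlap

variable {ι : Type*} [Fintype ι]

/-- The function whose integral is the Gaussian factor by which the Fourier transform of a Husimi
function at `(u, s)` differs from the characteristic function of the state; see
`windowedCorrelation_eq`. -/
def windowOverlap (u s a : ι → ℝ) : ℂ :=
  Complex.exp ((u ⬝ᵥ a : ℝ) * Complex.I) * (gaussRoot (-a) * gaussRoot (s - a) : ℝ)

theorem windowOverlap_eq_cexp_quadratic (u s a : ι → ℝ) :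
    windowOverlap u s a = ((∫ y : ι → ℝ, Real.exp (-∑ i, y i ^ 2) : ℝ) : ℂ)⁻¹ *
      Complex.exp (-((s ⬝ᵥ s : ℝ) : ℂ) / 2) * Complex.exp (-((1 : ℝ) : ℂ) * ∑ i, (a i : ℂ) ^ 2 +
        ∑ i, ((s i : ℂ) + u i * Complex.I) * a i) := by
  rw [windowOverlap, gaussRoot, gaussRoot, mul_mul_mul_comm,
    Real.mul_self_sqrt (inv_nonneg.2 integral_exp_neg_sum_sq_pos.le),
    Complex.ofReal_mul, mul_left_comm, mul_assoc, Complex.ofReal_inv]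
  congr 1
  rw [← Real.exp_add, Complex.ofReal_exp, ← Complex.exp_add, ← Complex.exp_add]
  congr 1
  have hsub : ∑ i, ((s i : ℂ) - a i) ^ 2 =
      ∑ i, (s i : ℂ) * s i - 2 * ∑ i, (s i : ℂ) * a i + ∑ i, (a i : ℂ) ^ 2 := by
    rw [Finset.mul_sum, ← Finset.sum_sub_distrib, ← Finset.sum_add_distrib]
    exact Finset.sum_congr rfl fun i _ => by ring
  have hlinear : ∑ i, ((s i : ℂ) + u i * Complex.I) * a i =
      ∑ i, (s i : ℂ) * a i + (∑ i, (u i : ℂ) * a i) * Complex.I := by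
    rw [Finset.sum_mul, ← Finset.sum_add_distrib]
    exact Finset.sum_congr rfl fun i _ => by ring
  push_cast [dotProduct, Pi.neg_apply, Pi.sub_apply, neg_sq]
  rw [hsub, hlinear]
  ring

theorem integrable_windowOverlap (u s : ι → ℝ) : Integrable (windowOverlap u s) :=
  ((GaussianFourier.integrable_cexp_neg_mul_sum_add (b := ((1 : ℝ) : ℂ)) (by simp)
    (fun i : ι => (s i : ℂ) + u i * Complex.I)).const_mul _).congr
      (Eventually.of_forall fun a => (windowOverlap_eq_cexp_quadratic u s a).symm)

theorem integral_windowOverlap (u s : ι → ℝ) :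
    ∫ a, windowOverlap u s a =
      Complex.exp (-((u ⬝ᵥ u + s ⬝ᵥ s : ℝ) : ℂ) / 4) *
        Complex.exp ((u ⬝ᵥ s / 2 : ℝ) * Complex.I) := by
  have hpos := integral_exp_neg_sum_sq_pos (ι := ι)
  have hsq : ∑ i, ((s i : ℂ) + u i * Complex.I) ^ 2 =
      ∑ i, (s i : ℂ) * s i - ∑ i, (u i : ℂ) * u i + 2 * (∑ i, (u i : ℂ) * s i) * Complex.I := by
    rw [Finset.mul_sum, Finset.sum_mul, ← Finset.sum_sub_distrib, ← Finset.sum_add_distrib]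
    refine Finset.sum_congr rfl fun i _ => ?_
    linear_combination ((u i : ℂ) ^ 2) * Complex.I_sq
  simp only [windowOverlap_eq_cexp_quadratic]
  rw [integral_const_mul, integral_cexp_quadratic one_pos]
  simp only [neg_mul, one_mul]
  rw [mul_mul_mul_comm, inv_mul_cancel₀ (by exact_mod_cast hpos.ne'), one_mul, ← Complex.exp_add,
    ← Complex.exp_add, hsq]
  congr 1
  push_cast [dotProduct]
  ring

end WindowOverlap

variable {ι : Type} [Fintype ι]

/-- The integrand over `(x, y)` whose integral over `y` is, by Plancherel, the Fourier transform in
the momentum variable of the Husimi function at position `x`. -/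
def windowedCorrelation (v : Modes ι) (u s : ι → ℝ) (p : (ι → ℝ) × (ι → ℝ)) : ℂ :=
  Complex.exp ((u ⬝ᵥ p.1 : ℝ) * Complex.I) *
    (star (windowed v p.1 p.2) * windowed v p.1 (p.2 + s))

theorem windowedCorrelation_eq (v : Modes ι) (u s : ι → ℝ) (p : (ι → ℝ) × (ι → ℝ)) :
    windowedCorrelation v u s p = windowOverlap u s (p.1 - p.2) *
      (Complex.exp ((u ⬝ᵥ p.2 : ℝ) * Complex.I) * autocorrelation v s p.2) := by
  have hleft : p.2 - p.1 = -(p.1 - p.2) := by abel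
  have hright : p.2 + s - p.1 = s - (p.1 - p.2) := by abel
  have hphase : u ⬝ᵥ p.1 = u ⬝ᵥ (p.1 - p.2) + u ⬝ᵥ p.2 := by
    rw [← dotProduct_add, sub_add_cancel]
  rw [windowedCorrelation, windowed, windowed, windowOverlap, autocorrelation, hleft, hright,
    hphase, Complex.ofReal_add, add_mul, Complex.exp_add, Complex.ofReal_mul]
  simp only [star_mul', RCLike.star_def, Complex.conj_ofReal, Pi.add_def]
  ring

theorem integrable_cexp_mul_autocorrelation (v : Modes ι) (u s : ι → ℝ) :
    Integrable fun y => Complex.exp ((u ⬝ᵥ y : ℝ) * Complex.I) * autocorrelation v s y := by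
  refine (integrable_autocorrelation v s).bdd_mul (c := 1) (by fun_prop)
    (Eventually.of_forall fun y => ?_)
  rw [Complex.norm_exp_ofReal_mul_I]

theorem integrable_windowedCorrelation (v : Modes ι) (u s : ι → ℝ) :
    Integrable (windowedCorrelation v u s) := by
  have hshear := measurePreserving_sub_prod (volume : Measure (ι → ℝ)) (volume : Measure (ι → ℝ))
  exact (hshear.integrable_comp_of_integrable ((integrable_windowOverlap u s).mul_prod
    (integrable_cexp_mul_autocorrelation v u s))).congr
      (Eventually.of_forall fun p => (windowedCorrelation_eq v u s p).symm)

theorem integral_windowedCorrelation (v : Modes ι) (u s : ι → ℝ) :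
    ∫ p, windowedCorrelation v u s p =
      Complex.exp (-((u ⬝ᵥ u + s ⬝ᵥ s : ℝ) : ℂ) / 4) * ⟪v, weyl (Sum.elim u s) v⟫_ℂ := by
  have hshear := measurePreserving_sub_prod (volume : Measure (ι → ℝ)) (volume : Measure (ι → ℝ))
  have hprod := (integrable_windowOverlap u s).mul_prod
    (integrable_cexp_mul_autocorrelation v u s)
  have hmap := integral_map hshear.measurable.aemeasurable (hshear.map_eq.symm ▸ hprod.1)
  rw [hshear.map_eq, integral_prod_mul (windowOverlap u s) fun y =>
      Complex.exp ((u ⬝ᵥ y : ℝ) * Complex.I) * autocorrelation v s y, integral_windowOverlap,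
    mul_assoc, ← inner_weyl_eq_integral_autocorrelation] at hmap
  rw [hmap]
  exact integral_congr_ae (Eventually.of_forall fun p => windowedCorrelation_eq v u s p)

/-- The Husimi function `(x, k) ↦ |⟨g_{x,k}, v⟩|²` of the wave function `v`. -/
def husimi (v : Modes ι) (p : (ι → ℝ) × (ι → ℝ)) : ℝ :=
  ‖⟪coherentState p, v⟫_ℂ‖ ^ 2

theorem husimi_nonneg (v : Modes ι) (p : (ι → ℝ) × (ι → ℝ)) : 0 ≤ husimi v p :=
  sq_nonneg _

theorem husimi_eq_norm_sq_coordFourier (v : Modes ι) (p : (ι → ℝ) × (ι → ℝ)) :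
    husimi v p = ‖coordFourier (windowed v p.1) p.2‖ ^ 2 := by
  rw [husimi, inner_coherentState]

theorem sum_husimi_le_one {J : Type*} {v : J → Modes ι} (hv : Orthonormal ℂ v) (F : Finset J)
    (p : (ι → ℝ) × (ι → ℝ)) : ∑ j ∈ F, husimi (v j) p ≤ 1 := by
  simpa only [husimi, norm_inner_symm, norm_coherentState, one_pow] using
    hv.sum_inner_products_le (coherentState p) (s := F)

theorem stronglyMeasurable_husimi (v : Modes ι) : StronglyMeasurable (husimi v) := by
  have hinner : StronglyMeasurable fun p : (ι → ℝ) × (ι → ℝ) =>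
      coordFourier (windowed v p.1) p.2 := by
    refine StronglyMeasurable.integral_prod_right' (f := fun q : ((ι → ℝ) × (ι → ℝ)) × (ι → ℝ) =>
      Complex.exp ((-(2 * Real.pi * (q.1.2 ⬝ᵥ q.2)) : ℝ) * Complex.I) *
        windowed v q.1.1 q.2) ?_
    have := continuous_gaussRoot (ι := ι)
    exact (Continuous.stronglyMeasurable (by fun_prop)).mul
      ((Continuous.stronglyMeasurable (by fun_prop)).mul
        ((Lp.stronglyMeasurable v).comp_measurable measurable_snd))
  rw [funext (husimi_eq_norm_sq_coordFourier v)]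
  exact hinner.norm.pow 2

theorem integrable_husimi (v : Modes ι) : Integrable (husimi v) := by
  rw [Measure.volume_eq_prod,
    integrable_prod_iff (stronglyMeasurable_husimi v).aestronglyMeasurable]
  simp only [husimi_eq_norm_sq_coordFourier]
  refine ⟨Eventually.of_forall fun x => ?_, ?_⟩
  · have hmem := memLp_coordFourier (integrable_windowed v x) (memLp_windowed v x)
    exact (memLp_two_iff_integrable_sq_norm hmem.1).1 hmem
  · refine (integrable_windowedCorrelation v 0 0).integral_prod_left.re.congr
      (Eventually.of_forall fun x => ?_)
    simp only [windowedCorrelation, zero_dotProduct, Complex.ofReal_zero, zero_mul,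
      Complex.exp_zero, one_mul, add_zero, RCLike.star_def, RCLike.conj_mul, norm_pow, norm_norm,
      ← RCLike.ofReal_pow, integral_ofReal, RCLike.ofReal_re,
      integral_norm_sq_coordFourier (integrable_windowed v x) (memLp_windowed v x)]

/-- The phase-space vector with position `x` and momentum `2π k` of the pair `p = (x, k)`; the
factor `2π` comes from the normalisation of `coordFourier`. -/
def phasePoint (p : (ι → ℝ) × (ι → ℝ)) : ι ⊕ ι → ℝ :=
  Sum.elim p.1 ((2 * Real.pi) • p.2)

@[fun_prop]
theorem continuous_phasePoint {κ : Type} : Continuous (phasePoint (ι := κ)) := by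
  refine continuous_pi fun i => ?_
  rcases i with i | i
  · exact (continuous_apply i).comp continuous_fst
  · exact ((continuous_apply i).comp continuous_snd).const_smul (2 * Real.pi)

theorem integrable_cexp_mul_husimi (v : Modes ι) (ξ : ι ⊕ ι → ℝ) :
    Integrable fun p => Complex.exp ((ξ ⬝ᵥ phasePoint p : ℝ) * Complex.I) * husimi v p := by
  refine (integrable_husimi v).ofReal.bdd_mul (c := 1) ?_ (Eventually.of_forall fun p => ?_)
  · exact Continuous.aestronglyMeasurable (by fun_prop)
  · rw [Complex.norm_exp_ofReal_mul_I]

theorem integral_cexp_mul_husimi_snd (v : Modes ι) (u s x : ι → ℝ) :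
    ∫ k, Complex.exp ((Sum.elim u s ⬝ᵥ phasePoint (x, k) : ℝ) * Complex.I) * husimi v (x, k) =
      ∫ y, windowedCorrelation v u s (x, y) := by
  simp only [windowedCorrelation]
  rw [integral_const_mul, ← integral_star_coordFourier_mul (integrable_windowed v x)
      (memLp_windowed v x) ((integrable_windowed v x).comp_add_right s)
      ((memLp_windowed v x).comp_measurePreserving (measurePreserving_add_right volume s)),
    ← integral_const_mul]
  refine integral_congr_ae (Eventually.of_forall fun k => ?_)
  simp only [coordFourier_translate, phasePoint, husimi_eq_norm_sq_coordFourier,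
    sumElim_dotProduct_sumElim, dotProduct_smul, smul_eq_mul, dotProduct_comm s k]
  rw [Complex.ofReal_add, add_mul, Complex.exp_add, mul_left_comm (star _), RCLike.star_def,
    RCLike.conj_mul, mul_assoc]
  norm_cast

theorem integral_cexp_mul_husimi (v : Modes ι) (ξ : ι ⊕ ι → ℝ) :
    ∫ p, Complex.exp ((ξ ⬝ᵥ phasePoint p : ℝ) * Complex.I) * husimi v p =
      Complex.exp (-((ξ ⬝ᵥ ξ : ℝ) : ℂ) / 4) * ⟪v, weyl ξ v⟫_ℂ := by
  obtain ⟨u, s, rfl⟩ : ∃ u s, ξ = Sum.elim u s :=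
    ⟨ξ ∘ Sum.inl, ξ ∘ Sum.inr, (Sum.elim_comp_inl_inr ξ).symm⟩
  rw [sumElim_dotProduct_sumElim, ← integral_windowedCorrelation, Measure.volume_eq_prod,
    integral_prod _ (integrable_cexp_mul_husimi v _),
    integral_prod _ (integrable_windowedCorrelation v u s)]
  simp only [integral_cexp_mul_husimi_snd]

theorem integrable_husimi_mul_cos (v : Modes ι) (ξ : ι ⊕ ι → ℝ) :
    Integrable fun p => husimi v p * Real.cos (ξ ⬝ᵥ phasePoint p) :=
  (integrable_cexp_mul_husimi v ξ).re.congr (Eventually.of_forall fun p => by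
    simp only [RCLike.re_eq_complex_re, Complex.re_mul_ofReal, Complex.exp_ofReal_mul_I_re,
      mul_comm (Real.cos _)])

theorem integral_husimi_mul_cos (v : Modes ι) (ξ : ι ⊕ ι → ℝ) :
    ∫ p, husimi v p * Real.cos (ξ ⬝ᵥ phasePoint p) =
      Real.exp (-(ξ ⬝ᵥ ξ) / 4) * (⟪v, weyl ξ v⟫_ℂ).re := by
  have hre := integral_re (integrable_cexp_mul_husimi v ξ)
  have hexp : Complex.exp (-((ξ ⬝ᵥ ξ : ℝ) : ℂ) / 4) = (Real.exp (-(ξ ⬝ᵥ ξ) / 4) : ℝ) := by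
    push_cast
    rfl
  rw [integral_cexp_mul_husimi, hexp, RCLike.re_eq_complex_re, Complex.re_ofReal_mul] at hre
  rw [← hre]
  simp only [Complex.re_mul_ofReal, Complex.exp_ofReal_mul_I_re, mul_comm (Real.cos _)]

theorem integral_husimi (v : Modes ι) : ∫ p, husimi v p = ‖v‖ ^ 2 := by
  have hzero := integral_husimi_mul_cos v 0
  simp only [zero_dotProduct, Real.cos_zero, mul_one, neg_zero, zero_div, Real.exp_zero, one_mul,
    weyl_zero, inner_self_eq_norm_sq_to_K] at hzero
  exact_mod_cast hzero

end Husimi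

section EntropyBound

variable {ι : Type} [Fintype ι]

section SecondMoments

theorem norm_sq_weyl_sub_self (v : Modes ι) (ξ : ι ⊕ ι → ℝ) :
    ‖weyl ξ v - v‖ ^ 2 = 2 * ‖v‖ ^ 2 - 2 * (⟪v, weyl ξ v⟫_ℂ).re := by
  rw [norm_sub_sq (𝕜 := ℂ), norm_weyl, ← inner_conj_symm, RCLike.conj_re, RCLike.re_eq_complex_re]
  ring

theorem integral_husimi_mul_two_sub_cos (v : Modes ι) (ξ : ι ⊕ ι → ℝ) :
    ∫ p, husimi v p * (2 - 2 * Real.cos (ξ ⬝ᵥ phasePoint p)) =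
      2 * ‖v‖ ^ 2 - 2 * (Real.exp (-(ξ ⬝ᵥ ξ) / 4) * (⟪v, weyl ξ v⟫_ℂ).re) := by
  rw [← integral_husimi v, ← integral_husimi_mul_cos v ξ, ← integral_const_mul,
    ← integral_const_mul, ← integral_sub ((integrable_husimi v).const_mul 2)
      ((integrable_husimi_mul_cos v ξ).const_mul 2)]
  exact integral_congr_ae (Eventually.of_forall fun p => by ring)

theorem integral_husimi_mul_two_sub_cos_le (v : Modes ι) (ξ : ι ⊕ ι → ℝ) :
    ∫ p, husimi v p * (2 - 2 * Real.cos (ξ ⬝ᵥ phasePoint p)) ≤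
      ‖weyl ξ v - v‖ ^ 2 + (ξ ⬝ᵥ ξ) / 2 * ‖v‖ ^ 2 := by
  have hinner : (⟪v, weyl ξ v⟫_ℂ).re ≤ ‖v‖ ^ 2 := by
    refine (re_inner_le_norm (𝕜 := ℂ) v (weyl ξ v)).trans_eq ?_
    rw [norm_weyl, sq]
  have hdot : 0 ≤ ξ ⬝ᵥ ξ := Finset.sum_nonneg fun i _ => mul_self_nonneg _
  have hexp_ge := Real.add_one_le_exp (-(ξ ⬝ᵥ ξ) / 4)
  have hexp_le : Real.exp (-(ξ ⬝ᵥ ξ) / 4) ≤ 1 := Real.exp_le_one_iff.2 (by linarith)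
  have hloss : (1 - Real.exp (-(ξ ⬝ᵥ ξ) / 4)) * (⟪v, weyl ξ v⟫_ℂ).re ≤
      (ξ ⬝ᵥ ξ) / 4 * ‖v‖ ^ 2 :=
    (mul_le_mul_of_nonneg_left hinner (by linarith)).trans
      (mul_le_mul_of_nonneg_right (by linarith) (sq_nonneg _))
  rw [integral_husimi_mul_two_sub_cos, norm_sq_weyl_sub_self]
  linarith

theorem two_sub_two_mul_cos (x : ℝ) : 2 - 2 * Real.cos x = (x * Real.sinc (x / 2)) ^ 2 := by
  have hsin : x * Real.sinc (x / 2) = 2 * Real.sin (x / 2) := by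
    rcases eq_or_ne x 0 with rfl | hx
    · simp
    · rw [Real.sinc_of_ne_zero (by simpa using hx)]
      field_simp
  have hcos := Real.cos_two_mul (x / 2)
  rw [mul_div_cancel₀ x two_ne_zero] at hcos
  rw [hsin, mul_pow, Real.sin_sq, hcos]
  ring

theorem norm_sq_weylQuot (ξ : ι ⊕ ι → ℝ) (φ : Modes ι) (t : ℝ) :
    ‖weylQuot ξ φ t‖ ^ 2 = ‖weyl (t • ξ) φ - φ‖ ^ 2 / t ^ 2 := by
  rw [weylQuot, norm_smul, norm_inv, norm_mul, Complex.norm_I, one_mul, Complex.norm_real,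
    Real.norm_eq_abs, mul_pow, inv_pow, sq_abs]
  ring

theorem mul_sinc_sq_eq_two_sub_cos_div [DecidableEq ι] (k : ι ⊕ ι) {t : ℝ} (ht : t ≠ 0)
    (p : (ι → ℝ) × (ι → ℝ)) :
    (phasePoint p k * Real.sinc (t * phasePoint p k / 2)) ^ 2 =
      (2 - 2 * Real.cos ((t • Pi.single k (1 : ℝ)) ⬝ᵥ phasePoint p)) / t ^ 2 := by
  rw [smul_dotProduct, single_dotProduct, one_mul, smul_eq_mul, two_sub_two_mul_cos]
  field_simp

theorem integrable_husimi_mul_sinc_sq (v : Modes ι) (k : ι ⊕ ι) {t : ℝ} (ht : t ≠ 0) :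
    Integrable fun p =>
      husimi v p * (phasePoint p k * Real.sinc (t * phasePoint p k / 2)) ^ 2 := by
  classical
  refine ((((integrable_husimi v).const_mul 2).sub
    ((integrable_husimi_mul_cos v (t • Pi.single k (1 : ℝ))).const_mul 2)).div_const
      (t ^ 2)).congr (Eventually.of_forall fun p => ?_)
  simp only [Pi.sub_apply, mul_sinc_sq_eq_two_sub_cos_div k ht]
  ring

variable [DecidableEq ι]

theorem integral_husimi_mul_sinc_sq_le (v : Modes ι) (k : ι ⊕ ι) {t : ℝ} (ht : t ≠ 0) :
    ∫ p, husimi v p * (phasePoint p k * Real.sinc (t * phasePoint p k / 2)) ^ 2 ≤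
      ‖weylQuot (Pi.single k 1) v t‖ ^ 2 + ‖v‖ ^ 2 / 2 := by
  have hdot : (t • Pi.single k (1 : ℝ)) ⬝ᵥ (t • Pi.single k (1 : ℝ)) = t ^ 2 := by
    rw [smul_dotProduct, single_dotProduct, one_mul, Pi.smul_apply, Pi.single_eq_same,
      smul_eq_mul, smul_eq_mul, mul_one, sq]
  have ht_sq : 0 < t ^ 2 := by positivity
  simp only [mul_sinc_sq_eq_two_sub_cos_div k ht, mul_div_assoc']
  rw [integral_div, norm_sq_weylQuot, div_le_iff₀ ht_sq, add_mul, div_mul_cancel₀ _ ht_sq.ne']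
  refine (integral_husimi_mul_two_sub_cos_le v _).trans_eq ?_
  rw [hdot]
  ring

/-- The numbers `A k` bound the second moments of the quadratures in the mixture
`∑ j, r j |v j⟩⟨v j|`. Difference quotients are used because the `v j` need not lie in the domain
of the quadratures, and finite partial sums because only these are needed. -/
def IsSecondMomentBound {J : Type*} (r : J → ℝ) (v : J → Modes ι) (A : ι ⊕ ι → ℝ) : Prop :=
  ∀ k, ∃ a : ℝ → ℝ, Tendsto a (𝓝[≠] 0) (𝓝 (A k)) ∧
    ∀ (F : Finset J) (t : ℝ), t ≠ 0 →
      ∑ j ∈ F, r j * ‖weylQuot (Pi.single k 1) (v j) t‖ ^ 2 ≤ a t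

theorem IsSecondMomentBound.nonneg {J : Type*} {r : J → ℝ} {v : J → Modes ι} {A : ι ⊕ ι → ℝ}
    (hA : IsSecondMomentBound r v A) (k : ι ⊕ ι) : 0 ≤ A k := by
  obtain ⟨a, ha_lim, ha_ge⟩ := hA k
  refine ge_of_tendsto ha_lim (eventually_mem_nhdsWithin.mono fun t ht => ?_)
  simpa using ha_ge ∅ t ht

end SecondMoments

section HusimiMix

variable {J : Type*} {r : J → ℝ} {v : J → Modes ι}

/-- The Husimi function of the truncated mixture `∑ j ∈ F, r j |v j⟩⟨v j|`. -/
def husimiMix (r : J → ℝ) (v : J → Modes ι) (F : Finset J) (p : (ι → ℝ) × (ι → ℝ)) : ℝ :=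
  ∑ j ∈ F, r j * husimi (v j) p

theorem integrable_husimiMix (r : J → ℝ) (v : J → Modes ι) (F : Finset J) :
    Integrable (husimiMix r v F) :=
  integrable_finsetSum _ fun j _ => (integrable_husimi (v j)).const_mul (r j)

theorem husimiMix_nonneg (hr : ∀ j, 0 ≤ r j) (v : J → Modes ι) (F : Finset J)
    (p : (ι → ℝ) × (ι → ℝ)) : 0 ≤ husimiMix r v F p :=
  Finset.sum_nonneg fun j _ => mul_nonneg (hr j) (husimi_nonneg _ _)

theorem integral_husimiMix (r : J → ℝ) (hv : ∀ j, ‖v j‖ = 1) (F : Finset J) :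
    ∫ p, husimiMix r v F p = ∑ j ∈ F, r j := by
  simp only [husimiMix]
  rw [integral_finsetSum _ fun j _ => (integrable_husimi (v j)).const_mul (r j)]
  refine Finset.sum_congr rfl fun j _ => ?_
  rw [integral_const_mul, integral_husimi, hv j, one_pow, mul_one]

theorem husimiMix_mul (r : J → ℝ) (v : J → Modes ι) (F : Finset J) (p : (ι → ℝ) × (ι → ℝ))
    (c : ℝ) : husimiMix r v F p * c = ∑ j ∈ F, r j * (husimi (v j) p * c) := by
  simp only [husimiMix, Finset.sum_mul, mul_assoc]

theorem integrable_husimiMix_mul_sinc_sq (r : J → ℝ) (v : J → Modes ι) (F : Finset J) (k : ι ⊕ ι)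
    {t : ℝ} (ht : t ≠ 0) :
    Integrable fun p =>
      husimiMix r v F p * (phasePoint p k * Real.sinc (t * phasePoint p k / 2)) ^ 2 := by
  simp only [husimiMix_mul]
  exact integrable_finsetSum _ fun j _ =>
    (integrable_husimi_mul_sinc_sq (v j) k ht).const_mul (r j)

theorem tendsto_husimiMix_mul_sinc_sq (r : J → ℝ) (v : J → Modes ι) (F : Finset J) (k : ι ⊕ ι)
    (p : (ι → ℝ) × (ι → ℝ)) :
    Tendsto (fun t => ENNReal.ofReal
      (husimiMix r v F p * (phasePoint p k * Real.sinc (t * phasePoint p k / 2)) ^ 2)) (𝓝 0)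
      (𝓝 (ENNReal.ofReal (husimiMix r v F p * phasePoint p k ^ 2))) := by
  have hsinc : Continuous fun t : ℝ => Real.sinc (t * phasePoint p k / 2) :=
    Real.continuous_sinc.comp (by fun_prop)
  have hcont : Continuous fun t : ℝ => ENNReal.ofReal
      (husimiMix r v F p * (phasePoint p k * Real.sinc (t * phasePoint p k / 2)) ^ 2) :=
    ENNReal.continuous_ofReal.comp (((hsinc.const_mul _).pow 2).const_mul _)
  simpa using hcont.tendsto 0

variable [DecidableEq ι]

theorem integral_husimiMix_mul_sinc_sq_le (hr : ∀ j, 0 ≤ r j) (hv : ∀ j, ‖v j‖ = 1)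
    (F : Finset J) (hF : ∑ j ∈ F, r j ≤ 1) (k : ι ⊕ ι) {t : ℝ} (ht : t ≠ 0) :
    ∫ p, husimiMix r v F p * (phasePoint p k * Real.sinc (t * phasePoint p k / 2)) ^ 2 ≤
      ∑ j ∈ F, r j * ‖weylQuot (Pi.single k 1) (v j) t‖ ^ 2 + 1 / 2 := by
  simp only [husimiMix_mul]
  rw [integral_finsetSum _ fun j _ => (integrable_husimi_mul_sinc_sq (v j) k ht).const_mul (r j)]
  simp only [integral_const_mul]
  calc ∑ j ∈ F, r j * ∫ p, husimi (v j) p *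
        (phasePoint p k * Real.sinc (t * phasePoint p k / 2)) ^ 2
      ≤ ∑ j ∈ F, r j * (‖weylQuot (Pi.single k 1) (v j) t‖ ^ 2 + ‖v j‖ ^ 2 / 2) :=
        Finset.sum_le_sum fun j _ =>
          mul_le_mul_of_nonneg_left (integral_husimi_mul_sinc_sq_le (v j) k ht) (hr j)
    _ = ∑ j ∈ F, r j * ‖weylQuot (Pi.single k 1) (v j) t‖ ^ 2 + (∑ j ∈ F, r j) * (1 / 2) := by
        simp only [hv, one_pow, mul_add, Finset.sum_add_distrib, Finset.sum_mul]
    _ ≤ _ := by linarith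

theorem lintegral_husimiMix_mul_sq_le (hr : ∀ j, 0 ≤ r j) (hv : ∀ j, ‖v j‖ = 1) (F : Finset J)
    (hF : ∑ j ∈ F, r j ≤ 1) {A : ι ⊕ ι → ℝ} (hA : IsSecondMomentBound r v A) (k : ι ⊕ ι) :
    ∫⁻ p, ENNReal.ofReal (husimiMix r v F p * phasePoint p k ^ 2) ≤
      ENNReal.ofReal (A k + 1 / 2) := by
  obtain ⟨a, ha_lim, ha_ge⟩ := hA k
  let τ : ℕ → ℝ := fun n => 1 / ((n : ℝ) + 1)
  have hτ : Tendsto τ atTop (𝓝 0) := tendsto_one_div_add_atTop_nhds_zero_nat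
  have hτ_ne : ∀ n, τ n ≠ 0 := fun n => Nat.one_div_pos_of_nat.ne'
  have hτ_punctured : Tendsto τ atTop (𝓝[≠] 0) :=
    tendsto_nhdsWithin_iff.2 ⟨hτ, Eventually.of_forall hτ_ne⟩
  let f : ℝ → (ι → ℝ) × (ι → ℝ) → ℝ := fun t p =>
    husimiMix r v F p * (phasePoint p k * Real.sinc (t * phasePoint p k / 2)) ^ 2
  have hf : ∀ n, Integrable (f (τ n)) := fun n =>
    integrable_husimiMix_mul_sinc_sq r v F k (hτ_ne n)
  calc ∫⁻ p, ENNReal.ofReal (husimiMix r v F p * phasePoint p k ^ 2)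
      = ∫⁻ p, liminf (fun n => ENNReal.ofReal (f (τ n) p)) atTop := lintegral_congr fun p =>
        (((tendsto_husimiMix_mul_sinc_sq r v F k p).comp hτ).liminf_eq).symm
    _ ≤ liminf (fun n => ∫⁻ p, ENNReal.ofReal (f (τ n) p)) atTop :=
        lintegral_liminf_le' fun n => (hf n).1.aemeasurable.ennreal_ofReal
    _ ≤ liminf (fun n => ENNReal.ofReal (a (τ n) + 1 / 2)) atTop := by
        refine liminf_le_liminf (Eventually.of_forall fun n => ?_)
        rw [← ofReal_integral_eq_lintegral_ofReal (hf n) (Eventually.of_forall fun p =>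
          mul_nonneg (husimiMix_nonneg hr v F p) (sq_nonneg _))]
        exact ENNReal.ofReal_le_ofReal
          ((integral_husimiMix_mul_sinc_sq_le hr hv F hF k (hτ_ne n)).trans
            (add_le_add_left (ha_ge F _ (hτ_ne n)) _))
    _ = ENNReal.ofReal (A k + 1 / 2) :=
        (ENNReal.tendsto_ofReal ((ha_lim.comp hτ_punctured).add_const (1 / 2))).liminf_eq

theorem integrable_husimiMix_mul_sq (hr : ∀ j, 0 ≤ r j) (hv : ∀ j, ‖v j‖ = 1) (F : Finset J)
    (hF : ∑ j ∈ F, r j ≤ 1) {A : ι ⊕ ι → ℝ} (hA : IsSecondMomentBound r v A) (k : ι ⊕ ι) :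
    Integrable fun p => husimiMix r v F p * phasePoint p k ^ 2 := by
  have hcont : Continuous fun p : (ι → ℝ) × (ι → ℝ) => phasePoint p k ^ 2 := by fun_prop
  refine ⟨(integrable_husimiMix r v F).1.mul hcont.aestronglyMeasurable, ?_⟩
  exact (hasFiniteIntegral_iff_ofReal (Eventually.of_forall fun p =>
    mul_nonneg (husimiMix_nonneg hr v F p) (sq_nonneg _))).2
      ((lintegral_husimiMix_mul_sq_le hr hv F hF hA k).trans_lt ENNReal.ofReal_lt_top)

theorem integral_husimiMix_mul_sq_le (hr : ∀ j, 0 ≤ r j) (hv : ∀ j, ‖v j‖ = 1) (F : Finset J)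
    (hF : ∑ j ∈ F, r j ≤ 1) {A : ι ⊕ ι → ℝ} (hA : IsSecondMomentBound r v A) (k : ι ⊕ ι) :
    ∫ p, husimiMix r v F p * phasePoint p k ^ 2 ≤ A k + 1 / 2 := by
  have hlintegral := lintegral_husimiMix_mul_sq_le hr hv F hF hA k
  rw [← ofReal_integral_eq_lintegral_ofReal (integrable_husimiMix_mul_sq hr hv F hF hA k)
    (Eventually.of_forall fun p => mul_nonneg (husimiMix_nonneg hr v F p) (sq_nonneg _))]
    at hlintegral
  exact (ENNReal.ofReal_le_ofReal_iff (by linarith [hA.nonneg k])).1 hlintegral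

end HusimiMix

section Oscillator

/-- The energy `(q ⬝ᵥ q + p ⬝ᵥ p) / 2` of the classical oscillator at the phase-space point `p`. -/
def oscillator (p : (ι → ℝ) × (ι → ℝ)) : ℝ := (∑ k, phasePoint p k ^ 2) / 2

@[fun_prop]
theorem continuous_oscillator : Continuous (oscillator (ι := ι)) := by
  unfold oscillator
  fun_prop

theorem exp_neg_oscillator (p : (ι → ℝ) × (ι → ℝ)) :
    Real.exp (-oscillator p) = (∏ i, Real.exp (-(1 / 2) * p.1 i ^ 2)) *
      ∏ i, Real.exp (-(2 * Real.pi ^ 2) * p.2 i ^ 2) := by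
  rw [← Real.exp_sum, ← Real.exp_sum, ← Real.exp_add, oscillator, Fintype.sum_sum_type]
  congr 1
  simp only [phasePoint, Sum.elim_inl, Sum.elim_inr, Pi.smul_apply, smul_eq_mul,
    ← Finset.mul_sum, mul_pow]
  ring

theorem integrable_exp_neg_oscillator :
    Integrable fun p : (ι → ℝ) × (ι → ℝ) => Real.exp (-oscillator p) := by
  simp only [exp_neg_oscillator]
  have hposition : Integrable fun x : ι → ℝ => ∏ i, Real.exp (-(1 / 2) * x i ^ 2) :=
    Integrable.fintype_prod fun _ => integrable_exp_neg_mul_sq (by norm_num)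
  have hmomentum : Integrable fun x : ι → ℝ => ∏ i, Real.exp (-(2 * Real.pi ^ 2) * x i ^ 2) :=
    Integrable.fintype_prod fun _ => integrable_exp_neg_mul_sq (by positivity)
  exact hposition.mul_prod hmomentum

theorem integral_exp_neg_oscillator :
    ∫ p : (ι → ℝ) × (ι → ℝ), Real.exp (-oscillator p) = 1 := by
  have hpi : Real.pi / (1 / 2) * (Real.pi / (2 * Real.pi ^ 2)) = 1 := by field_simp
  simp only [exp_neg_oscillator]
  rw [Measure.volume_eq_prod, integral_prod_mul
      (fun x : ι → ℝ => ∏ i, Real.exp (-(1 / 2) * x i ^ 2))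
      (fun x : ι → ℝ => ∏ i, Real.exp (-(2 * Real.pi ^ 2) * x i ^ 2)),
    integral_fintype_prod_volume_eq_pow (fun y : ℝ => Real.exp (-(1 / 2) * y ^ 2)),
    integral_fintype_prod_volume_eq_pow (fun y : ℝ => Real.exp (-(2 * Real.pi ^ 2) * y ^ 2)),
    integral_gaussian, integral_gaussian, ← mul_pow, ← Real.sqrt_mul (by positivity), hpi,
    Real.sqrt_one, one_pow]

theorem exp_neg_eq_exp_neg_half_sq (h : ℝ) : Real.exp (-h) = Real.exp (-h / 2) ^ 2 := by
  rw [← Real.exp_nat_mul]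
  congr 1
  push_cast
  ring

/-- A lower bound for the loss, at a phase-space point, in the estimate of the entropy of a state
whose eigenvalues are at most `Λ`; it comes from the remainder in `negMulLog_le_sub_sq`. -/
def slackDensity (Λ : ℝ) (p : (ι → ℝ) × (ι → ℝ)) : ℝ :=
  max 0 (Real.exp (-oscillator p / 2) - √Λ) ^ 2

theorem slackDensity_nonneg (Λ : ℝ) (p : (ι → ℝ) × (ι → ℝ)) : 0 ≤ slackDensity Λ p := sq_nonneg _

theorem slackDensity_le_sq {Λ r : ℝ} (hr : r ≤ Λ) (p : (ι → ℝ) × (ι → ℝ)) :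
    slackDensity Λ p ≤ (Real.exp (-oscillator p / 2) - √r) ^ 2 := by
  have hsqrt := Real.sqrt_le_sqrt hr
  rw [slackDensity]
  rcases max_cases 0 (Real.exp (-oscillator p / 2) - √Λ) with ⟨hmax, _⟩ | ⟨hmax, hpos⟩
  · rw [hmax, zero_pow two_ne_zero]
    exact sq_nonneg _
  · rw [hmax]
    exact pow_le_pow_left₀ hpos.le (by linarith) 2

theorem slackDensity_le (Λ : ℝ) (p : (ι → ℝ) × (ι → ℝ)) :
    slackDensity Λ p ≤ Real.exp (-oscillator p) := by
  rw [exp_neg_eq_exp_neg_half_sq, slackDensity]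
  refine pow_le_pow_left₀ (le_max_left _ _) (max_le (Real.exp_pos _).le ?_) 2
  linarith [Real.sqrt_nonneg Λ]

theorem continuous_slackDensity (Λ : ℝ) : Continuous (slackDensity (ι := ι) Λ) := by
  unfold slackDensity
  fun_prop

theorem integrable_slackDensity (Λ : ℝ) : Integrable (slackDensity (ι := ι) Λ) := by
  refine integrable_exp_neg_oscillator.mono (continuous_slackDensity Λ).aestronglyMeasurable
    (Eventually.of_forall fun p => ?_)
  rw [Real.norm_of_nonneg (slackDensity_nonneg Λ p), Real.norm_of_nonneg (Real.exp_pos _).le]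
  exact slackDensity_le Λ p

theorem integral_slackDensity_pos {Λ : ℝ} (hΛ : Λ < 1) : 0 < ∫ p, slackDensity (ι := ι) Λ p := by
  refine integral_pos_of_integrable_nonneg_nonzero (x := 0) (continuous_slackDensity Λ)
    (integrable_slackDensity Λ) (slackDensity_nonneg Λ) ?_
  have hzero : oscillator (0 : (ι → ℝ) × (ι → ℝ)) = 0 := by
    rw [oscillator, Fintype.sum_sum_type]
    simp [phasePoint]
  have hsqrt : √Λ < 1 := (Real.sqrt_lt' one_pos).2 (by simpa using hΛ)
  rw [slackDensity, hzero, neg_zero, zero_div, Real.exp_zero, max_eq_right (by linarith)]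
  exact pow_ne_zero 2 (by linarith)

end Oscillator

section Gibbs

-- This is `log x ≤ x - 1` at `x = exp (-h / 2) / √r`: taking square roots first leaves a square
-- as remainder.
theorem negMulLog_le_sub_sq {r : ℝ} (hr : 0 < r) (h : ℝ) :
    Real.negMulLog r ≤ r * h + Real.exp (-h) - r - (Real.exp (-h / 2) - √r) ^ 2 := by
  have hsqrt : 0 < √r := Real.sqrt_pos.2 hr
  have hsq : √r ^ 2 = r := Real.sq_sqrt hr.le
  have hlog : Real.log (Real.exp (-h / 2) / √r) ≤ Real.exp (-h / 2) / √r - 1 :=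
    Real.log_le_sub_one_of_pos (by positivity)
  rw [Real.log_div (Real.exp_pos _).ne' hsqrt.ne', Real.log_exp, Real.log_sqrt hr.le] at hlog
  have hmul := mul_le_mul_of_nonneg_left hlog (by positivity : 0 ≤ 2 * √r ^ 2)
  have hcancel : 2 * √r ^ 2 * (Real.exp (-h / 2) / √r - 1) =
      2 * √r * Real.exp (-h / 2) - 2 * √r ^ 2 := by
    field_simp
  rw [hcancel, hsq] at hmul
  rw [Real.negMulLog, exp_neg_eq_exp_neg_half_sq]
  nlinarith

variable {J : Type*} {r : J → ℝ} {v : J → Modes ι}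

theorem sum_husimi_mul_negMulLog_le (hv : Orthonormal ℂ v) (hr : ∀ j, 0 < r j) {Λ : ℝ}
    (hΛ : ∀ j, r j ≤ Λ) (F : Finset J) (p : (ι → ℝ) × (ι → ℝ)) :
    ∑ j ∈ F, husimi (v j) p * Real.negMulLog (r j) ≤
      husimiMix r v F p * oscillator p - husimiMix r v F p +
        (Real.exp (-oscillator p) - slackDensity Λ p) := by
  have hterm : ∀ j ∈ F, husimi (v j) p * Real.negMulLog (r j) ≤
      r j * husimi (v j) p * oscillator p - r j * husimi (v j) p +
        husimi (v j) p * (Real.exp (-oscillator p) - slackDensity Λ p) := fun j _ => by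
    have hslack := mul_le_mul_of_nonneg_left ((negMulLog_le_sub_sq (hr j) (oscillator p)).trans
      (sub_le_sub_left (slackDensity_le_sq (hΛ j) p) _)) (husimi_nonneg (v j) p)
    linarith
  refine (Finset.sum_le_sum hterm).trans ?_
  rw [Finset.sum_add_distrib, Finset.sum_sub_distrib, ← Finset.sum_mul, ← Finset.sum_mul]
  exact add_le_add_right (mul_le_of_le_one_left (sub_nonneg.2 (slackDensity_le Λ p))
    (sum_husimi_le_one hv F p)) _

theorem husimiMix_mul_oscillator (r : J → ℝ) (v : J → Modes ι) (F : Finset J)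
    (p : (ι → ℝ) × (ι → ℝ)) : husimiMix r v F p * oscillator p =
      (∑ k, husimiMix r v F p * phasePoint p k ^ 2) / 2 := by
  rw [oscillator, ← Finset.mul_sum, mul_div_assoc]

variable [DecidableEq ι]

theorem integrable_husimiMix_mul_oscillator (hr : ∀ j, 0 ≤ r j) (hv : ∀ j, ‖v j‖ = 1)
    (F : Finset J) (hF : ∑ j ∈ F, r j ≤ 1) {A : ι ⊕ ι → ℝ} (hA : IsSecondMomentBound r v A) :
    Integrable fun p => husimiMix r v F p * oscillator p := by
  simp only [husimiMix_mul_oscillator]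
  exact (integrable_finsetSum _ fun k _ =>
    integrable_husimiMix_mul_sq hr hv F hF hA k).div_const 2

theorem integral_husimiMix_mul_oscillator_le (hr : ∀ j, 0 ≤ r j) (hv : ∀ j, ‖v j‖ = 1)
    (F : Finset J) (hF : ∑ j ∈ F, r j ≤ 1) {A : ι ⊕ ι → ℝ} (hA : IsSecondMomentBound r v A) :
    ∫ p, husimiMix r v F p * oscillator p ≤ (∑ k, A k) / 2 + Fintype.card ι / 2 := by
  simp only [husimiMix_mul_oscillator]
  rw [integral_div, integral_finsetSum _ fun k _ => integrable_husimiMix_mul_sq hr hv F hF hA k]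
  have hsum := Finset.sum_le_sum fun k (_ : k ∈ Finset.univ) =>
    integral_husimiMix_mul_sq_le hr hv F hF hA k
  rw [Finset.sum_add_distrib, Finset.sum_const, Finset.card_univ, Fintype.card_sum,
    nsmul_eq_mul] at hsum
  push_cast at hsum
  linarith

theorem sum_negMulLog_le (hv : Orthonormal ℂ v) (hr : ∀ j, 0 < r j) {Λ : ℝ}
    (hΛ : ∀ j, r j ≤ Λ) (F : Finset J) (hF : ∑ j ∈ F, r j ≤ 1) {A : ι ⊕ ι → ℝ}
    (hA : IsSecondMomentBound r v A) :
    ∑ j ∈ F, Real.negMulLog (r j) ≤ (∑ k, A k) / 2 + Fintype.card ι / 2 - ∑ j ∈ F, r j +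
      (1 - ∫ p, slackDensity (ι := ι) Λ p) := by
  have hr_nonneg := fun j => (hr j).le
  have hweighted := fun j => (integrable_husimi (v j)).mul_const (Real.negMulLog (r j))
  have hintegral : ∫ p, ∑ j ∈ F, husimi (v j) p * Real.negMulLog (r j) =
      ∑ j ∈ F, Real.negMulLog (r j) := by
    rw [integral_finsetSum _ fun j _ => hweighted j]
    refine Finset.sum_congr rfl fun j _ => ?_
    rw [integral_mul_const, integral_husimi, hv.1 j, one_pow, one_mul]
  have hosc := integrable_husimiMix_mul_oscillator hr_nonneg hv.1 F hF hA
  have hmix := integrable_husimiMix r v F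
  have hexp := integrable_exp_neg_oscillator (ι := ι)
  have hslack := integrable_slackDensity (ι := ι) Λ
  have hmono := integral_mono (integrable_finsetSum F fun j _ => hweighted j)
    ((hosc.sub hmix).add (hexp.sub hslack)) (fun p => sum_husimi_mul_negMulLog_le hv hr hΛ F p)
  rw [hintegral, integral_add' (hosc.sub hmix) (hexp.sub hslack), integral_sub' hosc hmix,
    integral_sub' hexp hslack, integral_husimiMix r hv.1, integral_exp_neg_oscillator] at hmono
  linarith [integral_husimiMix_mul_oscillator_le hr_nonneg hv.1 F hF hA]

theorem summable_negMulLog (hv : Orthonormal ℂ v) (hr : ∀ j, 0 < r j) (hr_sum : HasSum r 1)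
    {A : ι ⊕ ι → ℝ} (hA : IsSecondMomentBound r v A) :
    Summable fun j => Real.negMulLog (r j) := by
  have hpartial : ∀ F : Finset J, ∑ j ∈ F, r j ≤ 1 := fun F =>
    sum_le_hasSum F (fun j _ => (hr j).le) hr_sum
  have hr_le_one : ∀ j, r j ≤ 1 := fun j => by simpa using hpartial {j}
  refine summable_of_sum_le (c := (∑ k, A k) / 2 + Fintype.card ι / 2 +
    (1 - ∫ p, slackDensity (ι := ι) 1 p))
    (fun j => Real.negMulLog_nonneg (hr j).le (hr_le_one j)) fun F => ?_
  have hsum_nonneg := Finset.sum_nonneg fun j (_ : j ∈ F) => (hr j).le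
  linarith [sum_negMulLog_le hv hr hr_le_one F (hpartial F) hA]

theorem tsum_negMulLog_add_integral_slackDensity_le (hv : Orthonormal ℂ v) (hr : ∀ j, 0 < r j)
    (hr_sum : HasSum r 1) {Λ : ℝ} (hΛ : ∀ j, r j ≤ Λ) {A : ι ⊕ ι → ℝ}
    (hA : IsSecondMomentBound r v A) :
    ∑' j, Real.negMulLog (r j) + ∫ p, slackDensity (ι := ι) Λ p ≤
      (∑ k, A k) / 2 + Fintype.card ι / 2 := by
  have hlimit := le_of_tendsto_of_tendsto' (summable_negMulLog hv hr hr_sum hA).hasSum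
    ((hr_sum.const_sub ((∑ k, A k) / 2 + Fintype.card ι / 2 : ℝ)).add_const
      (1 - ∫ p, slackDensity (ι := ι) Λ p))
    (fun F => sum_negMulLog_le hv hr hΛ F (sum_le_hasSum F (fun j _ => (hr j).le) hr_sum) hA)
  linarith

end Gibbs

section Slack

variable {J : Type*} {r : J → ℝ}

theorem add_le_one_of_hasSum_one (hr : ∀ j, 0 ≤ r j) (hr_sum : HasSum r 1) {i j : J}
    (hij : i ≠ j) : r i + r j ≤ 1 := by
  classical
  rw [← Finset.sum_pair hij]
  exact sum_le_hasSum {i, j} (fun j _ => hr j) hr_sum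

theorem exists_lt_one_forall_le (hr : ∀ j, 0 ≤ r j) (hr_sum : HasSum r 1) (hr_ne : ∀ j, r j ≠ 1) :
    ∃ Λ < 1, ∀ j, r j ≤ Λ := by
  by_cases hlarge : ∃ i, 1 / 2 < r i
  · obtain ⟨i, hi⟩ := hlarge
    refine ⟨r i, (le_hasSum hr_sum i fun j _ => hr j).lt_of_ne (hr_ne i), fun j => ?_⟩
    rcases eq_or_ne i j with rfl | hij
    · rfl
    · linarith [add_le_one_of_hasSum_one hr hr_sum hij]
  · push Not at hlarge
    exact ⟨1 / 2, by norm_num, hlarge⟩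

variable [DecidableEq ι] [Nonempty ι]

theorem exists_pos_tsum_negMulLog_add_le (hr : ∀ j, 0 < r j) (hr_sum : HasSum r 1) :
    ∃ c : ℝ, 0 < c ∧ ∀ (v : J → Modes ι) (A : ι ⊕ ι → ℝ), Orthonormal ℂ v →
      IsSecondMomentBound r v A →
      ∑' j, Real.negMulLog (r j) + c ≤ (∑ k, A k) / 2 + Fintype.card ι / 2 := by
  have hr_nonneg := fun j => (hr j).le
  by_cases hpure : ∃ i, r i = 1
  · obtain ⟨i, hi⟩ := hpure
    have hunique : ∀ j, i = j := fun j => by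
      by_contra hij
      linarith [hr j, add_le_one_of_hasSum_one hr_nonneg hr_sum hij]
    have hentropy : ∑' j, Real.negMulLog (r j) = 0 := by
      simp only [← hunique, hi, Real.negMulLog_one, tsum_zero]
    refine ⟨Fintype.card ι / 2, half_pos (Nat.cast_pos.2 Fintype.card_pos), fun v A _ hA => ?_⟩
    rw [hentropy, zero_add]
    linarith [Finset.sum_nonneg fun k (_ : k ∈ Finset.univ) => hA.nonneg k]
  · push Not at hpure
    obtain ⟨Λ, hΛ_lt, hΛ⟩ := exists_lt_one_forall_le hr_nonneg hr_sum hpure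
    exact ⟨_, integral_slackDensity_pos hΛ_lt, fun v A hv hA =>
      tsum_negMulLog_add_integral_slackDensity_le hv hr hr_sum hΛ hA⟩

end Slack

end EntropyBound

section SchmidtBessel

variable {H₁ H₂ H : Type*} [NormedAddCommGroup H₁] [InnerProductSpace ℂ H₁]
  [NormedAddCommGroup H₂] [InnerProductSpace ℂ H₂] [NormedAddCommGroup H] [InnerProductSpace ℂ H]
  {T : H₁ →L[ℂ] H₂ →L[ℂ] H} {J : Type*} {r : J → ℝ} {d : J → H₁} {u : J → H₂}

theorem IsHilbertTensor.inner_sqrt_smul_sqrt_smul (hT : IsHilbertTensor T) (hr : ∀ j, 0 ≤ r j)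
    (hu : Orthonormal ℂ u) (j : J) :
    ⟪(√(r j) : ℂ) • T (d j) (u j), (√(r j) : ℂ) • T (d j) (u j)⟫_ℂ = (r j * ‖d j‖ ^ 2 : ℝ) := by
  rw [inner_smul_left, inner_smul_right, hT.inner_apply, inner_self_eq_norm_sq_to_K,
    inner_self_eq_norm_sq_to_K, hu.1 j, Complex.conj_ofReal, ← mul_assoc, ← Complex.ofReal_mul,
    Real.mul_self_sqrt (hr j)]
  simp

theorem IsHilbertTensor.norm_sq_sum (hT : IsHilbertTensor T) (hr : ∀ j, 0 ≤ r j)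
    (hu : Orthonormal ℂ u) (F : Finset J) :
    ‖∑ j ∈ F, (√(r j) : ℂ) • T (d j) (u j)‖ ^ 2 = ∑ j ∈ F, r j * ‖d j‖ ^ 2 := by
  rw [← Complex.ofReal_inj]
  push_cast
  refine (inner_self_eq_norm_sq_to_K (𝕜 := ℂ)
    (∑ j ∈ F, (√(r j) : ℂ) • T (d j) (u j))).symm.trans ?_
  rw [sum_inner]
  refine Finset.sum_congr rfl fun j hj => ?_
  rw [inner_sum, Finset.sum_eq_single_of_mem j hj, hT.inner_sqrt_smul_sqrt_smul hr hu]
  · push_cast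
    rfl
  · intro k _ hk
    rw [inner_smul_left, inner_smul_right, hT.inner_apply, hu.2 hk.symm, mul_zero, mul_zero,
      mul_zero]

theorem IsHilbertTensor.sum_mul_norm_sq_le (hT : IsHilbertTensor T) (hr : ∀ j, 0 ≤ r j)
    (hu : Orthonormal ℂ u) {Φ : H} (hΦ : HasSum (fun j => (√(r j) : ℂ) • T (d j) (u j)) Φ)
    (F : Finset J) : ∑ j ∈ F, r j * ‖d j‖ ^ 2 ≤ ‖Φ‖ ^ 2 := by
  refine ge_of_tendsto ((Filter.Tendsto.norm hΦ).pow 2)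
    ((eventually_ge_atTop F).mono fun G hG => ?_)
  rw [hT.norm_sq_sum hr hu]
  exact Finset.sum_le_sum_of_subset_of_nonneg hG fun j _ _ => mul_nonneg (hr j) (sq_nonneg _)

theorem IsSchmidt.negMulLog_nonneg {φ : H} (hφ : IsSchmidt T φ r d u) (j : J) :
    0 ≤ Real.negMulLog (r j) :=
  Real.negMulLog_nonneg (hφ.pos j).le (le_hasSum hφ.hasSum_one j fun i _ => (hφ.pos i).le)

end SchmidtBessel

section FirstFactor

/-- `weylQuot ξ · t` as a continuous linear map. -/
def weylQuotCLM {κ : Type} [Fintype κ] (ξ : κ ⊕ κ → ℝ) (t : ℝ) : Modes κ →L[ℂ] Modes κ :=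
  (Complex.I * (t : ℂ))⁻¹ •
    ((weylIso (t • ξ)).toContinuousLinearMap - ContinuousLinearMap.id ℂ (Modes κ))

theorem weylQuotCLM_apply {κ : Type} [Fintype κ] (ξ : κ ⊕ κ → ℝ) (t : ℝ) (φ : Modes κ) :
    weylQuotCLM ξ t φ = weylQuot ξ φ t := rfl

theorem energy_eq_add {ι ν κ : Type} [Fintype ι] [Fintype ν] [Fintype κ] [DecidableEq κ]
    (e : ι ⊕ ν ≃ κ) (φ : Modes κ) :
    energy φ = 2⁻¹ * (∑ k : ι ⊕ ι, quadratureSq (k.map (e ∘ .inl) (e ∘ .inl)) φ +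
      ∑ k : ν ⊕ ν, quadratureSq (k.map (e ∘ .inr) (e ∘ .inr)) φ) := by
  rw [energy, ← (Equiv.sumCongr e e).sum_comp]
  simp only [Fintype.sum_sum_type, Equiv.sumCongr_apply, Sum.map_inl, Sum.map_inr,
    Function.comp_apply]
  congr 1
  ac_rfl

theorem quadratureSq_ne_top_of_energy_ne_top {κ : Type} [Fintype κ] [DecidableEq κ] {φ : Modes κ}
    (hfin : energy φ ≠ ⊤) (k : κ ⊕ κ) : quadratureSq k φ ≠ ⊤ := fun htop =>
  hfin <| by
    rw [energy, ENNReal.sum_eq_top.2 ⟨k, Finset.mem_univ k, htop⟩, ENNReal.mul_top (by simp)]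

theorem toReal_energy_eq_add {ι ν κ : Type} [Fintype ι] [Fintype ν] [Fintype κ] [DecidableEq κ]
    (e : ι ⊕ ν ≃ κ) {φ : Modes κ} (hfin : energy φ ≠ ⊤) :
    (energy φ).toReal =
      ((∑ k : ι ⊕ ι, (quadratureSq (k.map (e ∘ .inl) (e ∘ .inl)) φ).toReal) +
        (∑ k : ν ⊕ ν, quadratureSq (k.map (e ∘ .inr) (e ∘ .inr)) φ).toReal) / 2 := by
  have hquad := quadratureSq_ne_top_of_energy_ne_top hfin
  rw [energy_eq_add e, ENNReal.toReal_mul,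
    ENNReal.toReal_add (ENNReal.sum_ne_top.2 fun k _ => hquad _)
      (ENNReal.sum_ne_top.2 fun k _ => hquad _), ENNReal.toReal_sum fun k _ => hquad _,
    ENNReal.toReal_inv, ENNReal.toReal_ofNat]
  ring

theorem card_le_sum_quadratureSq {κ ν : Type} [Fintype κ] [DecidableEq κ] [Fintype ν]
    (f : ν → κ) {φ : Modes κ} (hφ : ‖φ‖ = 1) :
    (Fintype.card ν : ℝ≥0∞) ≤ ∑ k : ν ⊕ ν, quadratureSq (k.map f f) φ := by
  rw [Fintype.sum_sum_type, ← Finset.sum_add_distrib]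
  calc (Fintype.card ν : ℝ≥0∞) = ∑ _i : ν, 1 := by
        rw [Finset.sum_const, Finset.card_univ, nsmul_eq_mul, mul_one]
    _ ≤ _ := Finset.sum_le_sum fun i _ => one_le_quadratureSq_add hφ (f i)

variable {ι κ : Type} [Fintype ι] [DecidableEq ι] [Fintype κ] [DecidableEq κ]
  {H₂ : Type*} [NormedAddCommGroup H₂] [InnerProductSpace ℂ H₂]
  {T : Modes ι →L[ℂ] H₂ →L[ℂ] Modes κ}

/-- The quadratures of the modes `f i` act on the first factor of the tensor product `T`. This
covers both halves of a bipartition: `tensor` with `Sum.inl` and `tensor.flip` with `Sum.inr`. -/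
def ActsOnFirstFactor (T : Modes ι →L[ℂ] H₂ →L[ℂ] Modes κ) (f : ι → κ) : Prop :=
  ∀ (k : ι ⊕ ι) (t : ℝ) (φ : Modes ι) (χ : H₂),
    weylQuot (Pi.single (k.map f f) 1) (T φ χ) t = T (weylQuot (Pi.single k 1) φ t) χ

variable {f : ι → κ} {J : Type*} {r : J → ℝ} {v : J → Modes ι} {u : J → H₂} {φ : Modes κ}

theorem IsSchmidt.isSecondMomentBound (hT : IsHilbertTensor T) (hf : ActsOnFirstFactor T f)
    (hφ : IsSchmidt T φ r v u) (hfin : ∀ k : ι ⊕ ι, quadratureSq (k.map f f) φ ≠ ⊤) :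
    IsSecondMomentBound r v fun k => (quadratureSq (k.map f f) φ).toReal := by
  intro k
  obtain ⟨η, hη⟩ := exists_image_of_quadratureSq_ne_top (hfin k)
  refine ⟨fun t => ‖weylQuot (Pi.single (k.map f f) 1) φ t‖ ^ 2, ?_, fun F t _ => ?_⟩
  · beta_reduce
    rw [quadratureSq_eq hη, ENNReal.toReal_ofReal (sq_nonneg _)]
    exact hη.hasField.norm.pow 2
  · refine hT.sum_mul_norm_sq_le (fun j => (hφ.pos j).le) hφ.right ?_ F
    simpa only [map_smul, weylQuotCLM_apply, hf k t] using
      (weylQuotCLM (Pi.single (k.map f f) 1) t).hasSum hφ.hasSum_vec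

theorem IsSchmidt.summable_negMulLog (hT : IsHilbertTensor T) (hf : ActsOnFirstFactor T f)
    (hφ : IsSchmidt T φ r v u) (hfin : ∀ k : ι ⊕ ι, quadratureSq (k.map f f) φ ≠ ⊤) :
    Summable fun j => Real.negMulLog (r j) :=
  GaussianErgotropy.summable_negMulLog hφ.left hφ.pos hφ.hasSum_one
    (hφ.isSecondMomentBound hT hf hfin)

/-- As `c` depends on the Schmidt weights only, it serves all states obtained from each other by
local unitaries. -/
theorem exists_pos_tsum_negMulLog_add_le_energy [Nonempty ι] {ν : Type} [Fintype ν]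
    (e : ι ⊕ ν ≃ κ) (hT : IsHilbertTensor T) (hf : ActsOnFirstFactor T (e ∘ .inl))
    (hr : ∀ j, 0 < r j) (hr_sum : HasSum r 1) :
    ∃ c : ℝ, 0 < c ∧ ∀ (φ : Modes κ) (v : J → Modes ι) (u : J → H₂), IsSchmidt T φ r v u →
      ‖φ‖ = 1 → energy φ ≠ ⊤ →
        ∑' j, Real.negMulLog (r j) + c + Fintype.card ν / 2 ≤
          (energy φ).toReal + Fintype.card ι / 2 := by
  obtain ⟨c, hc, hbound⟩ := exists_pos_tsum_negMulLog_add_le (ι := ι) hr hr_sum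
  refine ⟨c, hc, fun φ v u hφ hnorm hfin => ?_⟩
  have hquad := quadratureSq_ne_top_of_energy_ne_top hfin
  have hentropy := hbound v _ hφ.left (hφ.isSecondMomentBound hT hf fun k => hquad _)
  have huncertainty : (Fintype.card ν : ℝ) ≤
      (∑ k : ν ⊕ ν, quadratureSq (k.map (e ∘ .inr) (e ∘ .inr)) φ).toReal := by
    simpa only [ENNReal.toReal_natCast] using ENNReal.toReal_mono
      (ENNReal.sum_ne_top.2 fun k _ => hquad _) (card_le_sum_quadratureSq (e ∘ .inr) hnorm)
  rw [toReal_energy_eq_add e hfin]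
  linarith

end FirstFactor

section Bipartition

variable {α β : Type}

theorem leftPart_smul (t : ℝ) (ξ : (α ⊕ β) ⊕ (α ⊕ β) → ℝ) :
    leftPart (t • ξ) = t • leftPart ξ := by
  ext (i | i) <;> rfl

theorem rightPart_smul (t : ℝ) (ξ : (α ⊕ β) ⊕ (α ⊕ β) → ℝ) :
    rightPart (t • ξ) = t • rightPart ξ := by
  ext (i | i) <;> rfl

section Single

variable [DecidableEq α] [DecidableEq β]

theorem leftPart_single_inl (k : α ⊕ α) :
    leftPart (Pi.single (k.map .inl .inl) 1 : (α ⊕ β) ⊕ (α ⊕ β) → ℝ) = Pi.single k 1 := by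
  ext (i | i) <;> rcases k with k | k <;> simp [leftPart, Pi.single_apply]

theorem rightPart_single_inl (k : α ⊕ α) :
    rightPart (Pi.single (k.map .inl .inl) 1 : (α ⊕ β) ⊕ (α ⊕ β) → ℝ) = 0 := by
  ext (i | i) <;> rcases k with k | k <;> simp [rightPart]

theorem leftPart_single_inr (k : β ⊕ β) :
    leftPart (Pi.single (k.map .inr .inr) 1 : (α ⊕ β) ⊕ (α ⊕ β) → ℝ) = 0 := by
  ext (i | i) <;> rcases k with k | k <;> simp [leftPart]

theorem rightPart_single_inr (k : β ⊕ β) :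
    rightPart (Pi.single (k.map .inr .inr) 1 : (α ⊕ β) ⊕ (α ⊕ β) → ℝ) = Pi.single k 1 := by
  ext (i | i) <;> rcases k with k | k <;> simp [rightPart, Pi.single_apply]

end Single

variable [Fintype α] [Fintype β] [DecidableEq α] [DecidableEq β]

theorem actsOnFirstFactor_tensor :
    ActsOnFirstFactor (tensor (α := α) (β := β)) (Equiv.refl (α ⊕ β) ∘ .inl) := by
  intro k t φ χ
  simp only [Equiv.coe_refl, Function.id_comp, weylQuot, weyl_tensor, leftPart_smul,
    rightPart_smul, leftPart_single_inl, rightPart_single_inl, smul_zero, weyl_zero, map_smul,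
    map_sub, smul_apply, sub_apply]

theorem actsOnFirstFactor_tensor_flip :
    ActsOnFirstFactor (tensor (α := α) (β := β)).flip (Equiv.sumComm β α ∘ .inl) := by
  intro k t χ φ
  have hcomp : (Equiv.sumComm β α ∘ .inl : β → α ⊕ β) = .inr := rfl
  simp only [hcomp, ContinuousLinearMap.flip_apply, weylQuot, weyl_tensor, leftPart_smul,
    rightPart_smul, leftPart_single_inr, rightPart_single_inr, smul_zero, weyl_zero, map_smul,
    map_sub, smul_apply, sub_apply]

theorem isLocalGaussianUnitary_refl :
    IsLocalGaussianUnitary (LinearIsometryEquiv.refl ℂ (Modes (α ⊕ β))) := by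
  have hrefl : ∀ {ι : Type} [Fintype ι] [DecidableEq ι],
      IsGaussianUnitary (LinearIsometryEquiv.refl ℂ (Modes ι)) := fun {ι} _ _ =>
    ⟨1, one_mem _, 0, fun ξ φ => by simp⟩
  exact ⟨_, _, hrefl, hrefl, fun _ _ => rfl⟩

theorem localMinEnergy_le (ψ : Modes (α ⊕ β)) : localMinEnergy ψ ≤ energy ψ :=
  iInf₂_le (LinearIsometryEquiv.refl ℂ (Modes (α ⊕ β))) isLocalGaussianUnitary_refl

theorem le_toReal_localMinEnergy {ψ : Modes (α ⊕ β)} (hψ : energy ψ ≠ ⊤) {B : ℝ}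
    (hB : ∀ U : Modes (α ⊕ β) ≃ₗᵢ[ℂ] Modes (α ⊕ β), IsLocalGaussianUnitary U →
      energy (U ψ) ≠ ⊤ → B ≤ (energy (U ψ)).toReal) : B ≤ (localMinEnergy ψ).toReal := by
  refine (ENNReal.ofReal_le_iff_le_toReal (ne_top_of_le_ne_top hψ (localMinEnergy_le ψ))).1
    (le_iInf₂ fun U hU => ?_)
  by_cases htop : energy (U ψ) = ⊤
  · rw [htop]
    exact le_top
  · exact (ENNReal.ofReal_le_iff_le_toReal htop).2 (hB U hU htop)

variable {J : Type*} {r : J → ℝ} {v : J → Modes α} {u : J → Modes β} {ψ : Modes (α ⊕ β)}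

theorem IsLocalGaussianUnitary.exists_isSchmidt {U : Modes (α ⊕ β) ≃ₗᵢ[ℂ] Modes (α ⊕ β)}
    (hU : IsLocalGaussianUnitary U) (hψ : IsSchmidt tensor ψ r v u) :
    ∃ v' u', IsSchmidt tensor (U ψ) r v' u' := by
  obtain ⟨U₁, U₂, -, -, hU⟩ := hU
  refine ⟨fun j => U₁ (v j), fun j => U₂ (u j), hψ.left.comp_linearIsometryEquiv U₁,
    hψ.right.comp_linearIsometryEquiv U₂, hψ.pos, hψ.hasSum_one, ?_⟩
  have himage : ∀ j, (√(r j) : ℂ) • tensor (U₁ (v j)) (U₂ (u j)) =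
      U ((√(r j) : ℂ) • tensor (v j) (u j)) := fun j => by rw [map_smul, hU]
  simp only [himage]
  exact U.toContinuousLinearEquiv.toContinuousLinearMap.hasSum hψ.hasSum_vec

theorem IsSchmidt.tsum_negMulLog_lt_localMinEnergy_left [Nonempty α] (hψ : IsSchmidt tensor ψ r v u)
    (hnorm : ‖ψ‖ = 1) (hfin : energy ψ ≠ ⊤) :
    ∑' j, Real.negMulLog (r j) + Fintype.card β / 2 <
      (localMinEnergy ψ).toReal + Fintype.card α / 2 := by
  obtain ⟨c, hc, hbound⟩ := exists_pos_tsum_negMulLog_add_le_energy (Equiv.refl (α ⊕ β))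
    isHilbertTensor_tensor actsOnFirstFactor_tensor hψ.pos hψ.hasSum_one
  have hmin := le_toReal_localMinEnergy hfin
    (B := ∑' j, Real.negMulLog (r j) + c + Fintype.card β / 2 - Fintype.card α / 2)
    fun U hU hU_fin => by
      obtain ⟨v', u', hUψ⟩ := hU.exists_isSchmidt hψ
      linarith [hbound _ v' u' hUψ (by rw [LinearIsometryEquiv.norm_map, hnorm]) hU_fin]
  linarith

theorem IsSchmidt.tsum_negMulLog_lt_localMinEnergy_right [Nonempty β]
    (hψ : IsSchmidt tensor ψ r v u) (hnorm : ‖ψ‖ = 1) (hfin : energy ψ ≠ ⊤) :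
    ∑' j, Real.negMulLog (r j) + Fintype.card α / 2 <
      (localMinEnergy ψ).toReal + Fintype.card β / 2 := by
  obtain ⟨c, hc, hbound⟩ := exists_pos_tsum_negMulLog_add_le_energy (Equiv.sumComm β α)
    isHilbertTensor_tensor.flip actsOnFirstFactor_tensor_flip hψ.pos hψ.hasSum_one
  have hmin := le_toReal_localMinEnergy hfin
    (B := ∑' j, Real.negMulLog (r j) + c + Fintype.card α / 2 - Fintype.card β / 2)
    fun U hU hU_fin => by
      obtain ⟨v', u', hUψ⟩ := hU.exists_isSchmidt hψ
      linarith [hbound _ u' v' hUψ.flip (by rw [LinearIsometryEquiv.norm_map, hnorm]) hU_fin]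
  linarith

theorem IsSchmidt.vonNeumannEntropy_reducedRight (hψ : IsSchmidt tensor ψ r v u)
    (hfin : energy ψ ≠ ⊤) : vonNeumannEntropy (reducedRight (pureState ψ)) =
      ENNReal.ofReal (∑' j, Real.negMulLog (r j)) := by
  rw [ENNReal.ofReal_tsum_of_nonneg hψ.negMulLog_nonneg
    (hψ.summable_negMulLog isHilbertTensor_tensor actsOnFirstFactor_tensor
      fun k => quadratureSq_ne_top_of_energy_ne_top hfin _)]
  exact hψ.vonNeumannEntropy_reducedOp (basis (Modes α)) isHilbertTensor_tensor

theorem IsSchmidt.vonNeumannEntropy_reducedLeft (hψ : IsSchmidt tensor ψ r v u)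
    (hfin : energy ψ ≠ ⊤) : vonNeumannEntropy (reducedLeft (pureState ψ)) =
      ENNReal.ofReal (∑' j, Real.negMulLog (r j)) := by
  rw [ENNReal.ofReal_tsum_of_nonneg hψ.negMulLog_nonneg
    (hψ.summable_negMulLog isHilbertTensor_tensor actsOnFirstFactor_tensor
      fun k => quadratureSq_ne_top_of_energy_ne_top hfin _)]
  exact hψ.flip.vonNeumannEntropy_reducedOp (basis (Modes β)) isHilbertTensor_tensor.flip

theorem IsSchmidt.half_mutualInformation (hψ : IsSchmidt tensor ψ r v u) (hnorm : ‖ψ‖ = 1)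
    (hfin : energy ψ ≠ ⊤) :
    (1 / 2 : ℝ) * mutualInformation (pureState ψ) = ∑' j, Real.negMulLog (r j) := by
  rw [mutualInformation, hψ.vonNeumannEntropy_reducedLeft hfin,
    hψ.vonNeumannEntropy_reducedRight hfin, vonNeumannEntropy_pureState hnorm,
    ENNReal.toReal_ofReal (tsum_nonneg hψ.negMulLog_nonneg), ENNReal.toReal_zero]
  ring

theorem IsPureGaussianWithCov.toReal_globalMinEnergy_le
    {Γ : Matrix ((α ⊕ β) ⊕ (α ⊕ β)) ((α ⊕ β) ⊕ (α ⊕ β)) ℝ} (hψ : IsPureGaussianWithCov ψ Γ) :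
    (globalMinEnergy ψ).toReal ≤ (Fintype.card α + Fintype.card β) / 2 := by
  rw [← Nat.cast_add, ← Fintype.card_sum]
  exact ENNReal.toReal_le_of_le_ofReal (by positivity) hψ.globalMinEnergy_le

end Bipartition

end GaussianErgotropy

end

/-- For every pure (displacement-free) Gaussian state `ψ` of modes split as `α | β`, each side with at
least one mode, half the mutual information is less than the 2-local ergotropic gap plus the smaller
number of modes. The first four conjuncts say that the entropies and energies involved are finite. -/
theorem mainTheorem11 {α β : Type} [Fintype α] [Fintype β] [DecidableEq α] [DecidableEq β]
    [Nonempty α] [Nonempty β] (ψ : GaussianErgotropy.Modes (α ⊕ β))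
    (hψ : GaussianErgotropy.IsPureGaussian ψ) :
    GaussianErgotropy.vonNeumannEntropy
        (GaussianErgotropy.reducedLeft (GaussianErgotropy.pureState ψ)) ≠ ⊤ ∧
    GaussianErgotropy.vonNeumannEntropy
        (GaussianErgotropy.reducedRight (GaussianErgotropy.pureState ψ)) ≠ ⊤ ∧
    GaussianErgotropy.vonNeumannEntropy (GaussianErgotropy.pureState ψ) ≠ ⊤ ∧
    GaussianErgotropy.energy ψ ≠ ⊤ ∧
    (1 / 2 : ℝ) * GaussianErgotropy.mutualInformation (GaussianErgotropy.pureState ψ) <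
      GaussianErgotropy.ergotropicGap ψ + ((min (Fintype.card α) (Fintype.card β) : ℕ) : ℝ) := by
  obtain ⟨Γ, hΓ⟩ := hψ
  have hnorm : ‖ψ‖ = 1 := hΓ.1
  have hfin : GaussianErgotropy.energy ψ ≠ ⊤ := hΓ.energy_eq ▸ ENNReal.ofReal_ne_top
  obtain ⟨J, r, v, u, hschmidt⟩ := GaussianErgotropy.isHilbertTensor_tensor.exists_schmidt hnorm
  have hpure := GaussianErgotropy.vonNeumannEntropy_pureState hnorm
  refine ⟨hschmidt.vonNeumannEntropy_reducedLeft hfin ▸ ENNReal.ofReal_ne_top,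
    hschmidt.vonNeumannEntropy_reducedRight hfin ▸ ENNReal.ofReal_ne_top,
    hpure ▸ ENNReal.zero_ne_top, hfin, ?_⟩
  have hglobal := hΓ.toReal_globalMinEnergy_le
  have hleft := hschmidt.tsum_negMulLog_lt_localMinEnergy_left hnorm hfin
  have hright := hschmidt.tsum_negMulLog_lt_localMinEnergy_right hnorm hfin
  rw [hschmidt.half_mutualInformation hnorm hfin, GaussianErgotropy.ergotropicGap,
    GaussianErgotropy.globalErgotropy, GaussianErgotropy.localErgotropy]
  rcases min_choice (Fintype.card α) (Fintype.card β) with hmin | hmin <;> rw [hmin] <;> linarith
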